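/- Let $\mathcal H$ be a finite-dimensional complex Hilbert space, $S\subset\mathcal H$ a subspace, $\bar S=S^\perp$, $\dim S,\dim\bar S\ge 2$, $P_K$ the orthogonal projection onto $K$, and $T>0$. Let $H(s)$, $\Delta(s)$, $s\in[0,1]$, be Hermitian operators on $\mathcal H$ with $H$ twice differentiable, $\Delta$ differentiable, $[H(s),P_S]=0$ (block diagonal) and $\Delta(s)P_S=P_{\bar S}\Delta(s)$ (block antidiagonal). Norms are operator norms and dots are derivatives in $s$. Let * $\lambda(s)$ be the smallest eigenvalue of $H+\Delta$, and $\mu<\mu_1$, $\bar\mu<\bar\mu_1$ the two smallest eigenvalues of $H|_S$ and of $H|_{\bar S}$; suppose that $\lambda,\mu,\bar\mu$ are simple for all $s$; * $\Gamma_S=\mu_1-\mu$, $\Gamma_{\bar S}=\bar\mu_1-\bar\mu$, $m=\min\{\Gamma_S,\Gamma_{\bar S}\}$; * $P_\mu,P_{\bar\mu}$ be the projections onto the ground spaces of $H|_S$ and $H|_{\bar S}$, $\mathcal M^\perp=I-P_\mu-P_{\bar\mu}$, $\Delta^\perp=\mathcal M^\perp\Delta\mathcal M^\perp$, $H_S=P_SHP_S$,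 $H_{\bar S}=P_{\bar S}HP_{\bar S}$; * $\vec\lambda(s)$ be a normalized ground vector of $H+\Delta$; suppose that $P_S\vec\lambda(s)\ne0$ and $P_{\bar S}\vec\lambda(s)\neq 0$ for all $s$, and let $$h=-\frac{\langle\vec\lambda,\Delta P_S\vec\lambda\rangle}{\min\{\langle\vec\lambda,P_S\vec\lambda\rangle,\langle\vec\lambda,P_{\bar S}\vec\lambda\rangle\}}$$ be the Cheeger ratio; * $c=\|\Delta\|/m$, $\eta=1-\|\Delta^\perp\|/m$, $\kappa=\|H+\Delta-\lambda\|$. Assume for all $s\in[0,1]$ that (1) $\min\{\mu_1,\bar\mu_1\}>\max\{\mu,\bar\mu\}$ and (2) $c\le 1-h/m$. Let $U,U'_\perp,V_{\mathrm{ad}}$ be the solutions on $[0,1]$, with value $I$ at $s=0$, of $$i\dot U=T(H+\Delta)U,\qquad i\dot U'_\perp=T\bigl(H+(\mu-\bar\mu)P_{\bar S}+\Delta^\perp\bigr)U'_\perp,\qquad i\dot V_{\mathrm{ad}}=\bigl(TH+i[\dot P_\mu,P_\mu]\bigr)V_{\mathrm{ad}}.$$ Let $\Pi(s)$ be the spectral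 projection of $H(s)+\Delta(s)$ onto $(-\infty,\lambda(s)+2h(s)]$ and put $$\epsilon_T(s)=\max\bigl\{\|(I-\Pi(s))U(s)\Pi(0)\|,\ \|\mathcal M^\perp(s)U'_\perp(s)P_\mu(0)\|\bigr\},$$ $$q(s)=\sqrt{\frac{2h(s)}{(1-c(s))\,m(s)}},\qquad \bar q(s)=\tfrac12\bigl(q(0)+q(s)\bigr),$$ $$B=1+\bar q+\bar q\sqrt{\frac{\kappa}{h}}+\epsilon_T\Bigl(1+\sqrt{\frac{\kappa}{h}}\Bigr),\qquad C_1=2\frac{\|\dot H_S\|}{\Gamma_S^2},$$ $$C_2=\frac{\|\ddot H_S\|}{\Gamma_S^2}+10\frac{\|\dot H_S^2\|}{\Gamma_S^3}+\frac1\eta\frac{\|\dot H_S\|}{\Gamma_S^2}\left(\frac{\|\tfrac{d}{ds}\Delta^\perp\|}{m}+4\|\Delta^\perp\|\max\left\{\frac{\|\dot H_S\|}{\Gamma_S^2},\frac{2\|\dot H_{\bar S}\|+\|\dot H_S\|}{\Gamma_{\bar S}^2}\right\}\right).$$ Then $$\bigl\|(U(1)-V_{\mathrm{ad}}(1))P_\mu(0)\bigr\|\le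 \sup_{s\in[0,1]}2\sqrt{hTB}+\sup_{s\in[0,1]}\frac{C_1}{\eta T}+\sup_{s\in[0,1]}\frac{C_2}{\eta T}.$$ -/

import Mathlib

open Set

noncomputable section

namespace LocalAdiabatic

variable {E : Type*} [NormedAddCommGroup E] [InnerProductSpace ℂ E] [FiniteDimensional ℂ E]

/-! ### Spectral data of one Hermitian operator on an invariant subspace -/

/-- The real eigenvalues of `A` that have an eigenvector in `K`; for a Hermitian `A` that leaves
`K` invariant this is the spectrum of the restriction of `A` to `K`. -/
def spectrumOn (K : Submodule ℂ E) (A : E →L[ℂ] E) : Set ℝ :=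
  {x : ℝ | ∃ v ∈ K, v ≠ 0 ∧ A v = (x : ℂ) • v}

/-- The smallest eigenvalue of `A` on `K`. -/
def groundEnergy (K : Submodule ℂ E) (A : E →L[ℂ] E) : ℝ :=
  sInf (spectrumOn K A)

/-- The second smallest eigenvalue of `A` on `K`. -/
def excitedEnergy (K : Submodule ℂ E) (A : E →L[ℂ] E) : ℝ :=
  sInf (spectrumOn K A \ {groundEnergy K A})

/-- The eigenvalue gap of `A` on `K`. -/
def gap (K : Submodule ℂ E) (A : E →L[ℂ] E) : ℝ :=
  excitedEnergy K A - groundEnergy K A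

/-- The eigenspace of `A` for the eigenvalue `x`. -/
def eigenSubspace (A : E →L[ℂ] E) (x : ℝ) : Submodule ℂ E :=
  Module.End.eigenspace (A : E →ₗ[ℂ] E) (x : ℂ)

/-- The ground space of `A` on `K`. -/
def groundSpace (K : Submodule ℂ E) (A : E →L[ℂ] E) : Submodule ℂ E :=
  K ⊓ eigenSubspace A (groundEnergy K A)

/-- The orthogonal projection onto the ground space of `A` on `K`. -/
def groundProj (K : Submodule ℂ E) (A : E →L[ℂ] E) : E →L[ℂ] E :=
  (groundSpace K A).starProjection

/-- The spectral projection of a Hermitian operator `A` onto the interval `(-∞, b]`. -/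
def lowProj (A : E →L[ℂ] E) (b : ℝ) : E →L[ℂ] E :=
  (⨆ x : Set.Iic b, eigenSubspace A (x : ℝ)).starProjection

/-! ### Quantities attached to a block-diagonal `H` and a block-antidiagonal `Δ` -/

/-- The block `P_K A P_K`. -/
def block (K : Submodule ℂ E) (A : E →L[ℂ] E) : E →L[ℂ] E :=
  K.starProjection * A * K.starProjection

/-- The smaller one of the two local gaps. -/
def minGap (S : Submodule ℂ E) (H : E →L[ℂ] E) : ℝ :=
  min (gap S H) (gap Sᗮ H)

/-- `I - P_μ - P_μbar`, the projection away from the two local ground spaces. -/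
def awayProj (S : Submodule ℂ E) (H : E →L[ℂ] E) : E →L[ℂ] E :=
  1 - groundProj S H - groundProj Sᗮ H

/-- The perturbation projected away from the two local ground spaces. -/
def perpPart (S : Submodule ℂ E) (H Δ : E →L[ℂ] E) : E →L[ℂ] E :=
  awayProj S H * Δ * awayProj S H

/-- `H' = H + (μ - μbar) P_Sbar`, which has the same smallest eigenvalue on both blocks. -/
def aligned (S : Submodule ℂ E) (H : E →L[ℂ] E) : E →L[ℂ] E :=
  H + ((groundEnergy S H - groundEnergy Sᗮ H : ℝ) : ℂ) • Sᗮ.starProjection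

open Classical in
/-- The Cheeger ratio, for a ground vector `v` of `H + Δ`. -/
def cheegerRatio (S : Submodule ℂ E) (Δ : E →L[ℂ] E) (v : E) : ℝ :=
  if min (inner ℂ v (S.starProjection v)).re (inner ℂ v (Sᗮ.starProjection v)).re ≠ 0 then
    -(inner ℂ v (Δ (S.starProjection v))).re /
      min (inner ℂ v (S.starProjection v)).re (inner ℂ v (Sᗮ.starProjection v)).re
  else 0

/-- `c = ‖Δ‖ / min(Γ_S, Γ_Sbar)`. -/
def relSize (S : Submodule ℂ E) (H Δ : E →L[ℂ] E) : ℝ :=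
  ‖Δ‖ / minGap S H

/-- `η = 1 - ‖Δ^⊥‖ / min(Γ_S, Γ_Sbar)`. -/
def eta (S : Submodule ℂ E) (H Δ : E →L[ℂ] E) : ℝ :=
  1 - ‖perpPart S H Δ‖ / minGap S H

/-- `κ = ‖H + Δ - λ‖`. -/
def kappa (H Δ : E →L[ℂ] E) : ℝ :=
  ‖H + Δ - ((groundEnergy ⊤ (H + Δ) : ℝ) : ℂ) • (1 : E →L[ℂ] E)‖

/-- `√(2h / ((1 - c) min(Γ_S, Γ_Sbar)))`. -/
def mismatch (S : Submodule ℂ E) (H Δ : E →L[ℂ] E) (v : E) : ℝ :=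
  √(2 * cheegerRatio S Δ v / ((1 - relSize S H Δ) * minGap S H))

/-! ### Evolutions and quantities attached to a family over `[0,1]` -/

/-- The derivative with respect to the parameter `s ∈ [0,1]`, one-sided at the end points. -/
def dot {F : Type*} [NormedAddCommGroup F] [NormedSpace ℝ F] (A : ℝ → F) : ℝ → F :=
  derivWithin A (Icc (0 : ℝ) 1)

/-- `U` solves `i U' = G U` on `[0,1]` with `U(0) = I`. -/
def IsEvolution (G U : ℝ → E →L[ℂ] E) : Prop :=
  U 0 = 1 ∧ ∀ s ∈ Icc (0 : ℝ) 1,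
    HasDerivWithinAt U (-Complex.I • (G s * U s)) (Icc (0 : ℝ) 1) s

/-- The generator `T (H + Δ)` of the true evolution `U`. -/
def trueGenerator (T : ℝ) (H Δ : ℝ → E →L[ℂ] E) (s : ℝ) : E →L[ℂ] E :=
  (T : ℂ) • (H s + Δ s)

/-- The generator `T (H' + Δ^⊥)` of the auxiliary evolution. -/
def perpGenerator (T : ℝ) (S : Submodule ℂ E) (H Δ : ℝ → E →L[ℂ] E) (s : ℝ) : E →L[ℂ] E :=
  (T : ℂ) • (aligned S (H s) + perpPart S (H s) (Δ s))

/-- The generator `T H + i [P_μ', P_μ]` of the adiabatic evolution. -/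
def adiabaticGenerator (T : ℝ) (S : Submodule ℂ E) (H : ℝ → E →L[ℂ] E) (s : ℝ) : E →L[ℂ] E :=
  (T : ℂ) • H s + Complex.I •
    (dot (fun t => groundProj S (H t)) s * groundProj S (H s)
      - groundProj S (H s) * dot (fun t => groundProj S (H t)) s)

/-- `Π(s)`, the spectral projection of `H + Δ` onto `(-∞, λ + 2h]`. -/
def globalLowProj (S : Submodule ℂ E) (H Δ : ℝ → E →L[ℂ] E) (ψ : ℝ → E) (s : ℝ) : E →L[ℂ] E :=
  lowProj (H s + Δ s) (groundEnergy ⊤ (H s + Δ s) + 2 * cheegerRatio S (Δ s) (ψ s))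

/-- The leakage `ε_T(s)`: the larger one of `‖Π(s)^⊥ U(s) Π(0)‖` and
`‖(I - P_μ(s) - P_μbar(s)) W(s) P_μ(0)‖`, where `U` is the true and `W` the auxiliary evolution. -/
def leakage (S : Submodule ℂ E) (H Δ : ℝ → E →L[ℂ] E) (ψ : ℝ → E) (U W : ℝ → E →L[ℂ] E)
    (s : ℝ) : ℝ :=
  max ‖(1 - globalLowProj S H Δ ψ s) * U s * globalLowProj S H Δ ψ 0‖
    ‖awayProj S (H s) * W s * groundProj S (H 0)‖

/-- The mean of the values of `√(2h / ((1 - c) min(Γ_S, Γ_Sbar)))` at the times `0` and `s`. -/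
def meanMismatch (S : Submodule ℂ E) (H Δ : ℝ → E →L[ℂ] E) (ψ : ℝ → E) (s : ℝ) : ℝ :=
  (mismatch S (H 0) (Δ 0) (ψ 0) + mismatch S (H s) (Δ s) (ψ s)) / 2

/-- The factor `B = 1 + q + q √(κ/h) + ε_T (1 + √(κ/h))`, where `q` is the mean mismatch. If the
mismatch has the same value at `0` and at `s`, then `q = √(2h / ((1 - c) min(Γ_S, Γ_Sbar)))` and
`q √(κ/h) = √(2κ / ((1 - c) min(Γ_S, Γ_Sbar)))`. -/
def tunnelFactor (S : Submodule ℂ E) (H Δ : ℝ → E →L[ℂ] E) (ψ : ℝ → E) (U W : ℝ → E →L[ℂ] E)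
    (s : ℝ) : ℝ :=
  1 + meanMismatch S H Δ ψ s
    + meanMismatch S H Δ ψ s * √(kappa (H s) (Δ s) / cheegerRatio S (Δ s) (ψ s))
    + leakage S H Δ ψ U W s * (1 + √(kappa (H s) (Δ s) / cheegerRatio S (Δ s) (ψ s)))

/-- The first summand of `C`: `2 ‖H_S'‖ / Γ_S²`. -/
def adiabaticBoundary (S : Submodule ℂ E) (H : ℝ → E →L[ℂ] E) (s : ℝ) : ℝ :=
  2 * (‖dot (fun t => block S (H t)) s‖ / gap S (H s) ^ 2)

/-- The sum of the remaining summands of `C`. -/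
def adiabaticBulk (S : Submodule ℂ E) (H Δ : ℝ → E →L[ℂ] E) (s : ℝ) : ℝ :=
  ‖dot (dot (fun t => block S (H t))) s‖ / gap S (H s) ^ 2
    + 10 * (‖dot (fun t => block S (H t)) s ^ 2‖ / gap S (H s) ^ 3)
    + 1 / eta S (H s) (Δ s) * (‖dot (fun t => block S (H t)) s‖ / gap S (H s) ^ 2) *
      (‖dot (fun t => perpPart S (H t) (Δ t)) s‖ / minGap S (H s)
        + 4 * ‖perpPart S (H s) (Δ s)‖ *
          max (‖dot (fun t => block S (H t)) s‖ / gap S (H s) ^ 2)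
            ((2 * ‖dot (fun t => block Sᗮ (H t)) s‖ + ‖dot (fun t => block S (H t)) s‖)
              / gap Sᗮ (H s) ^ 2))

end LocalAdiabatic

end

open Set

set_option linter.unusedSectionVars false

noncomputable section

namespace LocalAdiabatic

variable {E : Type*} [NormedAddCommGroup E] [InnerProductSpace ℂ E] [FiniteDimensional ℂ E]

/-! The auxiliary evolution `W`, generated by T(H' + Δ^⊥), is an intermediary. In this generator the
local ground vectors are decoupled from everything else. The triangle inequality bounds U - V by a
tunneling error U - W and an adiabatic error W - V, both applied to the ground space of H on S.

Tunneling error (`norm_true_sub_auxiliary_le`). The derivative of ‖Ux - Wx‖² is at most 2T times the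
matrix element of (H + Δ) - (H' + Δ^⊥) between Ux and Wx. Only this mixed matrix element enters, so
it helps that both vectors stay near the local ground spaces. Write p, r for the components of the
ground vector in S and its complement. The form of H + Δ - λ at αp + βr is exactly |α - β|² Q, where
Q is the numerator of h (`form_combination`). Two consequences follow. (a) Both μ and μbar lie in
[λ, λ + h]. Cauchy-Schwarz for the positive form H + Δ - λ bounds the coupling between the local
ground vectors by h, and their coupling to the rest by √(κh). This is `norm_inner_difference_le`.
(b) If 2h < m - ‖Δ‖, exactly two levels lie below λ + 2h and the others are at least λ + m - ‖Δ‖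
(`low_levels`). The low-energy plane and the span of the local ground vectors are then close, with
error `mismatch`; otherwise `mismatch` is at least 1 and the estimates are trivial. Hence leakage
out of the low-energy space controls leakage out of the local ground spaces.

Adiabatic error (`norm_auxiliary_sub_adiabatic_le`). The adiabatic evolution keeps its vector in the
range of P_μ, where H' + Δ^⊥ acts as μ. With R, Rbar the reduced resolvents of the two blocks, Z =
(1 + (R + Rbar)Δ^⊥)⁻¹ R² Ḣ_S P_μ solves (H' + Δ^⊥ - μ) Z = -Ṗ_μ P_μ. Correcting V by (i/T) Z V
therefore removes the forcing of order one. What remains is Z at the two end points and the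
derivative of Z on the ground space, all divided by T. The constants come from exact increment
identities for P and R (`P_sub_P`, `R_sub_R`), which yield their derivatives, and from orthogonality
of the blocks, which replaces sums of norms by maxima. -/

theorem re_inner_self (x : E) : (inner ℂ x x).re = ‖x‖ ^ 2 :=
  inner_self_eq_norm_sq (𝕜 := ℂ) x

/-! ### Rayleigh quotients on invariant subspaces -/

/-- On an invariant subspace, the quadratic form is bounded below by any lower bound of the
spectrum. -/
theorem mul_norm_sq_le_of_le_spectrumOn {K : Submodule ℂ E} {A : E →L[ℂ] E}
    (hA : (A : E →ₗ[ℂ] E).IsSymmetric) (hK : ∀ x ∈ K, A x ∈ K) {g : ℝ}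
    (hg : ∀ e ∈ spectrumOn K A, g ≤ e) {x : E} (hx : x ∈ K) :
    g * ‖x‖ ^ 2 ≤ (inner ℂ x (A x)).re := by
  have hT := hA.restrict_invariant (V := K) hK
  set b := hT.eigenvectorBasis rfl with hb
  set y : K := ⟨x, hx⟩ with hy
  have key : ∀ i, inner ℂ (b i) ((A : E →ₗ[ℂ] E).restrict hK y)
      = (hT.eigenvalues rfl i : ℂ) * inner ℂ (b i) y := by
    intro i
    rw [← hT (b i) y, hb, hT.apply_eigenvectorBasis, inner_smul_left]
    simp
  have e1 : inner ℂ x (A x) = inner ℂ y ((A : E →ₗ[ℂ] E).restrict hK y) := rfl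
  have e2 : ‖x‖ ^ 2 = ∑ i, ‖inner ℂ (b i) y‖ ^ 2 := by
    rw [b.sum_sq_norm_inner_right]; rfl
  rw [e1, e2, ← b.sum_inner_mul_inner, Complex.re_sum, Finset.mul_sum]
  refine Finset.sum_le_sum fun i _ => ?_
  have hi : g ≤ hT.eigenvalues rfl i := by
    refine hg _ ⟨(b i : E), (b i).2, ?_, ?_⟩
    · intro h0
      have : b i = 0 := Subtype.ext h0
      have h1 := b.orthonormal.1 i
      rw [this, norm_zero] at h1
      exact zero_ne_one h1
    · have := congrArg Subtype.val (hT.apply_eigenvectorBasis rfl i)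
      exact this
  rw [key, mul_left_comm, ← inner_conj_symm y (b i), Complex.conj_mul', Complex.re_ofReal_mul]
  norm_cast
  exact mul_le_mul_of_nonneg_right hi (sq_nonneg _)

theorem abs_le_norm_of_mem_spectrumOn {K : Submodule ℂ E} {A : E →L[ℂ] E} {e : ℝ}
    (he : e ∈ spectrumOn K A) : |e| ≤ ‖A‖ := by
  obtain ⟨v, -, hv, h⟩ := he
  have h1 := A.le_opNorm v
  rw [h, norm_smul, Complex.norm_real, Real.norm_eq_abs] at h1
  exact le_of_mul_le_mul_right h1 (norm_pos_iff.2 hv)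

theorem bddBelow_spectrumOn (K : Submodule ℂ E) (A : E →L[ℂ] E) : BddBelow (spectrumOn K A) :=
  ⟨-‖A‖, fun _ he => (abs_le.1 (abs_le_norm_of_mem_spectrumOn he)).1⟩

theorem groundEnergy_mul_le {K : Submodule ℂ E} {A : E →L[ℂ] E}
    (hA : (A : E →ₗ[ℂ] E).IsSymmetric) (hK : ∀ x ∈ K, A x ∈ K) {x : E} (hx : x ∈ K) :
    groundEnergy K A * ‖x‖ ^ 2 ≤ (inner ℂ x (A x)).re :=
  mul_norm_sq_le_of_le_spectrumOn hA hK (fun _ he => csInf_le (bddBelow_spectrumOn K A) he) hx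

theorem mem_groundSpace {K : Submodule ℂ E} {A : E →L[ℂ] E} {x : E} :
    x ∈ groundSpace K A ↔ x ∈ K ∧ A x = (groundEnergy K A : ℂ) • x := by
  rw [groundSpace, Submodule.mem_inf, eigenSubspace, Module.End.mem_eigenspace_iff]
  rfl

theorem excitedEnergy_mul_le {K : Submodule ℂ E} {A : E →L[ℂ] E}
    (hA : (A : E →ₗ[ℂ] E).IsSymmetric) (hK : ∀ x ∈ K, A x ∈ K) {x : E} (hx : x ∈ K)
    (hx' : x ∈ (groundSpace K A)ᗮ) :
    excitedEnergy K A * ‖x‖ ^ 2 ≤ (inner ℂ x (A x)).re := by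
  refine mul_norm_sq_le_of_le_spectrumOn (K := K ⊓ (groundSpace K A)ᗮ) hA ?_ ?_ ⟨hx, hx'⟩
  · rintro y ⟨hy, hy'⟩
    refine ⟨hK y hy, ?_⟩
    intro v hv
    have h1 : inner ℂ (A v) y = inner ℂ v (A y) := hA v y
    rw [← h1, (mem_groundSpace.1 hv).2, inner_smul_left, hy' v hv, mul_zero]
  · rintro e ⟨v, ⟨hv, hv'⟩, h0, h⟩
    refine csInf_le ((bddBelow_spectrumOn K A).mono sdiff_subset) ⟨⟨v, hv, h0, h⟩, ?_⟩
    rintro rfl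
    exact h0 (inner_self_eq_zero.1 (hv' v (mem_groundSpace.2 ⟨hv, h⟩)))

theorem gap_mul_le {K : Submodule ℂ E} {A : E →L[ℂ] E}
    (hA : (A : E →ₗ[ℂ] E).IsSymmetric) (hK : ∀ x ∈ K, A x ∈ K) {x : E} (hx : x ∈ K)
    (hx' : x ∈ (groundSpace K A)ᗮ) :
    gap K A * ‖x‖ ^ 2 ≤ (inner ℂ x (A x - (groundEnergy K A : ℂ) • x)).re := by
  have := excitedEnergy_mul_le hA hK hx hx'
  rw [inner_sub_right, inner_smul_right, gap, Complex.sub_re, Complex.re_ofReal_mul,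
    re_inner_self]
  linarith

/-! ### Positive forms -/

/-- Cauchy-Schwarz for the form of a positive symmetric operator. -/
theorem norm_inner_sq_le_of_nonneg {A : E →L[ℂ] E} (hA : (A : E →ₗ[ℂ] E).IsSymmetric)
    (hpos : ∀ x, 0 ≤ (inner ℂ x (A x)).re) (x y : E) :
    ‖inner ℂ x (A y)‖ ^ 2 ≤ (inner ℂ x (A x)).re * (inner ℂ y (A y)).re := by
  set z := inner ℂ x (A y) with hz
  have hsy : ∀ u v, inner ℂ (A u) v = inner ℂ u (A v) := fun u v => hA u v
  have hyx : inner ℂ y (A x) = (starRingEnd ℂ) z := by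
    rw [hz, inner_conj_symm, hsy]
  have key : ∀ t : ℝ, 0 ≤ ‖z‖ ^ 2 * (inner ℂ x (A x)).re * (t * t)
      + (2 * ‖z‖ ^ 2) * t + (inner ℂ y (A y)).re := by
    intro t
    -- The factor z aligns the phase, so the cross terms add up to 2t‖z‖². Nonnegativity for all
    -- real t is then a discriminant inequality, from which ‖z‖² is cancelled.
    have h := hpos ((t * z) • x + y)
    simp only [map_add, map_smul, inner_add_left, inner_add_right, inner_smul_left,
      inner_smul_right, hyx, ← hz, map_mul, Complex.conj_ofReal, Complex.add_re] at h
    have e1 : ((t : ℂ) * z * ((t : ℂ) * (starRingEnd ℂ) z * inner ℂ x (A x))).re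
        = ‖z‖ ^ 2 * (inner ℂ x (A x)).re * (t * t) := by
      have : (t : ℂ) * z * ((t : ℂ) * (starRingEnd ℂ) z * inner ℂ x (A x))
          = ((‖z‖ ^ 2 * (t * t) : ℝ) : ℂ) * inner ℂ x (A x) := by
        push_cast; rw [← Complex.mul_conj']; ring
      rw [this, Complex.re_ofReal_mul]; ring
    have e2 : ((t : ℂ) * (starRingEnd ℂ) z * z).re = ‖z‖ ^ 2 * t := by
      have : (t : ℂ) * (starRingEnd ℂ) z * z = ((‖z‖ ^ 2 * t : ℝ) : ℂ) := by
        push_cast; rw [← Complex.mul_conj']; ring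
      rw [this, Complex.ofReal_re]
    have e3 : ((t : ℂ) * z * (starRingEnd ℂ) z).re = ‖z‖ ^ 2 * t := by
      rw [← e2]; ring_nf
    simp only [mul_assoc, mul_add, Complex.add_re] at h e1 e2 e3 ⊢
    linarith
  have hd := discrim_le_zero key
  rw [discrim] at hd
  by_cases h0 : ‖z‖ ^ 2 = 0
  · rw [h0]; exact mul_nonneg (hpos x) (hpos y)
  · have hp : 0 < ‖z‖ ^ 2 := lt_of_le_of_ne (sq_nonneg _) (Ne.symm h0)
    nlinarith

/-- Cauchy-Schwarz for the pair A x, x, followed by cancelling ‖A x‖². For A = H + Δ - λ it turns a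
small energy excess into a small image, which is the source of √(κh); zero excess forces an
eigenvector. -/
theorem norm_apply_sq_le_of_nonneg {A : E →L[ℂ] E} (hA : (A : E →ₗ[ℂ] E).IsSymmetric)
    (hpos : ∀ x, 0 ≤ (inner ℂ x (A x)).re) (x : E) :
    ‖A x‖ ^ 2 ≤ ‖A‖ * (inner ℂ x (A x)).re := by
  have h := norm_inner_sq_le_of_nonneg hA hpos (A x) x
  have h1 : ‖inner ℂ (A x) (A x)‖ = ‖A x‖ ^ 2 := by
    rw [inner_self_eq_norm_sq_to_K]; simp
  have h2 : (inner ℂ (A x) (A (A x))).re ≤ ‖A‖ * ‖A x‖ ^ 2 := by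
    refine (Complex.re_le_norm _).trans ((norm_inner_le_norm _ _).trans ?_)
    nlinarith [A.le_opNorm (A x), norm_nonneg (A x)]
  rw [h1] at h
  have h3 := mul_le_mul_of_nonneg_right h2 (hpos x)
  by_cases h0 : ‖A x‖ ^ 2 = 0
  · rw [h0]; exact mul_nonneg (norm_nonneg _) (hpos x)
  · have hp : 0 < ‖A x‖ ^ 2 := lt_of_le_of_ne (sq_nonneg _) (Ne.symm h0)
    nlinarith

/-- A symmetric operator satisfies `‖A‖² ≤ ‖A²‖`. -/
theorem norm_sq_le_norm_sq_of_isSymmetric {A : E →L[ℂ] E} (hA : (A : E →ₗ[ℂ] E).IsSymmetric) :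
    ‖A‖ ^ 2 ≤ ‖A ^ 2‖ := by
  have h : ‖A‖ ≤ √‖A ^ 2‖ := by
    refine A.opNorm_le_bound (Real.sqrt_nonneg _) fun x => ?_
    rw [← Real.sqrt_sq (norm_nonneg x), ← Real.sqrt_mul (norm_nonneg _)]
    refine Real.le_sqrt_of_sq_le ?_
    have h1 : inner ℂ (A x) (A x) = inner ℂ x ((A ^ 2) x) := by
      rw [sq]; exact hA x (A x)
    have h2 : ‖inner ℂ (A x) (A x)‖ = ‖A x‖ ^ 2 := by
      rw [inner_self_eq_norm_sq_to_K]; simp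
    rw [← h2, h1]
    refine (norm_inner_le_norm _ _).trans ?_
    nlinarith [(A ^ 2).le_opNorm x, norm_nonneg x]
  calc ‖A‖ ^ 2 ≤ (√‖A ^ 2‖) ^ 2 := by gcongr
    _ = ‖A ^ 2‖ := Real.sq_sqrt (norm_nonneg _)

/-! ### The reduced resolvent at a simple ground energy -/

/-- `A - μ`. -/
def shifted (A : E →L[ℂ] E) (μ : ℝ) : E →L[ℂ] E :=
  A - (μ : ℂ) • (1 : E →L[ℂ] E)

theorem shifted_apply (A : E →L[ℂ] E) (μ : ℝ) (x : E) : shifted A μ x = A x - (μ : ℂ) • x := rfl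

/-- `A` is a Hermitian operator on the range of the projection `N`, with simple ground energy `μ`,
ground projection `P`, spectral gap at least `γ`, and reduced resolvent `R`. -/
structure GroundData (N A P R : E →L[ℂ] E) (μ γ : ℝ) : Prop where
  symmA : (A : E →ₗ[ℂ] E).IsSymmetric
  symmP : (P : E →ₗ[ℂ] E).IsSymmetric
  symmR : (R : E →ₗ[ℂ] E).IsSymmetric
  norm_N : ‖N‖ ≤ 1
  N_N : N * N = N
  N_A : N * A = A
  A_N : A * N = A
  N_P : N * P = P
  P_N : P * N = P
  P_P : P * P = P
  N_R : N * R = R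
  R_N : R * N = R
  P_R : P * R = 0
  R_P : R * P = 0
  sA_P : shifted A μ * P = 0
  P_sA : P * shifted A μ = 0
  sA_R : shifted A μ * R = N - P
  R_sA : R * shifted A μ = N - P
  gap_pos : 0 < γ
  ground_le : ∀ x, N x = x → μ * ‖x‖ ^ 2 ≤ (inner ℂ x (A x)).re
  gap_le : ∀ x, N x = x → P x = 0 → γ * ‖x‖ ^ 2 ≤ (inner ℂ x (shifted A μ x)).re
  rank_one : ∃ φ : E, ‖φ‖ = 1 ∧ ∀ x, P x = inner ℂ φ x • φ

namespace GroundData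

variable {N A P R A' P' R' : E →L[ℂ] E} {μ γ μ' γ' : ℝ}

theorem norm_P (h : GroundData N A P R μ γ) : ‖P‖ ≤ 1 := by
  obtain ⟨φ, h1, hP⟩ := h.rank_one
  refine P.opNorm_le_bound zero_le_one fun x => ?_
  rw [hP, norm_smul, h1, mul_one, one_mul]
  simpa [h1] using norm_inner_le_norm (𝕜 := ℂ) φ x

/-- A lower bound of the form of `A - μ` away from the ground space bounds the reduced resolvent. -/
theorem mul_norm_R_le (h : GroundData N A P R μ γ) {g : ℝ}
    (hg : ∀ x, N x = x → P x = 0 → g * ‖x‖ ^ 2 ≤ (inner ℂ x (shifted A μ x)).re) :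
    g * ‖R‖ ≤ 1 := by
  rcases le_or_gt g 0 with h0 | h0
  · exact (mul_nonpos_of_nonpos_of_nonneg h0 (norm_nonneg _)).trans zero_le_one
  rw [mul_comm, ← le_div_iff₀ h0]
  refine R.opNorm_le_bound (by positivity) fun x => ?_
  have hN : N (R x) = R x := DFunLike.congr_fun h.N_R x
  have hP : P (R x) = 0 := DFunLike.congr_fun h.P_R x
  have h1 := hg _ hN hP
  have h2 : shifted A μ (R x) = N x - P x := DFunLike.congr_fun h.sA_R x
  have hRN : R (N x) = R x := DFunLike.congr_fun h.R_N x
  have hRP : R (P x) = 0 := DFunLike.congr_fun h.R_P x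
  have h3 : inner ℂ (R x) (N x - P x) = inner ℂ (R x) (N x) := by
    have : inner ℂ (P (R x)) x = inner ℂ (R x) (P x) := h.symmP (R x) x
    rw [inner_sub_right, ← this, hP, inner_zero_left, sub_zero]
  rw [h2, h3] at h1
  have h4 : (inner ℂ (R x) (N x)).re ≤ ‖R x‖ * ‖x‖ := by
    refine (Complex.re_le_norm _).trans ((norm_inner_le_norm _ _).trans ?_)
    gcongr
    exact (N.le_opNorm x).trans (mul_le_of_le_one_left (norm_nonneg _) h.norm_N)
  rcases (norm_nonneg (R x)).eq_or_lt with h5 | h5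
  · rw [← h5]; positivity
  · rw [div_mul_eq_mul_div, one_mul, le_div_iff₀ h0]
    nlinarith

theorem norm_R (h : GroundData N A P R μ γ) : ‖R‖ ≤ 1 / γ := by
  rw [le_div_iff₀ h.gap_pos, mul_comm]
  exact h.mul_norm_R_le h.gap_le

/-- Since P' (A' - μ') = 0 and (A - μ) R = N - P, the first summand is P' - P'P; symmetrically the
second is P'P - P. The identity is exact, so it gives continuity of the projection as well as its
derivative. -/
theorem P_sub_P (h : GroundData N A P R μ γ) (h' : GroundData N A' P' R' μ' γ') :
    P' - P = P' * (shifted A μ - shifted A' μ') * R + R' * (shifted A μ - shifted A' μ') * P := by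
  have e1 : P' * (shifted A μ - shifted A' μ') * R = P' - P' * P := by
    rw [mul_sub, h'.P_sA, sub_zero, mul_assoc, h.sA_R, mul_sub, h'.P_N]
  have e2 : R' * (shifted A μ - shifted A' μ') * P = P' * P - P := by
    rw [mul_assoc, sub_mul, h.sA_P, zero_sub, mul_neg, ← mul_assoc, h'.R_sA, sub_mul, h.N_P,
      neg_sub]
  rw [e1, e2]; abel

/-- The second resolvent identity. The extra terms appear because each R inverts only off its own
ground space, and these spaces differ. -/
theorem R_sub_R (h : GroundData N A P R μ γ) (h' : GroundData N A' P' R' μ' γ') :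
    R' - R = R' * (shifted A μ - shifted A' μ') * R + (R' * (P - P') + (P - P') * R) := by
  have e1 : R' * (shifted A μ - shifted A' μ') * R
      = R' - R' * P - (R - P' * R) := by
    rw [mul_sub, sub_mul, h'.R_sA, mul_assoc, h.sA_R, mul_sub, sub_mul, h'.R_N, h.N_R]
  rw [e1, mul_sub, sub_mul, h'.R_P, h.P_R]; abel

theorem A_apply_rank_one (h : GroundData N A P R μ γ) {x : E} (hx : P x = x) :
    A x = (μ : ℂ) • x := by
  have := DFunLike.congr_fun h.sA_P x
  rw [mul_apply_eq_comp, hx, shifted_apply] at this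
  exact sub_eq_zero.1 this

theorem N_apply_of_P (h : GroundData N A P R μ γ) {x : E} (hx : P x = x) : N x = x := by
  conv_lhs => rw [← hx]
  exact (DFunLike.congr_fun h.N_P x).trans hx

theorem exists_unit (h : GroundData N A P R μ γ) :
    ∃ φ : E, ‖φ‖ = 1 ∧ (∀ x, P x = inner ℂ φ x • φ) ∧ P φ = φ := by
  obtain ⟨φ, h1, hP⟩ := h.rank_one
  refine ⟨φ, h1, hP, ?_⟩
  rw [hP, inner_self_eq_norm_sq_to_K, h1]; simp

theorem re_inner_sub_le (A A' : E →L[ℂ] E) (x : E) :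
    (inner ℂ x (A' x)).re ≤ (inner ℂ x (A x)).re + ‖A' - A‖ * ‖x‖ ^ 2 := by
  have h1 : (inner ℂ x ((A' - A) x)).re ≤ ‖A' - A‖ * ‖x‖ ^ 2 := by
    refine (Complex.re_le_norm _).trans ((norm_inner_le_norm _ _).trans ?_)
    nlinarith [(A' - A).le_opNorm x, norm_nonneg x]
  rw [sub_apply, inner_sub_right, Complex.sub_re] at h1
  linarith

/-- The old ground vector is a trial vector for the new operator. -/
theorem energy_le (h : GroundData N A P R μ γ) (h' : GroundData N A' P' R' μ' γ') :
    μ' ≤ μ + ‖A' - A‖ := by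
  obtain ⟨φ, h1, -, hφ⟩ := h.exists_unit
  have h2 := h'.ground_le φ (h.N_apply_of_P hφ)
  have h3 := re_inner_sub_le A A' φ
  rw [h.A_apply_rank_one hφ, inner_smul_right, Complex.re_ofReal_mul, re_inner_self] at h3
  rw [h1] at h2 h3
  linarith

theorem abs_energy_sub_le (h : GroundData N A P R μ γ) (h' : GroundData N A' P' R' μ' γ') :
    |μ' - μ| ≤ ‖A' - A‖ := by
  rw [abs_le]
  have h1 := h.energy_le h'
  have h2 := h'.energy_le h
  rw [norm_sub_rev] at h2
  constructor <;> linarith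

/-- The gap is stable: a vector orthogonal to the new ground vector has an energy above the old
excited energy up to the size of the perturbation. -/
theorem gap_sub_le (h : GroundData N A P R μ γ) (h' : GroundData N A' P' R' μ' γ') (y : E)
    (hy : N y = y) (hPy : P' y = 0) :
    (γ - 2 * ‖A' - A‖) * ‖y‖ ^ 2 ≤ (inner ℂ y (shifted A' μ' y)).re := by
  obtain ⟨φ, hφ1, hφP, hφ⟩ := h.exists_unit
  obtain ⟨v, hv1, hvP, hv⟩ := h'.exists_unit
  have hvy : inner ℂ v y = 0 := by
    have := hvP y
    rw [hPy] at this
    rcases smul_eq_zero.1 this.symm with h0 | h0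
    · exact h0
    · rw [h0, norm_zero] at hv1; exact absurd hv1 zero_ne_one
  have hyv : inner ℂ y v = 0 := by rw [← inner_conj_symm, hvy, map_zero]
  have hAv := h'.A_apply_rank_one hv
  have hgy := h'.ground_le y hy
  -- a combination `u` of `v` and `y` is orthogonal to the old ground vector
  have main : ∀ α β : ℂ, P (α • v + β • y) = 0 →
      (γ + μ - ‖A' - A‖) * (‖α‖ ^ 2 + ‖β‖ ^ 2 * ‖y‖ ^ 2)
        ≤ ‖α‖ ^ 2 * μ' + ‖β‖ ^ 2 * (inner ℂ y (A' y)).re := by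
    intro α β hu
    have hNu : N (α • v + β • y) = α • v + β • y := by
      rw [map_add, map_smul, map_smul, hy, h'.N_apply_of_P hv]
    have h2 := h.gap_le _ hNu hu
    have h3 := re_inner_sub_le A' A (α • v + β • y)
    rw [shifted_apply, inner_sub_right, inner_smul_right, Complex.sub_re, Complex.re_ofReal_mul,
      re_inner_self] at h2
    have hAyv : inner ℂ v (A' y) = 0 := by
      have : inner ℂ (A' v) y = inner ℂ v (A' y) := h'.symmA v y
      rw [← this, hAv, inner_smul_left, hvy, mul_zero]
    have e1 : ‖α • v + β • y‖ ^ 2 = ‖α‖ ^ 2 + ‖β‖ ^ 2 * ‖y‖ ^ 2 := by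
      rw [sq, norm_add_sq_eq_norm_sq_add_norm_sq_of_inner_eq_zero (𝕜 := ℂ), norm_smul, norm_smul, hv1]
      · ring
      · rw [inner_smul_left, inner_smul_right, hvy]; simp
    have e2 : (inner ℂ (α • v + β • y) (A' (α • v + β • y))).re
        = ‖α‖ ^ 2 * μ' + ‖β‖ ^ 2 * (inner ℂ y (A' y)).re := by
      have : inner ℂ (α • v + β • y) (A' (α • v + β • y))
          = ((‖α‖ ^ 2 * μ' : ℝ) : ℂ) + ((‖β‖ ^ 2 : ℝ) : ℂ) * inner ℂ y (A' y) := by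
        simp only [map_add, map_smul, hAv, inner_add_left, inner_add_right, inner_smul_left,
          inner_smul_right, hAyv, hyv, inner_self_eq_norm_sq_to_K, hv1]
        push_cast
        rw [← Complex.conj_mul', ← Complex.conj_mul']
        simp; ring
      rw [this, Complex.add_re, Complex.ofReal_re, Complex.re_ofReal_mul]
    rw [e1] at h2 h3
    rw [e2] at h3
    rw [norm_sub_rev] at h3
    linarith
  have hE := h.energy_le h'
  rw [shifted_apply, inner_sub_right, inner_smul_right, Complex.sub_re, Complex.re_ofReal_mul,
      re_inner_self]
  -- If v is orthogonal to the old ground vector φ, it is itself a test vector. Otherwise ⟨φ, y⟩ v -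
  -- ⟨φ, v⟩ y is one. One ‖A' - A‖ is lost in comparing the two forms, and the other in replacing μ'
  -- by μ.
  by_cases h0 : inner ℂ φ v = 0
  · have := main 1 0 (by simp [hφP, h0])
    simp only [norm_one, norm_zero] at this
    nlinarith [sq_nonneg ‖y‖]
  · have := main (inner ℂ φ y) (-inner ℂ φ v) (by
      rw [hφP, inner_add_right, inner_smul_right, inner_smul_right]
      rw [mul_comm, neg_mul, add_neg_cancel, zero_smul])
    rw [norm_neg] at this
    have hp : 0 < ‖(inner ℂ φ v : ℂ)‖ ^ 2 := by positivity
    set a := ‖(inner ℂ φ y : ℂ)‖ ^ 2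
    set b := ‖(inner ℂ φ v : ℂ)‖ ^ 2
    set r := (inner ℂ y (A' y)).re
    set δ := ‖A' - A‖
    have ha : 0 ≤ a := sq_nonneg _
    by_contra! hc
    have hlt : r < (γ + μ - δ) * ‖y‖ ^ 2 := by nlinarith [sq_nonneg ‖y‖]
    have hμ : μ' ≤ γ + μ - δ := by
      by_contra! hc'
      have : (γ + μ - δ) * ‖y‖ ^ 2 ≤ μ' * ‖y‖ ^ 2 := by gcongr
      linarith
    nlinarith [mul_lt_mul_of_pos_left hlt hp, mul_le_mul_of_nonneg_left hμ ha]

theorem mul_norm_R_le' (h : GroundData N A P R μ γ) (h' : GroundData N A' P' R' μ' γ') :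
    (γ - 2 * ‖A' - A‖) * ‖R'‖ ≤ 1 :=
  h'.mul_norm_R_le (h.gap_sub_le h')

end GroundData

/-! ### Construction of the reduced resolvent on an invariant subspace -/

theorem exists_inverse_of_injective {D : E →L[ℂ] E} (hD : ∀ x, D x = 0 → x = 0) :
    ∃ D' : E →L[ℂ] E, D' * D = 1 ∧ D * D' = 1 := by
  have hinj : Function.Injective (D : E →ₗ[ℂ] E) :=
    (injective_iff_map_eq_zero (D : E →ₗ[ℂ] E)).2 hD
  let e := LinearEquiv.ofInjectiveEndo (D : E →ₗ[ℂ] E) hinj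
  refine ⟨LinearMap.toContinuousLinearMap (e.symm : E →ₗ[ℂ] E), ?_, ?_⟩
  · ext x
    exact e.symm_apply_apply x
  · ext x
    exact e.apply_symm_apply x

theorem block_apply_of_mem {K : Submodule ℂ E} {B : E →L[ℂ] E} (hK : ∀ x ∈ K, B x ∈ K) {x : E}
    (hx : x ∈ K) : block K B x = B x := by
  change K.starProjection (B (K.starProjection x)) = B x
  rw [Submodule.starProjection_eq_self_iff.2 hx, Submodule.starProjection_eq_self_iff.2 (hK x hx)]

theorem mem_of_commute {K : Submodule ℂ E} {B : E →L[ℂ] E}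
    (hc : B * K.starProjection = K.starProjection * B) : ∀ x ∈ K, B x ∈ K := by
  intro x hx
  have := DFunLike.congr_fun hc x
  rw [mul_apply_eq_comp, mul_apply_eq_comp, Submodule.starProjection_eq_self_iff.2 hx] at this
  exact Submodule.starProjection_eq_self_iff.1 this.symm

theorem isSymmetric_mul_mul {N B : E →L[ℂ] E} (hN : (N : E →ₗ[ℂ] E).IsSymmetric)
    (hB : (B : E →ₗ[ℂ] E).IsSymmetric) : ((N * B * N : E →L[ℂ] E) : E →ₗ[ℂ] E).IsSymmetric := by
  intro x y
  have h1 : inner ℂ (N (B (N x))) y = inner ℂ (B (N x)) (N y) := hN _ _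
  have h2 : inner ℂ (B (N x)) (N y) = inner ℂ (N x) (B (N y)) := hB _ _
  have h3 : inner ℂ (N x) (B (N y)) = inner ℂ x (N (B (N y))) := hN _ _
  exact (h1.trans h2).trans h3

theorem isSymmetric_block {K : Submodule ℂ E} {B : E →L[ℂ] E}
    (hB : (B : E →ₗ[ℂ] E).IsSymmetric) : (block K B : E →ₗ[ℂ] E).IsSymmetric :=
  isSymmetric_mul_mul K.starProjection_isSymmetric hB

theorem exists_unit_groundSpace {K : Submodule ℂ E} {B : E →L[ℂ] E}
    (hfin : Module.finrank ℂ (groundSpace K B) = 1) :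
    ∃ φ ∈ groundSpace K B, ‖φ‖ = 1 ∧ ∀ x, groundProj K B x = inner ℂ φ x • φ := by
  obtain ⟨v, hv0, hv⟩ := finrank_eq_one_iff'.1 hfin
  have hv0' : (v : E) ≠ 0 := fun h => hv0 (Subtype.ext h)
  have hnv : (‖(v : E)‖ : ℂ) ≠ 0 := by simpa using hv0'
  set φ : E := (‖(v : E)‖ : ℂ)⁻¹ • (v : E) with hφ
  have hφ1 : ‖φ‖ = 1 := by
    rw [hφ, norm_smul, norm_inv, Complex.norm_real, norm_norm,
      inv_mul_cancel₀ (norm_ne_zero_iff.2 hv0')]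
  have hφm : φ ∈ groundSpace K B := Submodule.smul_mem _ _ v.2
  refine ⟨φ, hφm, hφ1, fun x => ?_⟩
  have hspan : groundSpace K B = Submodule.span ℂ {φ} := by
    refine le_antisymm (fun w hw => ?_) ((Submodule.span_singleton_le_iff_mem _ _).2 hφm)
    obtain ⟨c, hc⟩ := hv ⟨w, hw⟩
    refine Submodule.mem_span_singleton.2 ⟨c * ‖(v : E)‖, ?_⟩
    rw [hφ, smul_smul, mul_assoc, mul_inv_cancel₀ hnv, mul_one]
    exact congrArg Subtype.val hc
  have : groundProj K B = (Submodule.span ℂ {φ}).starProjection :=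
    Submodule.starProjection_inj.2 hspan
  rw [this, Submodule.starProjection_unit_singleton ℂ hφ1]

/-- On the part of K orthogonal to the ground vector, A - μ is bounded below by the gap. Replacing
it by the identity on the ground space and on the complement of K gives an operator D that is
invertible on E and commutes with N - P. The reduced resolvent is D⁻¹ (N - P). -/
theorem exists_groundData {K : Submodule ℂ E} {B : E →L[ℂ] E}
    (hB : (B : E →ₗ[ℂ] E).IsSymmetric) (hc : B * K.starProjection = K.starProjection * B)
    (hfin : Module.finrank ℂ (groundSpace K B) = 1) (hgap : 0 < gap K B) :
    ∃ R, GroundData K.starProjection (block K B) (groundProj K B) R (groundEnergy K B)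
      (gap K B) := by
  have hK := mem_of_commute hc
  set N := K.starProjection with hN
  set P := groundProj K B with hP
  set A := block K B with hA
  set μ := groundEnergy K B with hμ
  have hNN : N * N = N := K.isIdempotentElem_starProjection
  have hPP : P * P = P := (groundSpace K B).isIdempotentElem_starProjection
  have symmN : (N : E →ₗ[ℂ] E).IsSymmetric := K.starProjection_isSymmetric
  have symmP : (P : E →ₗ[ℂ] E).IsSymmetric := (groundSpace K B).starProjection_isSymmetric
  have symmA : (A : E →ₗ[ℂ] E).IsSymmetric := isSymmetric_block hB
  have hPmem : ∀ x, P x ∈ groundSpace K B := fun x => Submodule.starProjection_apply_mem _ x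
  have hNP : N * P = P := by
    ext x
    exact Submodule.starProjection_eq_self_iff.2 (mem_groundSpace.1 (hPmem x)).1
  have hPN : P * N = P := by
    ext x
    refine ext_inner_right ℂ fun y => ?_
    have h1 : inner ℂ (P (N x)) y = inner ℂ (N x) (P y) := symmP _ _
    have h2 : inner ℂ (N x) (P y) = inner ℂ x (N (P y)) := symmN _ _
    have h3 : N (P y) = P y := DFunLike.congr_fun hNP y
    have h4 : inner ℂ (P x) y = inner ℂ x (P y) := symmP _ _
    rw [mul_apply_eq_comp, h1, h2, h3, h4]
  have hNA : N * A = A := by rw [hA, block, ← hN, ← mul_assoc, ← mul_assoc, hNN]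
  have hAN : A * N = A := by rw [hA, block, ← hN, mul_assoc, hNN]
  have sA_P : shifted A μ * P = 0 := by
    ext x
    have h1 := mem_groundSpace.1 (hPmem x)
    rw [mul_apply_eq_comp, shifted_apply, hA, block_apply_of_mem hK h1.1, h1.2, sub_self]
    rfl
  have symms : ∀ x y, inner ℂ (shifted A μ x) y = inner ℂ x (shifted A μ y) := by
    intro x y
    have : inner ℂ (A x) y = inner ℂ x (A y) := symmA x y
    rw [shifted_apply, shifted_apply, inner_sub_left, inner_sub_right, this, inner_smul_left,
      inner_smul_right, Complex.conj_ofReal]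
  have P_sA : P * shifted A μ = 0 := by
    ext x
    refine ext_inner_right ℂ fun y => ?_
    have h1 : inner ℂ (P (shifted A μ x)) y = inner ℂ (shifted A μ x) (P y) := symmP _ _
    have h2 : shifted A μ (P y) = 0 := DFunLike.congr_fun sA_P y
    rw [mul_apply_eq_comp, h1, symms, h2, inner_zero_right]
    simp
  have gap_le : ∀ x, N x = x → P x = 0 →
      gap K B * ‖x‖ ^ 2 ≤ (inner ℂ x (shifted A μ x)).re := by
    intro x hx hPx
    have hxK := Submodule.starProjection_eq_self_iff.1 hx
    rw [shifted_apply, hA, block_apply_of_mem hK hxK]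
    exact gap_mul_le hB hK hxK ((Submodule.starProjection_apply_eq_zero_iff _).1 hPx)
  -- the invertible operator whose inverse gives the reduced resolvent
  set M := shifted A μ * N with hM
  have hsN : N * shifted A μ = M := by
    rw [hM, shifted, mul_sub, sub_mul, hNA, hAN, mul_smul_comm, smul_mul_assoc, mul_one, one_mul]
  have hPM : P * M = 0 := by rw [hM, ← mul_assoc, P_sA, zero_mul]
  have hMP : M * P = 0 := by rw [hM, mul_assoc, hNP, sA_P]
  have hNM : N * M = M := by rw [← hsN, ← mul_assoc, hNN]
  have hMN : M * N = M := by rw [hM, mul_assoc, hNN]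
  set D := M + P + (1 - N) with hD
  have hPD : P * D = P := by
    rw [hD, mul_add, mul_add, hPM, hPP, mul_sub, hPN, mul_one]; abel
  have hND : N * D = M + P := by
    rw [hD, mul_add, mul_add, hNM, hNP, mul_sub, hNN, mul_one]; abel
  have hinj : ∀ x, D x = 0 → x = 0 := by
    intro x hx
    have h1 : P x = 0 := by
      have := DFunLike.congr_fun hPD x
      rw [mul_apply_eq_comp, hx, map_zero] at this
      exact this.symm
    have h2 : M x = 0 := by
      have := DFunLike.congr_fun hND x
      rw [mul_apply_eq_comp, hx, map_zero, add_apply, h1, add_zero] at this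
      exact this.symm
    have h3 : N x = x := by
      have : D x = M x + P x + (x - N x) := rfl
      rw [hx, h1, h2, zero_add, zero_add] at this
      exact (sub_eq_zero.1 this.symm).symm
    have h4 : shifted A μ x = 0 := by
      have : M x = shifted A μ (N x) := rfl
      rw [h2, h3] at this
      exact this.symm
    have h5 := gap_le x h3 h1
    rw [h4, inner_zero_right, Complex.zero_re] at h5
    by_contra hne
    have : 0 < ‖x‖ ^ 2 := by positivity
    nlinarith
  obtain ⟨D', hD1, hD2⟩ := exists_inverse_of_injective hinj
  have hQD : (N - P) * D = M := by rw [sub_mul, hND, hPD]; abel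
  have hDQ : D * (N - P) = M := by
    rw [hD, add_mul, add_mul, mul_sub, mul_sub, mul_sub, sub_mul, sub_mul, hMN, hMP, hPN, hPP, hNN,
      hNP, one_mul, one_mul]
    abel
  have hQQ : (N - P) * (N - P) = N - P := by
    rw [mul_sub, sub_mul, sub_mul, hNN, hPN, hNP, hPP]; abel
  have hcom : D' * (N - P) = (N - P) * D' := by
    calc D' * (N - P) = D' * ((N - P) * (D * D')) := by rw [hD2, mul_one]
      _ = D' * ((N - P) * D) * D' := by simp only [mul_assoc]
      _ = D' * (D * (N - P)) * D' := by rw [hQD, hDQ]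
      _ = (D' * D) * (N - P) * D' := by simp only [mul_assoc]
      _ = (N - P) * D' := by rw [hD1, one_mul]
  set R := D' * (N - P) with hR
  have N_R : N * R = R := by
    rw [hcom, ← mul_assoc, mul_sub, hNN, hNP]
  have R_N : R * N = R := by
    rw [hR, mul_assoc, sub_mul, hNN, hPN]
  have P_R : P * R = 0 := by
    rw [hcom, ← mul_assoc, mul_sub, hPN, hPP, sub_self, zero_mul]
  have R_P : R * P = 0 := by
    rw [hR, mul_assoc, sub_mul, hNP, hPP, sub_self, mul_zero]
  have sA_R : shifted A μ * R = N - P := by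
    calc shifted A μ * R = shifted A μ * (N * R) := by rw [N_R]
      _ = M * (D' * (N - P)) := by rw [← mul_assoc, ← hM]
      _ = (N - P) * (D * D') * (N - P) := by rw [← hQD]; simp only [mul_assoc]
      _ = N - P := by rw [hD2, mul_one, hQQ]
  have R_sA : R * shifted A μ = N - P := by
    calc R * shifted A μ = R * (N * shifted A μ) := by rw [← mul_assoc, R_N]
      _ = (N - P) * D' * (D * (N - P)) := by rw [hsN, hcom, hDQ]
      _ = (N - P) * (D' * D) * (N - P) := by simp only [mul_assoc]
      _ = N - P := by rw [hD1, mul_one, hQQ]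
  have symmQ : ∀ x y, inner ℂ ((N - P) x) y = inner ℂ x ((N - P) y) := by
    intro x y
    have h1 : inner ℂ (N x) y = inner ℂ x (N y) := symmN x y
    have h2 : inner ℂ (P x) y = inner ℂ x (P y) := symmP x y
    rw [sub_apply, sub_apply, inner_sub_left, inner_sub_right, h1, h2]
  have hQR : (N - P) * R = R := by rw [sub_mul, N_R, P_R, sub_zero]
  have symmR : (R : E →ₗ[ℂ] E).IsSymmetric := by
    intro x y
    have h1 : ∀ z, (N - P) (R z) = R z := fun z => DFunLike.congr_fun hQR z
    have h2 : ∀ z, shifted A μ (R z) = (N - P) z := fun z => DFunLike.congr_fun sA_R z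
    change inner ℂ (R x) y = inner ℂ x (R y)
    rw [← h1 x, symmQ, ← h2 y, ← symms, h2 x, symmQ, h1 y]
  exact ⟨R,
    { symmA, symmP, symmR, norm_N := K.starProjection_norm_le, N_N := hNN, N_A := hNA, A_N := hAN,
      N_P := hNP, P_N := hPN, P_P := hPP, N_R, R_N, P_R, R_P, sA_P, P_sA, sA_R, R_sA,
      gap_pos := hgap
      ground_le := fun x hx => by
        have hxK := Submodule.starProjection_eq_self_iff.1 hx
        rw [hA, block_apply_of_mem hK hxK]
        exact groundEnergy_mul_le hB hK hxK
      gap_le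
      rank_one := by
        obtain ⟨φ, -, h1, h2⟩ := exists_unit_groundSpace hfin
        exact ⟨φ, h1, h2⟩ }⟩

section

open Filter Topology

/-! ### Differentiability of the ground energy, ground projection and reduced resolvent -/

/-- A function whose increments are `F t * (a t - a s) * G t` is differentiable at `s` when `a` is,
provided that `F` and `G` are continuous at `s`. -/
theorem hasDerivWithinAt_of_sub_eq_mul {f a F G : ℝ → E →L[ℂ] E} {a' : E →L[ℂ] E} {I : Set ℝ}
    {s : ℝ} (hF : ContinuousWithinAt F I s) (hG : ContinuousWithinAt G I s)
    (ha : HasDerivWithinAt a a' I s) (h : ∀ t ∈ I, f t - f s = F t * (a t - a s) * G t) :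
    HasDerivWithinAt f (F s * a' * G s) I s := by
  rw [hasDerivWithinAt_iff_tendsto_slope] at ha ⊢
  have hF' : Tendsto F (𝓝[I \ {s}] s) (𝓝 (F s)) := hF.mono_left (nhdsWithin_mono _ sdiff_subset)
  have hG' : Tendsto G (𝓝[I \ {s}] s) (𝓝 (G s)) := hG.mono_left (nhdsWithin_mono _ sdiff_subset)
  refine ((hF'.mul ha).mul hG').congr' ?_
  filter_upwards [self_mem_nhdsWithin] with t ht
  rw [slope_def_module, slope_def_module, h t ht.1, mul_smul_comm, smul_mul_assoc]

namespace GroundData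

variable {N : E →L[ℂ] E} {A P R : ℝ → E →L[ℂ] E} {μ γ : ℝ → ℝ} {I : Set ℝ} {s : ℝ}
  {A' : E →L[ℂ] E}

theorem tendsto_norm_sub (hA : HasDerivWithinAt A A' I s) :
    Tendsto (fun t => ‖A t - A s‖) (𝓝[I] s) (𝓝 0) := by
  have h := (hA.continuousWithinAt.sub (continuousWithinAt_const (b := A s))).norm
  rw [ContinuousWithinAt, Pi.sub_apply, sub_self, norm_zero] at h
  exact h

/-- The gap at s alone controls the resolvents at nearby t through `mul_norm_R_le'`, so no
continuity of t ↦ γ t is needed. -/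
theorem eventually_norm_R_le (hs : s ∈ I)
    (h : ∀ t ∈ I, GroundData N (A t) (P t) (R t) (μ t) (γ t)) (hA : HasDerivWithinAt A A' I s) :
    ∀ᶠ t in 𝓝[I] s, ‖R t‖ ≤ 2 / γ s := by
  have hγ := (h s hs).gap_pos
  filter_upwards [self_mem_nhdsWithin,
    (tendsto_norm_sub hA).eventually (gt_mem_nhds (show (0 : ℝ) < γ s / 4 by positivity))]
    with t ht hlt
  have h1 := (h s hs).mul_norm_R_le' (h t ht)
  rw [le_div_iff₀ hγ]
  nlinarith [norm_nonneg (R t)]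

theorem norm_shifted_sub_le (hs : s ∈ I)
    (h : ∀ t ∈ I, GroundData N (A t) (P t) (R t) (μ t) (γ t)) {t : ℝ} (ht : t ∈ I) :
    ‖shifted (A s) (μ s) - shifted (A t) (μ t)‖ ≤ 2 * ‖A t - A s‖ := by
  have h1 := (h s hs).abs_energy_sub_le (h t ht)
  have e : shifted (A s) (μ s) - shifted (A t) (μ t)
      = ((μ t - μ s : ℝ) : ℂ) • (1 : E →L[ℂ] E) - (A t - A s) := by
    rw [shifted, shifted]; push_cast; rw [sub_smul]; abel
  have h2 : ‖((μ t - μ s : ℝ) : ℂ) • (1 : E →L[ℂ] E)‖ ≤ ‖A t - A s‖ := by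
    rw [norm_smul, Complex.norm_real]
    exact (mul_le_of_le_one_right (norm_nonneg _) ContinuousLinearMap.norm_id_le).trans h1
  rw [e]
  linarith [norm_sub_le (((μ t - μ s : ℝ) : ℂ) • (1 : E →L[ℂ] E)) (A t - A s)]

theorem continuousWithinAt_P (hs : s ∈ I)
    (h : ∀ t ∈ I, GroundData N (A t) (P t) (R t) (μ t) (γ t)) (hA : HasDerivWithinAt A A' I s) :
    ContinuousWithinAt P I s := by
  have hγ := (h s hs).gap_pos
  rw [ContinuousWithinAt, tendsto_iff_norm_sub_tendsto_zero]
  have h0 := (tendsto_norm_sub hA).const_mul (2 * ‖R s‖ + 2 * (2 / γ s))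
  rw [mul_zero] at h0
  refine squeeze_zero' (Eventually.of_forall fun _ => norm_nonneg _) ?_ h0
  filter_upwards [self_mem_nhdsWithin, eventually_norm_R_le hs h hA] with t ht hR
  have hE := norm_shifted_sub_le hs h ht
  rw [(h s hs).P_sub_P (h t ht)]
  set D := shifted (A s) (μ s) - shifted (A t) (μ t)
  have h1 : ‖P t * D * R s‖ ≤ 1 * (2 * ‖A t - A s‖) * ‖R s‖ :=
    (norm_mul_le _ _).trans (mul_le_mul_of_nonneg_right ((norm_mul_le _ _).trans
      (mul_le_mul (h t ht).norm_P hE (norm_nonneg _) zero_le_one)) (norm_nonneg _))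
  have h2 : ‖R t * D * P s‖ ≤ (2 / γ s) * (2 * ‖A t - A s‖) * 1 :=
    (norm_mul_le _ _).trans (mul_le_mul ((norm_mul_le _ _).trans
      (mul_le_mul hR hE (norm_nonneg _) (by positivity))) (h s hs).norm_P (norm_nonneg _)
      (by positivity))
  linarith [norm_add_le (P t * D * R s) (R t * D * P s)]

theorem continuousWithinAt_R (hs : s ∈ I)
    (h : ∀ t ∈ I, GroundData N (A t) (P t) (R t) (μ t) (γ t)) (hA : HasDerivWithinAt A A' I s) :
    ContinuousWithinAt R I s := by
  have hγ := (h s hs).gap_pos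
  have hP := continuousWithinAt_P hs h hA
  rw [ContinuousWithinAt, tendsto_iff_norm_sub_tendsto_zero] at hP ⊢
  have h0 := ((tendsto_norm_sub hA).const_mul (2 / γ s * 2 * ‖R s‖)).add
    (hP.const_mul (2 / γ s + ‖R s‖))
  rw [mul_zero, mul_zero, add_zero] at h0
  refine squeeze_zero' (Eventually.of_forall fun _ => norm_nonneg _) ?_ h0
  filter_upwards [self_mem_nhdsWithin, eventually_norm_R_le hs h hA] with t ht hR
  have hE := norm_shifted_sub_le hs h ht
  rw [(h s hs).R_sub_R (h t ht)]
  set D := shifted (A s) (μ s) - shifted (A t) (μ t)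
  have h1 : ‖R t * D * R s‖ ≤ (2 / γ s) * (2 * ‖A t - A s‖) * ‖R s‖ :=
    (norm_mul_le _ _).trans (mul_le_mul_of_nonneg_right ((norm_mul_le _ _).trans
      (mul_le_mul hR hE (norm_nonneg _) (by positivity))) (norm_nonneg _))
  have h2 : ‖R t * (P s - P t)‖ ≤ (2 / γ s) * ‖P t - P s‖ := by
    rw [norm_sub_rev (P t)]
    exact (norm_mul_le _ _).trans (mul_le_mul_of_nonneg_right hR (norm_nonneg _))
  have h3 : ‖(P s - P t) * R s‖ ≤ ‖P t - P s‖ * ‖R s‖ := by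
    rw [norm_sub_rev (P t)]
    exact norm_mul_le _ _
  linarith [norm_add_le (R t * D * R s) (R t * (P s - P t) + (P s - P t) * R s),
    norm_add_le (R t * (P s - P t)) ((P s - P t) * R s)]

/-- The Hellmann-Feynman formula, without differentiating an eigenvector: for the fixed ground
vector φ of A s, P t (A t - A s) φ = (μ t - μ s) P t φ exactly. Continuity of P then suffices to
pass to the limit. -/
theorem exists_hasDerivWithinAt_energy (hs : s ∈ I)
    (h : ∀ t ∈ I, GroundData N (A t) (P t) (R t) (μ t) (γ t)) (hA : HasDerivWithinAt A A' I s) :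
    ∃ μ' : ℝ, HasDerivWithinAt μ μ' I s ∧ |μ'| ≤ ‖A'‖ := by
  obtain ⟨φ, hφ1, -, hφ⟩ := (h s hs).exists_unit
  -- the real linear functional `B ↦ re ⟪φ, B φ⟫`
  set ℓ : (E →L[ℂ] E) → ℝ := fun B => (inner ℂ φ (B φ)).re with hℓ
  have hℓc : Continuous ℓ := by
    have h1 : Continuous fun B : E →L[ℂ] E => B φ :=
      (ContinuousLinearMap.apply ℂ E φ).continuous
    exact Complex.continuous_re.comp (continuous_const.inner h1)
  refine ⟨ℓ A', ?_, ?_⟩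
  · have hP := continuousWithinAt_P hs h hA
    rw [hasDerivWithinAt_iff_tendsto_slope] at hA ⊢
    have hP' : Tendsto P (𝓝[I \ {s}] s) (𝓝 (P s)) :=
      hP.mono_left (nhdsWithin_mono _ sdiff_subset)
    have h1 : ℓ (P s) = 1 := by
      rw [hℓ]; simp only; rw [hφ, re_inner_self, hφ1, one_pow]
    have h2 : ℓ (P s * A') = ℓ A' := by
      rw [hℓ]; simp only
      have : inner ℂ (P s φ) (A' φ) = inner ℂ φ (P s (A' φ)) := (h s hs).symmP _ _
      rw [mul_apply_eq_comp, ← this, hφ]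
    have h3 : Tendsto (fun t => ℓ (P t)) (𝓝[I \ {s}] s) (𝓝 1) := by
      rw [← h1]; exact (hℓc.tendsto _).comp hP'
    have h4 : Tendsto (fun t => ℓ (P t * slope A s t)) (𝓝[I \ {s}] s) (𝓝 (ℓ A')) := by
      rw [← h2]; exact (hℓc.tendsto _).comp (hP'.mul hA)
    have h5 := h4.div h3 one_ne_zero
    rw [div_one] at h5
    refine h5.congr' ?_
    filter_upwards [self_mem_nhdsWithin, h3.eventually (lt_mem_nhds one_pos)] with t ht hpos
    have e1 : ℓ (P t * (A t - A s)) = (μ t - μ s) * ℓ (P t) := by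
      have k1 : P t * A t = (μ t : ℂ) • P t := by
        have := (h t ht.1).P_sA
        rw [shifted, mul_sub, mul_smul_comm, mul_one] at this
        exact sub_eq_zero.1 this
      have k2 : A s φ = (μ s : ℂ) • φ := (h s hs).A_apply_rank_one hφ
      have k3 : (P t * (A t - A s)) φ = ((μ t - μ s : ℝ) : ℂ) • P t φ := by
        rw [mul_sub, k1, sub_apply, mul_apply_eq_comp, k2, map_smul, smul_apply]
        push_cast; rw [sub_smul]
      rw [hℓ]; simp only
      rw [k3, inner_smul_right, Complex.re_ofReal_mul]
    have e2 : ℓ (P t * slope A s t) = (t - s)⁻¹ * ℓ (P t * (A t - A s)) := by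
      rw [slope_def_module, mul_smul_comm, hℓ]; simp only
      rw [smul_apply, ← Complex.coe_smul, inner_smul_right, Complex.re_ofReal_mul]
    rw [Pi.div_apply, e2, e1, slope_def_field]
    field_simp
  · refine (Complex.abs_re_le_norm _).trans ((norm_inner_le_norm _ _).trans ?_)
    have := A'.le_opNorm φ
    rw [hφ1] at this ⊢
    linarith

theorem hasDerivWithinAt_shifted {μ' : ℝ} (hA : HasDerivWithinAt A A' I s)
    (hμ : HasDerivWithinAt μ μ' I s) :
    HasDerivWithinAt (fun t => shifted (A t) (μ t)) (shifted A' μ') I s :=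
  hA.sub (hμ.ofReal_comp.smul_const (1 : E →L[ℂ] E))

/-- The increment identity `P_sub_P` is differentiated term by term. The derivative of the energy
drops out because P R = R P = 0; in the derivative of R it survives. -/
theorem hasDerivWithinAt_P (hs : s ∈ I)
    (h : ∀ t ∈ I, GroundData N (A t) (P t) (R t) (μ t) (γ t)) (hA : HasDerivWithinAt A A' I s) :
    HasDerivWithinAt P (-(P s * A' * R s + R s * A' * P s)) I s := by
  obtain ⟨μ', hμ, -⟩ := exists_hasDerivWithinAt_energy hs h hA
  have hP := continuousWithinAt_P hs h hA
  have hR := continuousWithinAt_R hs h hA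
  have ha := (hasDerivWithinAt_shifted hA hμ).neg
  have h1 := hasDerivWithinAt_of_sub_eq_mul (f := fun t => P t *
      (shifted (A s) (μ s) - shifted (A t) (μ t)) * R s) hP
    (continuousWithinAt_const (b := R s)) ha (fun t _ => by simp [neg_add_eq_sub])
  have h2 := hasDerivWithinAt_of_sub_eq_mul (f := fun t => R t *
      (shifted (A s) (μ s) - shifted (A t) (μ t)) * P s) hR
    (continuousWithinAt_const (b := P s)) ha (fun t _ => by simp [neg_add_eq_sub])
  have h3 := ((h1.add h2).const_add (P s)).congr_deriv
    (show _ = -(P s * A' * R s + R s * A' * P s) by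
      rw [shifted]
      simp only [mul_neg, neg_mul, mul_sub, sub_mul, mul_smul_comm, smul_mul_assoc, mul_one,
        (h s hs).P_R, (h s hs).R_P, smul_zero, sub_zero]
      abel)
  refine h3.congr (fun t ht => ?_) ?_
  · exact sub_eq_iff_eq_add'.1 ((h s hs).P_sub_P (h t ht))
  · simp

theorem hasDerivWithinAt_R (hs : s ∈ I)
    (h : ∀ t ∈ I, GroundData N (A t) (P t) (R t) (μ t) (γ t)) (hA : HasDerivWithinAt A A' I s)
    {μ' : ℝ} (hμ : HasDerivWithinAt μ μ' I s) :
    HasDerivWithinAt R (-(R s * shifted A' μ' * R s) + R s * R s * A' * P s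
      + P s * A' * R s * R s) I s := by
  have hR := continuousWithinAt_R hs h hA
  have hP := hasDerivWithinAt_P hs h hA
  have ha := (hasDerivWithinAt_shifted hA hμ).neg
  have h1 := hasDerivWithinAt_of_sub_eq_mul (f := fun t => R t *
      (shifted (A s) (μ s) - shifted (A t) (μ t)) * R s) hR
    (continuousWithinAt_const (b := R s)) ha (fun t _ => by simp [neg_add_eq_sub])
  have h2 := hasDerivWithinAt_of_sub_eq_mul (f := fun t => R t * (P s - P t)) hR
    (continuousWithinAt_const (b := 1)) hP.neg (fun t _ => by simp [neg_add_eq_sub])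
  have h3 := (hP.const_sub (P s)).mul_const (R s)
  have h4 := ((h1.add (h2.add h3)).const_add (R s)).congr_deriv
    (show _ = -(R s * shifted A' μ' * R s) + R s * R s * A' * P s + P s * A' * R s * R s by
      simp only [mul_neg, neg_mul, mul_add, add_mul, mul_one, neg_neg, ← mul_assoc, (h s hs).R_P,
        zero_mul, zero_add]
      rw [mul_assoc (R s * A') (P s) (R s), (h s hs).P_R, mul_zero, add_zero, add_assoc])
  refine h4.congr (fun t ht => ?_) ?_
  · exact sub_eq_iff_eq_add'.1 ((h s hs).R_sub_R (h t ht))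
  · simp

end GroundData

end

/-! ### Schrödinger equations -/

theorem hasDerivWithinAt_clm_apply {A : ℝ → E →L[ℂ] E} {A' : E →L[ℂ] E} {x : ℝ → E} {x' : E}
    {I : Set ℝ} {s : ℝ} (hA : HasDerivWithinAt A A' I s) (hx : HasDerivWithinAt x x' I s) :
    HasDerivWithinAt (fun t => A t (x t)) (A' (x s) + A s x') I s := by
  have h := ((ContinuousLinearMap.restrictScalarsL ℂ E E ℝ ℝ).hasFDerivAt.comp_hasDerivWithinAt
    s hA).clm_apply hx
  exact h

theorem hasDerivWithinAt_norm_sq {x : ℝ → E} {x' : E} {I : Set ℝ} {s : ℝ}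
    (hx : HasDerivWithinAt x x' I s) :
    HasDerivWithinAt (fun t => ‖x t‖ ^ 2) (2 * (inner ℂ (x s) x').re) I s := by
  have h := Complex.reCLM.hasFDerivAt.comp_hasDerivWithinAt s (hx.inner ℂ hx)
  have e : Complex.reCLM (inner ℂ (x s) x' + inner ℂ x' (x s)) = 2 * (inner ℂ (x s) x').re := by
    rw [Complex.reCLM_apply, Complex.add_re, ← inner_conj_symm x' (x s), Complex.conj_re, two_mul]
  refine (h.congr_deriv e).congr (fun t _ => ?_) ?_
  · exact (re_inner_self (x t)).symm
  · exact (re_inner_self (x s)).symm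

theorem re_inner_I_smul_eq_zero {G : E →L[ℂ] E} (hG : (G : E →ₗ[ℂ] E).IsSymmetric) (x : E) :
    (inner ℂ x (-Complex.I • G x)).re = 0 := by
  have h : inner ℂ (G x) x = inner ℂ x (G x) := hG x x
  have h1 : (inner ℂ x (G x)).im = 0 := by
    rw [← Complex.conj_eq_iff_im, inner_conj_symm, h]
  rw [inner_smul_right]
  simp [h1]

theorem le_add_of_hasDerivWithinAt_le {n n' : ℝ → ℝ} {C : ℝ} (hC : 0 ≤ C)
    (hd : ∀ t ∈ Icc (0 : ℝ) 1, HasDerivWithinAt n (n' t) (Icc (0 : ℝ) 1) t)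
    (hb : ∀ t ∈ Icc (0 : ℝ) 1, n' t ≤ C) {s : ℝ} (hs : s ∈ Icc (0 : ℝ) 1) : n s ≤ n 0 + C := by
  have hmono : n s ≤ n 0 + C * (s - 0) := by
    refine image_le_of_deriv_right_le_deriv_boundary (a := 0) (b := 1) (f := n)
      (B := fun t => n 0 + C * (t - 0)) (B' := fun _ => C) (f' := n')
      (fun t ht => (hd t ht).continuousWithinAt) (fun t ht => ?_) (by simp) (by fun_prop)
      (fun t _ => ?_) (fun t ht => hb t (Ico_subset_Icc_self ht)) hs
    · exact (hd t (Ico_subset_Icc_self ht)).mono_of_mem_nhdsWithin (Icc_mem_nhdsGE_of_mem ht)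
    · simpa using (((hasDerivAt_id t).sub_const 0).const_mul C).const_add (n 0) |>.hasDerivWithinAt
  have h3 : C * (s - 0) ≤ C := by rw [sub_zero]; exact mul_le_of_le_one_right hC hs.2
  linarith

/-- A forced Schrödinger equation increases the norm at most by the size of the forcing. -/
theorem norm_le_of_forced_schroedinger {G : ℝ → E →L[ℂ] E} {r f : ℝ → E} {C : ℝ}
    (hG : ∀ s ∈ Icc (0 : ℝ) 1, (G s : E →ₗ[ℂ] E).IsSymmetric)
    (hr : ∀ s ∈ Icc (0 : ℝ) 1,
      HasDerivWithinAt r (-Complex.I • G s (r s) + f s) (Icc (0 : ℝ) 1) s)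
    (hf : ∀ s ∈ Icc (0 : ℝ) 1, ‖f s‖ ≤ C) {s : ℝ} (hs : s ∈ Icc (0 : ℝ) 1) :
    ‖r s‖ ≤ ‖r 0‖ + C := by
  have hC : 0 ≤ C := (norm_nonneg _).trans (hf s hs)
  refine le_of_forall_pos_le_add fun δ hδ => ?_
  -- The norm need not be differentiable where r vanishes. This regularization is differentiable
  -- everywhere, and δ is arbitrary at the end.
  set n : ℝ → ℝ := fun t => √(‖r t‖ ^ 2 + δ ^ 2) with hn
  have hpos : ∀ t, 0 < ‖r t‖ ^ 2 + δ ^ 2 := fun t => by positivity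
  have hd : ∀ t ∈ Icc (0 : ℝ) 1, HasDerivWithinAt n
      (2 * (inner ℂ (r t) (-Complex.I • G t (r t) + f t)).re / (2 * √(‖r t‖ ^ 2 + δ ^ 2)))
      (Icc (0 : ℝ) 1) t := fun t ht =>
    ((hasDerivWithinAt_norm_sq (hr t ht)).add_const (δ ^ 2)).sqrt (hpos t).ne'
  have hb : ∀ t ∈ Icc (0 : ℝ) 1,
      2 * (inner ℂ (r t) (-Complex.I • G t (r t) + f t)).re / (2 * √(‖r t‖ ^ 2 + δ ^ 2)) ≤ C := by
    intro t ht
    rw [inner_add_right, Complex.add_re, re_inner_I_smul_eq_zero (hG t ht), zero_add]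
    have hsq : 0 < √(‖r t‖ ^ 2 + δ ^ 2) := Real.sqrt_pos.2 (hpos t)
    rw [mul_div_mul_left _ _ two_ne_zero, div_le_iff₀ hsq]
    have h1 : ‖r t‖ ≤ √(‖r t‖ ^ 2 + δ ^ 2) := Real.le_sqrt_of_sq_le (by nlinarith)
    calc (inner ℂ (r t) (f t)).re ≤ ‖r t‖ * ‖f t‖ :=
          (Complex.re_le_norm _).trans (norm_inner_le_norm _ _)
      _ ≤ √(‖r t‖ ^ 2 + δ ^ 2) * C := mul_le_mul h1 (hf t ht) (norm_nonneg _) hsq.le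
      _ = C * √(‖r t‖ ^ 2 + δ ^ 2) := mul_comm _ _
  have hmono := le_add_of_hasDerivWithinAt_le hC hd hb hs
  have h1 : ‖r s‖ ≤ n s := Real.le_sqrt_of_sq_le (by nlinarith [sq_nonneg δ])
  have h2 : n 0 ≤ ‖r 0‖ + δ := Real.sqrt_le_iff.2 ⟨by positivity, by nlinarith [norm_nonneg (r 0)]⟩
  linarith

/-! ### Block diagonal operators -/

theorem norm_sq_eq_add_blocks (K : Submodule ℂ E) (x : E) :
    ‖x‖ ^ 2 = ‖K.starProjection x‖ ^ 2 + ‖Kᗮ.starProjection x‖ ^ 2 :=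
  Submodule.norm_sq_eq_add_norm_sq_starProjection x K

theorem starProjection_mul_orthogonal (K : Submodule ℂ E) :
    K.starProjection * Kᗮ.starProjection = 0 := by
  rw [Submodule.starProjection_orthogonal', mul_sub, mul_one,
    K.isIdempotentElem_starProjection.eq, sub_self]

theorem starProjection_orthogonal_mul (K : Submodule ℂ E) :
    Kᗮ.starProjection * K.starProjection = 0 := by
  rw [Submodule.starProjection_orthogonal', sub_mul, one_mul,
    K.isIdempotentElem_starProjection.eq, sub_self]

/-- The two operators act on, and map into, orthogonal blocks, so Pythagoras applies to source and
target. The maximum is what gives `min γ γ₂` in η and the maximum in the bulk constant. -/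
theorem norm_add_le_max_of_blocks {K : Submodule ℂ E} {B C : E →L[ℂ] E}
    (hB : K.starProjection * B = B) (hB' : B * K.starProjection = B)
    (hC : Kᗮ.starProjection * C = C) (hC' : C * Kᗮ.starProjection = C) :
    ‖B + C‖ ≤ max ‖B‖ ‖C‖ := by
  set M := max ‖B‖ ‖C‖ with hM
  have hM0 : 0 ≤ M := le_max_of_le_left (norm_nonneg _)
  refine (B + C).opNorm_le_bound hM0 fun x => ?_
  refine (sq_le_sq₀ (norm_nonneg _) (by positivity)).1 ?_
  have e1 : K.starProjection ((B + C) x) = B (K.starProjection x) := by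
    have h1 : K.starProjection * (B + C) = B * K.starProjection := by
      rw [mul_add, hB, hB', ← hC, ← mul_assoc, starProjection_mul_orthogonal, zero_mul, add_zero]
    exact DFunLike.congr_fun h1 x
  have e2 : Kᗮ.starProjection ((B + C) x) = C (Kᗮ.starProjection x) := by
    have h1 : Kᗮ.starProjection * (B + C) = C * Kᗮ.starProjection := by
      rw [mul_add, hC, hC', ← hB, ← mul_assoc, starProjection_orthogonal_mul, zero_mul, zero_add]
    exact DFunLike.congr_fun h1 x
  rw [norm_sq_eq_add_blocks K, e1, e2, mul_pow, norm_sq_eq_add_blocks K x, mul_add, ← mul_pow,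
    ← mul_pow]
  gcongr
  · exact (B.le_opNorm _).trans (by gcongr; exact le_max_left _ _)
  · exact (C.le_opNorm _).trans (by gcongr; exact le_max_right _ _)

/-! ### The inverse of `1 + R Δ` -/

theorem isUnit_one_add_of_norm_lt_one {B : E →L[ℂ] E} (hB : ‖B‖ < 1) : IsUnit (1 + B) := by
  have := FiniteDimensional.complete ℂ E
  have := isUnit_one_sub_of_norm_lt_one (x := -B) (by rwa [norm_neg])
  rwa [sub_neg_eq_add] at this

/-- If (1 + B) x = y, then ‖x‖ ≤ ‖y‖ + ‖B‖ ‖x‖. With B = (R + R₂) D this produces the factor 1/η. -/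
theorem norm_inverse_one_add_le {B : E →L[ℂ] E} (hB : ‖B‖ < 1) :
    ‖Ring.inverse (1 + B)‖ ≤ 1 / (1 - ‖B‖) := by
  have h := Ring.mul_inverse_cancel _ (isUnit_one_add_of_norm_lt_one hB)
  refine ContinuousLinearMap.opNorm_le_bound _ (by
    have : 0 < 1 - ‖B‖ := by linarith
    positivity) fun y => ?_
  have h1 : Ring.inverse (1 + B) y + B (Ring.inverse (1 + B) y) = y := DFunLike.congr_fun h y
  set x := Ring.inverse (1 + B) y
  rw [div_mul_eq_mul_div, one_mul, le_div_iff₀ (by linarith)]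
  have h2 : ‖x‖ ≤ ‖y‖ + ‖B x‖ := by
    calc ‖x‖ = ‖y - B x‖ := by rw [← h1, add_sub_cancel_right]
      _ ≤ _ := norm_sub_le _ _
  linarith [B.le_opNorm x]

theorem hasDerivWithinAt_inverse {U : ℝ → E →L[ℂ] E} {U' : E →L[ℂ] E} {I : Set ℝ} {s : ℝ}
    (hu : IsUnit (U s)) (hU : HasDerivWithinAt U U' I s) :
    HasDerivWithinAt (fun t => Ring.inverse (U t))
      (-(Ring.inverse (U s) * U' * Ring.inverse (U s))) I s := by
  have := FiniteDimensional.complete ℂ E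
  obtain ⟨u, hu⟩ := hu
  have h := (hasFDerivAt_ringInverse (𝕜 := ℝ) u)
  rw [hu] at h
  have h1 := h.comp_hasDerivWithinAt s hU
  rw [← hu, Ring.inverse_unit]
  exact h1

/-! ### Bounds for one block -/

namespace GroundData

variable {N A P R B : E →L[ℂ] E} {μ γ b : ℝ}

theorem norm_R_mul_R (h : GroundData N A P R μ γ) : ‖R * R‖ ≤ 1 / γ ^ 2 := by
  have := norm_mul_le_of_le h.norm_R h.norm_R
  rwa [div_mul_div_comm, one_mul, ← sq γ] at this

theorem norm_RRBP_le (h : GroundData N A P R μ γ) : ‖R * R * B * P‖ ≤ ‖B‖ / γ ^ 2 := by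
  have := norm_mul_le_of_le (norm_mul_le_of_le h.norm_R_mul_R (le_refl ‖B‖)) h.norm_P
  rwa [mul_one, div_mul_eq_mul_div, one_mul] at this

theorem norm_PBRR_le (h : GroundData N A P R μ γ) : ‖P * B * R * R‖ ≤ ‖B‖ / γ ^ 2 := by
  have := norm_mul_le_of_le (norm_mul_le_of_le h.norm_P (le_refl ‖B‖)) h.norm_R_mul_R
  rwa [one_mul, mul_one_div, ← mul_assoc] at this

theorem norm_shifted_le (hb : |b| ≤ ‖B‖) : ‖shifted B b‖ ≤ 2 * ‖B‖ := by
  have h2 : ‖((b : ℝ) : ℂ) • (1 : E →L[ℂ] E)‖ ≤ ‖B‖ := by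
    rw [norm_smul, Complex.norm_real]
    exact (mul_le_of_le_one_right (norm_nonneg _) ContinuousLinearMap.norm_id_le).trans hb
  rw [shifted]
  linarith [norm_sub_le B ((b : ℂ) • (1 : E →L[ℂ] E))]

/-- The bound of the derivative of the reduced resolvent. -/
theorem norm_deriv_R_le (h : GroundData N A P R μ γ) (hb : |b| ≤ ‖B‖) :
    ‖-(R * shifted B b * R) + R * R * B * P + P * B * R * R‖ ≤ 4 * (‖B‖ / γ ^ 2) := by
  have h1 : ‖R * shifted B b * R‖ ≤ 2 * (‖B‖ / γ ^ 2) := by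
    have := norm_mul_le_of_le (norm_mul_le_of_le h.norm_R (norm_shifted_le hb)) h.norm_R
    refine this.trans (le_of_eq ?_)
    have := h.gap_pos
    field_simp
  rw [← norm_neg] at h1
  -- The 4 is 2 + 1 + 1: the 2 comes from ‖B - b‖ ≤ 2‖B‖, and each term that contains P contributes
  -- 1.
  linarith [norm_add₃_le (a := -(R * shifted B b * R)) (b := R * R * B * P) (c := P * B * R * R),
    h.norm_RRBP_le (B := B), h.norm_PBRR_le (B := B)]

theorem deriv_P_mul_P (h : GroundData N A P R μ γ) :
    -(P * B * R + R * B * P) * P = -(R * B * P) := by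
  rw [neg_mul, add_mul, mul_assoc (P * B), h.R_P, mul_zero, zero_add, mul_assoc (R * B), h.P_P]

theorem P_mul_deriv_P (h : GroundData N A P R μ γ) :
    P * -(P * B * R + R * B * P) = -(P * B * R) := by
  rw [mul_neg, mul_add, ← mul_assoc, ← mul_assoc, ← mul_assoc, ← mul_assoc, h.P_R, h.P_P, zero_mul,
    zero_mul, add_zero]

/-- The bound of the derivative of `R² B P`, applied to the ground space. -/
theorem norm_deriv_RRBP_mul_P_le (h : GroundData N A P R μ γ) (hb : |b| ≤ ‖B‖)
    {R' P' B' : E →L[ℂ] E} (hR' : R' = -(R * shifted B b * R) + R * R * B * P + P * B * R * R)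
    (hP' : P' = -(P * B * R + R * B * P)) :
    ‖(((R' * R + R * R') * B + R * R * B') * P + R * R * B * P') * P‖
      ≤ ‖B'‖ / γ ^ 2 + 10 * (‖B‖ ^ 2 / γ ^ 3) := by
  have hγ := h.gap_pos
  have hR : ‖R'‖ ≤ 4 * (‖B‖ / γ ^ 2) := hR' ▸ h.norm_deriv_R_le hb
  have e : (((R' * R + R * R') * B + R * R * B') * P + R * R * B * P') * P
      = R' * R * B * P + R * R' * B * P + R * R * B' * P + -(R * R * B * (R * B * P)) := by
    rw [add_mul _ (R * R * B * P'), mul_assoc (R * R * B) P' P, hP', h.deriv_P_mul_P, mul_assoc _ P P,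
      h.P_P, add_mul, add_mul, add_mul, mul_neg]
  have h1 : ‖R' * R * B * P‖ ≤ 4 * (‖B‖ ^ 2 / γ ^ 3) := by
    have := norm_mul_le_of_le (norm_mul_le_of_le (norm_mul_le_of_le hR h.norm_R) (le_refl ‖B‖))
      h.norm_P
    refine this.trans (le_of_eq ?_)
    field_simp
  have h2 : ‖R * R' * B * P‖ ≤ 4 * (‖B‖ ^ 2 / γ ^ 3) := by
    have := norm_mul_le_of_le (norm_mul_le_of_le (norm_mul_le_of_le h.norm_R hR) (le_refl ‖B‖))
      h.norm_P
    refine this.trans (le_of_eq ?_)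
    field_simp
  have h3 : ‖R * R * B' * P‖ ≤ ‖B'‖ / γ ^ 2 := h.norm_RRBP_le
  have h4 : ‖-(R * R * B * (R * B * P))‖ ≤ ‖B‖ ^ 2 / γ ^ 3 := by
    rw [norm_neg]
    have := norm_mul_le_of_le (norm_mul_le_of_le h.norm_R_mul_R (le_refl ‖B‖))
      (norm_mul_le_of_le (norm_mul_le_of_le h.norm_R (le_refl ‖B‖)) h.norm_P)
    refine this.trans (le_of_eq ?_)
    field_simp
  have h5 : 0 ≤ ‖B‖ ^ 2 / γ ^ 3 := by positivity
  rw [e]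
  have := norm_add_le (R' * R * B * P + R * R' * B * P + R * R * B' * P) (-(R * R * B * (R * B * P)))
  -- The quadratic contributions are 4 + 4 + 1 = 9, one less than the constant 10 allows.
  linarith [norm_add₃_le (a := R' * R * B * P) (b := R * R' * B * P) (c := R * R * B' * P)]

end GroundData

/-! ### Two blocks coupled away from their ground spaces -/

theorem mul_eq_zero_of_factor {X Y N M : E →L[ℂ] E} (hX : X * N = X) (hY : M * Y = Y)
    (h : N * M = 0) : X * Y = 0 := by
  rw [← hX, ← hY, mul_assoc, ← mul_assoc N, h, zero_mul, mul_zero]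

section TwoBlocks

variable {K : Submodule ℂ E} {A P R A₂ P₂ R₂ D B : E →L[ℂ] E} {μ γ μ₂ γ₂ : ℝ}

theorem norm_R_add_R_le (h : GroundData K.starProjection A P R μ γ)
    (h₂ : GroundData Kᗮ.starProjection A₂ P₂ R₂ μ₂ γ₂) : ‖R + R₂‖ ≤ 1 / min γ γ₂ := by
  have hm : 0 < min γ γ₂ := lt_min h.gap_pos h₂.gap_pos
  refine (norm_add_le_max_of_blocks h.N_R h.R_N h₂.N_R h₂.R_N).trans (max_le ?_ ?_)
  · exact h.norm_R.trans (one_div_le_one_div_of_le hm (min_le_left _ _))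
  · exact h₂.norm_R.trans (one_div_le_one_div_of_le hm (min_le_right _ _))

/-- `A + A₂ + (μ - μ₂) N₂ + D`, whose restrictions to the two blocks have the ground energy `μ`. -/
def coupled (K : Submodule ℂ E) (A A₂ D : E →L[ℂ] E) (μ μ₂ : ℝ) : E →L[ℂ] E :=
  A + A₂ + ((μ - μ₂ : ℝ) : ℂ) • Kᗮ.starProjection + D

theorem coupled_sub (K : Submodule ℂ E) (A A₂ D : E →L[ℂ] E) (μ μ₂ : ℝ) :
    coupled K A A₂ D μ μ₂ - (μ : ℂ) • 1 = shifted A μ * K.starProjection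
      + shifted A₂ μ₂ * Kᗮ.starProjection + D + A * Kᗮ.starProjection + A₂ * K.starProjection := by
  rw [coupled, shifted, shifted, Submodule.starProjection_orthogonal']
  push_cast
  simp only [mul_sub, sub_mul, smul_mul_assoc, one_mul, mul_one, sub_smul, smul_sub]
  abel

/-- The solution `Z` of `(C - μ) Z = R B P`, where `C` is the coupled operator. -/
def couplingSolution (R R₂ D B P : E →L[ℂ] E) : E →L[ℂ] E :=
  Ring.inverse (1 + (R + R₂) * D) * (R * R * B * P)

theorem couplingSolution_mul_P (h : GroundData K.starProjection A P R μ γ) :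
    couplingSolution R R₂ D B P * P = couplingSolution R R₂ D B P := by
  rw [couplingSolution, mul_assoc, mul_assoc _ P P, h.P_P]

/-- Without D, the operator `coupled` minus μ is inverted by R + R₂ off the two ground spaces,
because the alignment gives both blocks the same ground energy. Since D and R B P have range off
these spaces, the remaining equation is (1 + (R + R₂) D) Z = R² B P. -/
theorem coupled_mul_couplingSolution (h : GroundData K.starProjection A P R μ γ)
    (h₂ : GroundData Kᗮ.starProjection A₂ P₂ R₂ μ₂ γ₂) (hD : (1 - P - P₂) * D = D)
    (hu : ‖(R + R₂) * D‖ < 1) :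
    (coupled K A A₂ D μ μ₂ - (μ : ℂ) • 1) * couplingSolution R R₂ D B P = R * B * P := by
  set Z := couplingSolution R R₂ D B P with hZ
  have hNN₂ := starProjection_mul_orthogonal K
  have hN₂N := starProjection_orthogonal_mul K
  have hR₂R : R₂ * R = 0 := mul_eq_zero_of_factor h₂.R_N h.N_R hN₂N
  have hP₂R : P₂ * R = 0 := mul_eq_zero_of_factor h₂.P_N h.N_R hN₂N
  -- The fixed-point form of the definition of Z: it shows that Z lies in the range of R + R₂, where
  -- the uncoupled operator can be applied.
  have h1 : Z = (R + R₂) * (R * B * P - D * Z) := by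
    have h2 : (1 + (R + R₂) * D) * Z = R * R * B * P := by
      rw [hZ, couplingSolution, ← mul_assoc,
        Ring.mul_inverse_cancel _ (isUnit_one_add_of_norm_lt_one hu), one_mul]
    rw [add_mul, one_mul] at h2
    have h3 : (R + R₂) * (R * B * P) = R * R * B * P := by
      rw [add_mul, ← mul_assoc R₂, ← mul_assoc R₂, hR₂R, zero_mul, zero_mul, add_zero]
      simp only [mul_assoc]
    rw [mul_sub, h3, ← h2, ← mul_assoc, add_sub_cancel_right]
  have h4 : (shifted A μ * K.starProjection + shifted A₂ μ₂ * Kᗮ.starProjection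
      + A * Kᗮ.starProjection + A₂ * K.starProjection) * (R + R₂) = 1 - P - P₂ := by
    have k1 : A * Kᗮ.starProjection = 0 := by rw [← h.A_N, mul_assoc, hNN₂, mul_zero]
    have k2 : A₂ * K.starProjection = 0 := by rw [← h₂.A_N, mul_assoc, hN₂N, mul_zero]
    have k3 : K.starProjection * R₂ = 0 := by rw [← h₂.N_R, ← mul_assoc, hNN₂, zero_mul]
    have k4 : Kᗮ.starProjection * R = 0 := by rw [← h.N_R, ← mul_assoc, hN₂N, zero_mul]
    rw [k1, k2, add_zero, add_zero, mul_add, add_mul, add_mul, mul_assoc, mul_assoc, mul_assoc,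
      mul_assoc, k3, k4, mul_zero, mul_zero, h.N_R, h₂.N_R, h.sA_R, h₂.sA_R,
      Submodule.starProjection_orthogonal']
    abel
  have h5 : (1 - P - P₂) * (R * B * P) = R * B * P := by
    rw [sub_mul, sub_mul, one_mul, ← mul_assoc P, ← mul_assoc P, h.P_R, ← mul_assoc P₂,
      ← mul_assoc P₂, hP₂R, zero_mul, zero_mul, sub_zero, sub_zero]
  rw [coupled_sub]
  have h6 : (shifted A μ * K.starProjection + shifted A₂ μ₂ * Kᗮ.starProjection
      + A * Kᗮ.starProjection + A₂ * K.starProjection) * Z = R * B * P - D * Z := by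
    conv_lhs => rw [h1]
    rw [← mul_assoc, h4, mul_sub, h5, ← mul_assoc, hD]
  calc _ = (shifted A μ * K.starProjection + shifted A₂ μ₂ * Kᗮ.starProjection
      + A * Kᗮ.starProjection + A₂ * K.starProjection) * Z + D * Z := by
        rw [← add_mul]; congr 1; abel
    _ = R * B * P := by rw [h6, sub_add_cancel]

theorem norm_R_mul_le (h : GroundData K.starProjection A P R μ γ)
    (h₂ : GroundData Kᗮ.starProjection A₂ P₂ R₂ μ₂ γ₂) :
    ‖(R + R₂) * D‖ ≤ ‖D‖ / min γ γ₂ := by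
  have := norm_mul_le_of_le (norm_R_add_R_le h h₂) (le_refl ‖D‖)
  rwa [div_mul_eq_mul_div, one_mul] at this

theorem norm_inverse_le (h : GroundData K.starProjection A P R μ γ)
    (h₂ : GroundData Kᗮ.starProjection A₂ P₂ R₂ μ₂ γ₂) (hη : 0 < 1 - ‖D‖ / min γ γ₂) :
    ‖Ring.inverse (1 + (R + R₂) * D)‖ ≤ 1 / (1 - ‖D‖ / min γ γ₂) := by
  have h1 := norm_R_mul_le (D := D) h h₂
  exact (norm_inverse_one_add_le (by linarith)).trans
    (one_div_le_one_div_of_le hη (by linarith))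

theorem norm_couplingSolution_le (h : GroundData K.starProjection A P R μ γ)
    (h₂ : GroundData Kᗮ.starProjection A₂ P₂ R₂ μ₂ γ₂) (hη : 0 < 1 - ‖D‖ / min γ γ₂) :
    ‖couplingSolution R R₂ D B P‖ ≤ 1 / (1 - ‖D‖ / min γ γ₂) * (‖B‖ / γ ^ 2) :=
  norm_mul_le_of_le (norm_inverse_le h h₂ hη) h.norm_RRBP_le

end TwoBlocks

/-! ### Differentiating the coupling solution along a path -/

section Families

variable {K : Submodule ℂ E} {A P R A₂ P₂ R₂ D B : ℝ → E →L[ℂ] E} {μ γ μ₂ γ₂ : ℝ → ℝ}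
  {I : Set ℝ} {s : ℝ} {B' B₂ D' : E →L[ℂ] E}

/-- The derivative of the coupling solution, with its bound on the ground space. -/
theorem exists_hasDerivWithinAt_couplingSolution (hs : s ∈ I)
    (h : ∀ t ∈ I, GroundData K.starProjection (A t) (P t) (R t) (μ t) (γ t))
    (h₂ : ∀ t ∈ I, GroundData Kᗮ.starProjection (A₂ t) (P₂ t) (R₂ t) (μ₂ t) (γ₂ t))
    (hA : HasDerivWithinAt A (B s) I s) (hB : HasDerivWithinAt B B' I s)
    (hA₂ : HasDerivWithinAt A₂ B₂ I s) (hD : HasDerivWithinAt D D' I s)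
    (hη : 0 < 1 - ‖D s‖ / min (γ s) (γ₂ s)) :
    ∃ Z' : E →L[ℂ] E, HasDerivWithinAt
        (fun t => couplingSolution (R t) (R₂ t) (D t) (B t) (P t)) Z' I s ∧
      ‖Z' * P s‖ ≤ 1 / (1 - ‖D s‖ / min (γ s) (γ₂ s)) *
        (‖B'‖ / γ s ^ 2 + 10 * (‖B s‖ ^ 2 / γ s ^ 3)
          + 1 / (1 - ‖D s‖ / min (γ s) (γ₂ s)) * (‖B s‖ / γ s ^ 2) *
            (‖D'‖ / min (γ s) (γ₂ s)
              + 4 * ‖D s‖ * max (‖B s‖ / γ s ^ 2) (‖B₂‖ / γ₂ s ^ 2))) := by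
  have hh := h s hs
  have hh₂ := h₂ s hs
  have hm : 0 < min (γ s) (γ₂ s) := lt_min hh.gap_pos hh₂.gap_pos
  obtain ⟨b, hb, hb'⟩ := GroundData.exists_hasDerivWithinAt_energy hs h hA
  obtain ⟨b₂, hb₂, hb₂'⟩ := GroundData.exists_hasDerivWithinAt_energy hs h₂ hA₂
  have hP := GroundData.hasDerivWithinAt_P hs h hA
  have hR := GroundData.hasDerivWithinAt_R hs h hA hb
  have hR₂ := GroundData.hasDerivWithinAt_R hs h₂ hA₂ hb₂
  set P' := -(P s * B s * R s + R s * B s * P s) with hP'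
  set R' := -(R s * shifted (B s) b * R s) + R s * R s * B s * P s + P s * B s * R s * R s with hR'
  set R₂' := -(R₂ s * shifted B₂ b₂ * R₂ s) + R₂ s * R₂ s * B₂ * P₂ s + P₂ s * B₂ * R₂ s * R₂ s
    with hR₂'
  have hu := isUnit_one_add_of_norm_lt_one
    (lt_of_le_of_lt (norm_R_mul_le (D := D s) hh hh₂) (by linarith))
  have hG := hasDerivWithinAt_inverse (U := fun t => 1 + (R t + R₂ t) * D t) hu
    (((hR.add hR₂).mul hD).const_add 1)
  have hY := ((hR.mul hR).mul hB).mul hP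
  refine ⟨_, hG.mul hY, ?_⟩
  have hGn := norm_inverse_le (D := D s) hh hh₂ hη
  set G := Ring.inverse (1 + (R s + R₂ s) * D s)
  set η := 1 - ‖D s‖ / min (γ s) (γ₂ s)
  -- Each derivative stays in its own block, so the maximum of the two bounds suffices.
  have hRR : ‖R' + R₂'‖ ≤ 4 * max (‖B s‖ / γ s ^ 2) (‖B₂‖ / γ₂ s ^ 2) := by
    have k1 : K.starProjection * R' = R' := by
      rw [hR', mul_add, mul_add, mul_neg]; simp only [← mul_assoc, hh.N_R, hh.N_P]
    have k2 : R' * K.starProjection = R' := by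
      rw [hR', add_mul, add_mul, neg_mul]; simp only [mul_assoc, hh.R_N, hh.P_N]
    have k3 : Kᗮ.starProjection * R₂' = R₂' := by
      rw [hR₂', mul_add, mul_add, mul_neg]; simp only [← mul_assoc, hh₂.N_R, hh₂.N_P]
    have k4 : R₂' * Kᗮ.starProjection = R₂' := by
      rw [hR₂', add_mul, add_mul, neg_mul]; simp only [mul_assoc, hh₂.R_N, hh₂.P_N]
    refine (norm_add_le_max_of_blocks k1 k2 k3 k4).trans (max_le ?_ ?_)
    · exact (hh.norm_deriv_R_le hb').trans (by gcongr; exact le_max_left _ _)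
    · exact (hh₂.norm_deriv_R_le hb₂').trans (by gcongr; exact le_max_right _ _)
  have hU' : ‖(R' + R₂') * D s + (R s + R₂ s) * D'‖
      ≤ ‖D'‖ / min (γ s) (γ₂ s)
        + 4 * ‖D s‖ * max (‖B s‖ / γ s ^ 2) (‖B₂‖ / γ₂ s ^ 2) := by
    have k1 := norm_mul_le_of_le hRR (le_refl ‖D s‖)
    have k2 := norm_R_mul_le (D := D') hh hh₂
    linarith [norm_add_le ((R' + R₂') * D s) ((R s + R₂ s) * D')]
  set U' := (R' + R₂') * D s + (R s + R₂ s) * D'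
  set Y := ((R' * R s + R s * R') * B s + R s * R s * B') * P s + R s * R s * B s * P' with hYdef
  have hYn : ‖Y * P s‖ ≤ ‖B'‖ / γ s ^ 2 + 10 * (‖B s‖ ^ 2 / γ s ^ 3) :=
    hh.norm_deriv_RRBP_mul_P_le hb' hR' hP'
  have hP2 : R s * R s * B s * P s * P s = R s * R s * B s * P s := by
    rw [mul_assoc, hh.P_P]
  -- Multiplying by P s on the right costs nothing in the first term, which already ends in P s, and
  -- allows the sharper bound for Y P s in the second.
  have e : (-(G * U' * G) * (R s * R s * B s * P s) + G * Y) * P s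
      = -(G * U' * (G * (R s * R s * B s * P s))) + G * (Y * P s) := by
    rw [add_mul, mul_assoc _ _ (P s), hP2, neg_mul, mul_assoc (G * U'), mul_assoc G Y]
  have hη' : 0 ≤ 1 / η := by positivity
  have h1 : ‖-(G * U' * (G * (R s * R s * B s * P s)))‖
      ≤ 1 / η * (‖D'‖ / min (γ s) (γ₂ s)
        + 4 * ‖D s‖ * max (‖B s‖ / γ s ^ 2) (‖B₂‖ / γ₂ s ^ 2)) * (1 / η * (‖B s‖ / γ s ^ 2)) := by
    rw [norm_neg]
    exact norm_mul_le_of_le (norm_mul_le_of_le hGn hU') (norm_mul_le_of_le hGn hh.norm_RRBP_le)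
  have h2 : ‖G * (Y * P s)‖ ≤ 1 / η * (‖B'‖ / γ s ^ 2 + 10 * (‖B s‖ ^ 2 / γ s ^ 3)) :=
    norm_mul_le_of_le hGn hYn
  have h3 := norm_add_le (-(G * U' * (G * (R s * R s * B s * P s)))) (G * (Y * P s))
  rw [← e] at h3
  refine h3.trans ((add_le_add h1 h2).trans (le_of_eq ?_))
  ring

end Families

/-! ### The adiabatic estimate -/

theorem IsEvolution.hasDerivWithinAt_apply {G U : ℝ → E →L[ℂ] E} (hU : IsEvolution G U) (x : E)
    {s : ℝ} (hs : s ∈ Icc (0 : ℝ) 1) :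
    HasDerivWithinAt (fun t => U t x) (-Complex.I • G s (U s x)) (Icc (0 : ℝ) 1) s := by
  have := hasDerivWithinAt_clm_apply (hU.2 s hs) (hasDerivWithinAt_const s _ x)
  rw [map_zero, add_zero] at this
  exact this

theorem IsEvolution.norm_apply_le {G U : ℝ → E →L[ℂ] E} (hU : IsEvolution G U)
    (hG : ∀ s ∈ Icc (0 : ℝ) 1, (G s : E →ₗ[ℂ] E).IsSymmetric) (x : E) {s : ℝ}
    (hs : s ∈ Icc (0 : ℝ) 1) : ‖U s x‖ ≤ ‖x‖ := by
  have h := norm_le_of_forced_schroedinger (f := fun _ => 0) (C := 0) hG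
    (fun t ht => by rw [add_zero]; exact hU.hasDerivWithinAt_apply x ht) (by simp) hs
  rw [hU.1, add_zero] at h
  exact h

section Algebra

variable {P Q H : E →L[ℂ] E}

theorem mul_deriv_mul_eq_zero (hPP : P * P = P) (hQ : Q = Q * P + P * Q) : P * Q * P = 0 := by
  have h := congrArg (fun X => P * X * P) hQ
  simp only [mul_add, add_mul] at h
  rw [mul_assoc P (Q * P), mul_assoc Q P P, hPP, ← mul_assoc P P Q, hPP, ← mul_assoc P Q P] at h
  exact left_eq_add.1 h

end Algebra

/-- The adiabatic generator transports the ground space. -/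
theorem proj_apply_adiabatic_evolution {T : ℝ} {H P Q V : ℝ → E →L[ℂ] E} {μ : ℝ → ℝ}
    (hH : ∀ s ∈ Icc (0 : ℝ) 1, (H s : E →ₗ[ℂ] E).IsSymmetric)
    (hP : ∀ s ∈ Icc (0 : ℝ) 1, HasDerivWithinAt P (Q s) (Icc 0 1) s)
    (hPs : ∀ s ∈ Icc (0 : ℝ) 1, (P s : E →ₗ[ℂ] E).IsSymmetric)
    (hQs : ∀ s ∈ Icc (0 : ℝ) 1, (Q s : E →ₗ[ℂ] E).IsSymmetric)
    (hPP : ∀ s ∈ Icc (0 : ℝ) 1, P s * P s = P s)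
    (hQ : ∀ s ∈ Icc (0 : ℝ) 1, Q s = Q s * P s + P s * Q s)
    (hHP : ∀ s ∈ Icc (0 : ℝ) 1, H s * P s = (μ s : ℂ) • P s)
    (hPH : ∀ s ∈ Icc (0 : ℝ) 1, P s * H s = (μ s : ℂ) • P s)
    (hV : IsEvolution (fun s => (T : ℂ) • H s + Complex.I • (Q s * P s - P s * Q s)) V)
    (x : E) : (∀ s ∈ Icc (0 : ℝ) 1, ‖V s x‖ ≤ ‖x‖) ∧
      (P 0 x = x → ∀ s ∈ Icc (0 : ℝ) 1, P s (V s x) = V s x) := by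
  have hsym : ∀ s ∈ Icc (0 : ℝ) 1,
      (((T : ℂ) • H s + Complex.I • (Q s * P s - P s * Q s) : E →L[ℂ] E)
        : E →ₗ[ℂ] E).IsSymmetric := by
    intro s hs y z
    change inner ℂ ((T : ℂ) • H s y + Complex.I • (Q s (P s y) - P s (Q s y))) z
      = inner ℂ y ((T : ℂ) • H s z + Complex.I • (Q s (P s z) - P s (Q s z)))
    have h1 : inner ℂ (H s y) z = inner ℂ y (H s z) := hH s hs y z
    have h2 : inner ℂ (Q s (P s y)) z = inner ℂ y (P s (Q s z)) :=
      (hQs s hs _ _).trans (hPs s hs _ _)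
    have h3 : inner ℂ (P s (Q s y)) z = inner ℂ y (Q s (P s z)) :=
      (hPs s hs _ _).trans (hQs s hs _ _)
    simp only [inner_add_left, inner_add_right, inner_smul_left, inner_smul_right, inner_sub_left,
      inner_sub_right, h1, h2, h3, Complex.conj_ofReal, Complex.conj_I]
    ring
  refine ⟨fun s hs => hV.norm_apply_le hsym x hs, fun hx s hs => ?_⟩
  -- The defect P V x - V x solves the same homogeneous equation as V x, because P commutes with H
  -- and Q = [[Q, P], P] when P Q P = 0. It starts at zero, so it remains zero.
  have hd : ∀ t ∈ Icc (0 : ℝ) 1, HasDerivWithinAt (fun t => P t (V t x) - V t x)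
      (-Complex.I • ((T : ℂ) • H t + Complex.I • (Q t * P t - P t * Q t)) (P t (V t x) - V t x)
        + 0) (Icc (0 : ℝ) 1) t := by
    intro t ht
    have hv := hV.hasDerivWithinAt_apply x ht
    refine ((hasDerivWithinAt_clm_apply (hP t ht) hv).sub hv).congr_deriv ?_
    set v := V t x
    have e1 : P t (Q t (P t v)) = 0 :=
      DFunLike.congr_fun (mul_deriv_mul_eq_zero (hPP t ht) (hQ t ht)) v
    have e2 : P t (P t v) = P t v := DFunLike.congr_fun (hPP t ht) v
    have e2' : P t (P t (Q t v)) = P t (Q t v) := DFunLike.congr_fun (hPP t ht) (Q t v)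
    have e3 : H t (P t v) = (μ t : ℂ) • P t v := DFunLike.congr_fun (hHP t ht) v
    have e4 : P t (H t v) = (μ t : ℂ) • P t v := DFunLike.congr_fun (hPH t ht) v
    have e5 : Q t v = Q t (P t v) + P t (Q t v) := DFunLike.congr_fun (hQ t ht) v
    simp only [add_apply, smul_apply, sub_apply, mul_apply_eq_comp, map_sub, map_add, map_smul, e1,
      e2, e2', e3, e4]
    conv_lhs => enter [1, 1]; rw [e5]
    match_scalars <;> ring_nf <;> simp
  have h := norm_le_of_forced_schroedinger (f := fun _ => 0) (C := 0) hsym hd (by simp) hs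
  have h0 : P 0 (V 0 x) - V 0 x = 0 := by
    rw [hV.1]; exact sub_eq_zero.2 hx
  rw [h0, norm_zero, add_zero] at h
  exact sub_eq_zero.1 (norm_le_zero_iff.1 h)

/-- The abstract adiabatic theorem: if `(C - μ) Z = -Ṗ P` and `Z = Z P`, the evolution with
generator `T C` follows the adiabatic evolution up to boundary terms and the derivative of `Z`. -/
theorem norm_sub_adiabatic_evolution_le {T : ℝ} (hT : 0 < T) {C P Q V W Z Z' G : ℝ → E →L[ℂ] E}
    {μ : ℝ → ℝ} {c₀ c₁ b : ℝ}
    (hC : ∀ s ∈ Icc (0 : ℝ) 1, (C s : E →ₗ[ℂ] E).IsSymmetric)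
    (hW : IsEvolution (fun s => (T : ℂ) • C s) W) (hV : IsEvolution G V) {x : E}
    (hVn : ∀ s ∈ Icc (0 : ℝ) 1, ‖V s x‖ ≤ ‖x‖)
    (hVP : ∀ s ∈ Icc (0 : ℝ) 1, P s (V s x) = V s x)
    (hPQP : ∀ s ∈ Icc (0 : ℝ) 1, P s * Q s * P s = 0)
    (hG : ∀ s ∈ Icc (0 : ℝ) 1,
      G s * P s = ((T * μ s : ℝ) : ℂ) • P s + Complex.I • (Q s * P s))
    (hCP : ∀ s ∈ Icc (0 : ℝ) 1, C s * P s = (μ s : ℂ) • P s)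
    (hZ : ∀ s ∈ Icc (0 : ℝ) 1, HasDerivWithinAt Z (Z' s) (Icc 0 1) s)
    (hZP : ∀ s ∈ Icc (0 : ℝ) 1, Z s * P s = Z s)
    (hCZ : ∀ s ∈ Icc (0 : ℝ) 1, (C s - (μ s : ℂ) • 1) * Z s = -(Q s * P s))
    (h0 : ‖Z 0‖ ≤ c₀) (h1 : ‖Z 1‖ ≤ c₁) (hb : ∀ s ∈ Icc (0 : ℝ) 1, ‖Z' s * P s‖ ≤ b) :
    ‖W 1 x - V 1 x‖ ≤ (c₀ + c₁ + b) / T * ‖x‖ := by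
  have hTC : (T : ℂ) ≠ 0 := by exact_mod_cast hT.ne'
  have m0 : (0 : ℝ) ∈ Icc (0 : ℝ) 1 := by simp
  have m1 : (1 : ℝ) ∈ Icc (0 : ℝ) 1 := by simp
  have hCs : ∀ s ∈ Icc (0 : ℝ) 1, (((T : ℂ) • C s : E →L[ℂ] E) : E →ₗ[ℂ] E).IsSymmetric := by
    intro s hs y z
    change inner ℂ ((T : ℂ) • C s y) z = inner ℂ y ((T : ℂ) • C s z)
    have : inner ℂ (C s y) z = inner ℂ y (C s z) := hC s hs y z
    rw [inner_smul_left, inner_smul_right, this, Complex.conj_ofReal]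
  -- Under the generator T C, the vector V x has the forcing Q V x. The correction contributes (C -
  -- μ) Z V x, which cancels it by `hCZ`; only -(i/T) Z' V x is left.
  set r : ℝ → E := fun t => V t x - (Complex.I / T) • Z t (V t x) - W t x with hr
  have hd : ∀ t ∈ Icc (0 : ℝ) 1, HasDerivWithinAt r
      (-Complex.I • ((T : ℂ) • C t) (r t) + -((Complex.I / T) • Z' t (V t x)))
      (Icc (0 : ℝ) 1) t := by
    intro t ht
    have hv := hV.hasDerivWithinAt_apply x ht
    have hw := hW.hasDerivWithinAt_apply x ht
    refine ((hv.sub ((hasDerivWithinAt_clm_apply (hZ t ht) hv).const_smul (Complex.I / (T : ℂ)))).sub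
      hw).congr_deriv ?_
    simp only [hr]
    set v := V t x
    have hPv : P t v = v := hVP t ht
    have e1 : G t v = ((T * μ t : ℝ) : ℂ) • v + Complex.I • Q t v := by
      have := DFunLike.congr_fun (hG t ht) v
      simpa only [mul_apply_eq_comp, add_apply, smul_apply, hPv] using this
    have e2 : P t (Q t v) = 0 := by
      have h : P t (Q t (P t v)) = 0 := DFunLike.congr_fun (hPQP t ht) v
      rwa [hPv] at h
    have e3 : Z t (Q t v) = 0 := by
      have := DFunLike.congr_fun (hZP t ht) (Q t v)
      rw [← this, mul_apply_eq_comp, e2, map_zero]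
    have e4 : C t v = (μ t : ℂ) • v := by
      have := DFunLike.congr_fun (hCP t ht) v
      simpa only [mul_apply_eq_comp, smul_apply, hPv] using this
    have e5 : C t (Z t v) = (μ t : ℂ) • Z t v - Q t v := by
      have h := DFunLike.congr_fun (hCZ t ht) v
      have h' : C t (Z t v) - (μ t : ℂ) • Z t v = -Q t (P t v) := h
      rw [hPv] at h'
      rw [sub_eq_iff_eq_add'.1 h', sub_eq_add_neg]
    simp only [e1, smul_apply, map_sub, map_smul, map_add, e3, e4, e5]
    push_cast
    match_scalars <;> field_simp
  have hf : ∀ t ∈ Icc (0 : ℝ) 1, ‖-((Complex.I / T) • Z' t (V t x))‖ ≤ b / T * ‖x‖ := by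
    intro t ht
    -- The adiabatic vector is in the range of P, so only Z' P has to be bounded.
    have e : Z' t (V t x) = (Z' t * P t) (V t x) := by rw [mul_apply_eq_comp, hVP t ht]
    rw [norm_neg, norm_smul, norm_div, Complex.norm_I, Complex.norm_real, Real.norm_eq_abs,
      abs_of_pos hT, e]
    calc 1 / T * ‖(Z' t * P t) (V t x)‖ ≤ 1 / T * (b * ‖x‖) := by
          gcongr
          exact ((Z' t * P t).le_opNorm _).trans (mul_le_mul (hb t ht) (hVn t ht) (norm_nonneg _)
            ((norm_nonneg _).trans (hb t ht)))
      _ = b / T * ‖x‖ := by ring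
  have hmain := norm_le_of_forced_schroedinger hCs hd hf m1
  have hZn : ∀ t ∈ Icc (0 : ℝ) 1, ∀ c, ‖Z t‖ ≤ c →
      ‖(Complex.I / T) • Z t (V t x)‖ ≤ c / T * ‖x‖ := by
    intro t ht c hc
    rw [norm_smul, norm_div, Complex.norm_I, Complex.norm_real, Real.norm_eq_abs, abs_of_pos hT]
    calc 1 / T * ‖Z t (V t x)‖ ≤ 1 / T * (c * ‖x‖) := by
          gcongr
          exact ((Z t).le_opNorm _).trans (mul_le_mul hc (hVn t ht) (norm_nonneg _)
            ((norm_nonneg _).trans hc))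
      _ = c / T * ‖x‖ := by ring
  have k0 : ‖r 0‖ ≤ c₀ / T * ‖x‖ := by
    have : r 0 = -((Complex.I / T) • Z 0 (V 0 x)) := by
      simp only [hr]; rw [hV.1, hW.1]; abel
    rw [this, norm_neg]
    exact hZn 0 m0 _ h0
  have k1 := hZn 1 m1 _ h1
  have e : W 1 x - V 1 x = -(r 1 + (Complex.I / T) • Z 1 (V 1 x)) := by
    simp only [hr]; abel
  rw [e, norm_neg]
  refine (norm_add_le _ _).trans ?_
  have : (c₀ + c₁ + b) / T * ‖x‖ = c₀ / T * ‖x‖ + b / T * ‖x‖ + c₁ / T * ‖x‖ := by ring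
  linarith

/-! ### The adiabatic estimate for block-diagonal families -/

theorem isSymmetric_of_hasDerivWithinAt {A : ℝ → E →L[ℂ] E} {B : E →L[ℂ] E} {I : Set ℝ} {s : ℝ}
    (hI : UniqueDiffWithinAt ℝ I s) (hs : s ∈ I)
    (hA : ∀ t ∈ I, (A t : E →ₗ[ℂ] E).IsSymmetric) (hB : HasDerivWithinAt A B I s) :
    (B : E →ₗ[ℂ] E).IsSymmetric := by
  intro x y
  have d : ∀ z, HasDerivWithinAt (fun t => A t z) (B z) I s := fun z => by
    have := hasDerivWithinAt_clm_apply hB (hasDerivWithinAt_const s I z)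
    rwa [map_zero, add_zero] at this
  have h1 := (d x).inner ℂ (hasDerivWithinAt_const s I y)
  have h2 := (hasDerivWithinAt_const s I x).inner ℂ (d y)
  have h3 := hI.eq_deriv _ h1 (h2.congr (fun t ht => hA t ht x y) (hA s hs x y))
  simpa using h3

theorem hasDerivWithinAt_block (K : Submodule ℂ E) {H : ℝ → E →L[ℂ] E} {H' : E →L[ℂ] E}
    {I : Set ℝ} {s : ℝ} (hH : HasDerivWithinAt H H' I s) :
    HasDerivWithinAt (fun t => block K (H t)) (block K H') I s :=
  (hH.const_mul K.starProjection).mul_const K.starProjection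

theorem uniqueDiffWithinAt_unit {s : ℝ} (hs : s ∈ Icc (0 : ℝ) 1) :
    UniqueDiffWithinAt ℝ (Icc (0 : ℝ) 1) s :=
  uniqueDiffOn_Icc zero_lt_one s hs

theorem HasDerivWithinAt.dot_eq {F : Type*} [NormedAddCommGroup F] [NormedSpace ℝ F] {A : ℝ → F}
    {A' : F} {s : ℝ} (hs : s ∈ Icc (0 : ℝ) 1) (h : HasDerivWithinAt A A' (Icc (0 : ℝ) 1) s) :
    dot A s = A' :=
  h.derivWithin (uniqueDiffWithinAt_unit hs)

section Block

variable {H : ℝ → E →L[ℂ] E}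

theorem hasDerivWithinAt_dot_block (K : Submodule ℂ E) (hH : DifferentiableOn ℝ H (Icc 0 1))
    {s : ℝ} (hs : s ∈ Icc (0 : ℝ) 1) :
    HasDerivWithinAt (fun t => block K (H t)) (dot (fun t => block K (H t)) s) (Icc 0 1) s :=
  (hasDerivWithinAt_block K (hH s hs).hasDerivWithinAt).differentiableWithinAt.hasDerivWithinAt

theorem hasDerivWithinAt_dot_dot_block (K : Submodule ℂ E) (hH : DifferentiableOn ℝ H (Icc 0 1))
    (hH2 : DifferentiableOn ℝ (dot H) (Icc 0 1)) {s : ℝ} (hs : s ∈ Icc (0 : ℝ) 1) :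
    HasDerivWithinAt (dot (fun t => block K (H t))) (dot (dot (fun t => block K (H t))) s)
      (Icc 0 1) s := by
  have e : ∀ t ∈ Icc (0 : ℝ) 1, dot (fun t => block K (H t)) t = block K (dot H t) := fun t ht =>
    HasDerivWithinAt.dot_eq ht (hasDerivWithinAt_block K (hH t ht).hasDerivWithinAt)
  exact ((hasDerivWithinAt_block K (hH2 s hs).hasDerivWithinAt).congr e
    (e s hs)).differentiableWithinAt.hasDerivWithinAt

end Block

theorem commute_orthogonal {S : Submodule ℂ E} {H : E →L[ℂ] E}
    (h : H * S.starProjection = S.starProjection * H) :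
    H * Sᗮ.starProjection = Sᗮ.starProjection * H := by
  rw [Submodule.starProjection_orthogonal', mul_sub, sub_mul, h, mul_one, one_mul]

theorem block_add_block {S : Submodule ℂ E} {H : E →L[ℂ] E}
    (h : H * S.starProjection = S.starProjection * H) : block S H + block Sᗮ H = H := by
  have h1 : block S H = H * S.starProjection := by
    rw [block, ← h, mul_assoc, S.isIdempotentElem_starProjection.eq]
  have h2 : block Sᗮ H = H * Sᗮ.starProjection := by
    rw [block, ← commute_orthogonal h, mul_assoc, Sᗮ.isIdempotentElem_starProjection.eq]
  rw [h1, h2, ← mul_add, Submodule.starProjection_orthogonal', add_sub_cancel, mul_one]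

theorem isSymmetric_awayProj (S : Submodule ℂ E) (H : E →L[ℂ] E) :
    (awayProj S H : E →ₗ[ℂ] E).IsSymmetric := by
  intro x y
  have h1 : inner ℂ (groundProj S H x) y = inner ℂ x (groundProj S H y) :=
    (groundSpace S H).starProjection_isSymmetric x y
  have h2 : inner ℂ (groundProj Sᗮ H x) y = inner ℂ x (groundProj Sᗮ H y) :=
    (groundSpace Sᗮ H).starProjection_isSymmetric x y
  change inner ℂ (x - groundProj S H x - groundProj Sᗮ H x) y
    = inner ℂ x (y - groundProj S H y - groundProj Sᗮ H y)
  simp only [inner_sub_left, inner_sub_right, h1, h2]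

theorem groundProj_mul_self (S : Submodule ℂ E) (H : E →L[ℂ] E) :
    groundProj S H * groundProj S H = groundProj S H :=
  (groundSpace S H).isIdempotentElem_starProjection

theorem groundProj_mul_groundProj_orthogonal (S : Submodule ℂ E) (H : E →L[ℂ] E) :
    groundProj S H * groundProj Sᗮ H = 0 := by
  have h : groundSpace S H ⟂ groundSpace Sᗮ H := (Submodule.isOrtho_orthogonal_right S).mono
    inf_le_left inf_le_left
  exact h.starProjection_comp_starProjection

theorem groundProj_orthogonal_mul_groundProj (S : Submodule ℂ E) (H : E →L[ℂ] E) :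
    groundProj Sᗮ H * groundProj S H = 0 := by
  have h : groundSpace S H ⟂ groundSpace Sᗮ H := (Submodule.isOrtho_orthogonal_right S).mono
    inf_le_left inf_le_left
  exact h.symm.starProjection_comp_starProjection

theorem awayProj_mul_groundProj (S : Submodule ℂ E) (H : E →L[ℂ] E) :
    awayProj S H * groundProj S H = 0 := by
  rw [awayProj, sub_mul, sub_mul, one_mul, groundProj_mul_self,
    groundProj_orthogonal_mul_groundProj, sub_self, sub_zero]

theorem awayProj_mul_groundProj_orthogonal (S : Submodule ℂ E) (H : E →L[ℂ] E) :
    awayProj S H * groundProj Sᗮ H = 0 := by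
  rw [awayProj, sub_mul, sub_mul, one_mul, groundProj_mul_self,
    groundProj_mul_groundProj_orthogonal, sub_zero, sub_self]

theorem awayProj_mul_self (S : Submodule ℂ E) (H : E →L[ℂ] E) :
    awayProj S H * awayProj S H = awayProj S H := by
  have e : awayProj S H * (1 - groundProj S H - groundProj Sᗮ H) = awayProj S H := by
    rw [mul_sub, mul_sub, mul_one, awayProj_mul_groundProj, awayProj_mul_groundProj_orthogonal,
      sub_zero, sub_zero]
  exact e

theorem perpPart_mul_groundProj (S : Submodule ℂ E) (H Δ : E →L[ℂ] E) :
    perpPart S H Δ * groundProj S H = 0 := by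
  rw [perpPart, mul_assoc, awayProj_mul_groundProj, mul_zero]

theorem isSymmetric_aligned {S : Submodule ℂ E} {H : E →L[ℂ] E}
    (hH : (H : E →ₗ[ℂ] E).IsSymmetric) : (aligned S H : E →ₗ[ℂ] E).IsSymmetric := by
  intro x y
  have h1 : inner ℂ (H x) y = inner ℂ x (H y) := hH x y
  have h2 : inner ℂ (Sᗮ.starProjection x) y = inner ℂ x (Sᗮ.starProjection y) :=
    Sᗮ.starProjection_isSymmetric x y
  change inner ℂ (H x + ((groundEnergy S H - groundEnergy Sᗮ H : ℝ) : ℂ) • Sᗮ.starProjection x) y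
    = inner ℂ x (H y + ((groundEnergy S H - groundEnergy Sᗮ H : ℝ) : ℂ) • Sᗮ.starProjection y)
  rw [inner_add_left, inner_add_right, inner_smul_left, inner_smul_right, h1, h2,
    Complex.conj_ofReal]

theorem isSymmetric_perpPart {S : Submodule ℂ E} {H Δ : E →L[ℂ] E}
    (hΔ : (Δ : E →ₗ[ℂ] E).IsSymmetric) : (perpPart S H Δ : E →ₗ[ℂ] E).IsSymmetric :=
  isSymmetric_mul_mul (isSymmetric_awayProj S H) hΔ

theorem isSymmetric_add {A B : E →L[ℂ] E} (hA : (A : E →ₗ[ℂ] E).IsSymmetric)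
    (hB : (B : E →ₗ[ℂ] E).IsSymmetric) : ((A + B : E →L[ℂ] E) : E →ₗ[ℂ] E).IsSymmetric := by
  intro x y
  have h1 : inner ℂ (A x) y = inner ℂ x (A y) := hA x y
  have h2 : inner ℂ (B x) y = inner ℂ x (B y) := hB x y
  change inner ℂ (A x + B x) y = inner ℂ x (A y + B y)
  rw [inner_add_left, inner_add_right, h1, h2]

/-- The auxiliary evolution follows the adiabatic one. -/
theorem norm_auxiliary_sub_adiabatic_le {S : Submodule ℂ E} {T : ℝ} (hT : 0 < T)
    {H Δ : ℝ → E →L[ℂ] E}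
    (hHsymm : ∀ s ∈ Icc (0 : ℝ) 1, (H s : E →ₗ[ℂ] E).IsSymmetric)
    (hΔsymm : ∀ s ∈ Icc (0 : ℝ) 1, (Δ s : E →ₗ[ℂ] E).IsSymmetric)
    (hHdiag : ∀ s ∈ Icc (0 : ℝ) 1, H s * S.starProjection = S.starProjection * H s)
    (hHdiff : DifferentiableOn ℝ H (Icc 0 1))
    (hHdiff2 : DifferentiableOn ℝ (dot H) (Icc 0 1))
    (hΔdiff : DifferentiableOn ℝ Δ (Icc 0 1))
    (hgroundS : ∀ s ∈ Icc (0 : ℝ) 1, Module.finrank ℂ (groundSpace S (H s)) = 1)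
    (hgroundS' : ∀ s ∈ Icc (0 : ℝ) 1, Module.finrank ℂ (groundSpace Sᗮ (H s)) = 1)
    (hgap : ∀ s ∈ Icc (0 : ℝ) 1, 0 < gap S (H s))
    (hgap' : ∀ s ∈ Icc (0 : ℝ) 1, 0 < gap Sᗮ (H s))
    (hη : ∀ s ∈ Icc (0 : ℝ) 1, 0 < eta S (H s) (Δ s))
    {W V : ℝ → E →L[ℂ] E} (hW : IsEvolution (perpGenerator T S H Δ) W)
    (hV : IsEvolution (adiabaticGenerator T S H) V) {M₂ M₃ : ℝ}
    (hM₂ : ∀ s ∈ Icc (0 : ℝ) 1,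
      1 / (eta S (H s) (Δ s) * T) * adiabaticBoundary S H s ≤ M₂)
    (hM₃ : ∀ s ∈ Icc (0 : ℝ) 1, 1 / (eta S (H s) (Δ s) * T) * adiabaticBulk S H Δ s ≤ M₃)
    {x : E} (hx : groundProj S (H 0) x = x) :
    ‖W 1 x - V 1 x‖ ≤ (M₂ + M₃) * ‖x‖ := by
  choose! R hR using fun s hs => exists_groundData (hHsymm s hs) (hHdiag s hs) (hgroundS s hs)
    (hgap s hs)
  choose! R₂ hR₂ using fun s hs => exists_groundData (hHsymm s hs)
    (commute_orthogonal (hHdiag s hs)) (hgroundS' s hs) (hgap' s hs)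
  set A : ℝ → E →L[ℂ] E := fun t => block S (H t) with hAdef
  set A₂ : ℝ → E →L[ℂ] E := fun t => block Sᗮ (H t) with hA₂def
  set P : ℝ → E →L[ℂ] E := fun t => groundProj S (H t) with hPdef
  set P₂ : ℝ → E →L[ℂ] E := fun t => groundProj Sᗮ (H t) with hP₂def
  set D : ℝ → E →L[ℂ] E := fun t => perpPart S (H t) (Δ t) with hDdef
  set μ : ℝ → ℝ := fun t => groundEnergy S (H t) with hμdef
  set μ₂ : ℝ → ℝ := fun t => groundEnergy Sᗮ (H t) with hμ₂def
  set γ : ℝ → ℝ := fun t => gap S (H t) with hγdef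
  set γ₂ : ℝ → ℝ := fun t => gap Sᗮ (H t) with hγ₂def
  have h : ∀ t ∈ Icc (0 : ℝ) 1,
      GroundData S.starProjection (A t) (P t) (R t) (μ t) (γ t) := hR
  have h₂ : ∀ t ∈ Icc (0 : ℝ) 1,
      GroundData Sᗮ.starProjection (A₂ t) (P₂ t) (R₂ t) (μ₂ t) (γ₂ t) := hR₂
  have hA : ∀ s ∈ Icc (0 : ℝ) 1, HasDerivWithinAt A (dot A s) (Icc 0 1) s := fun s hs =>
    hasDerivWithinAt_dot_block S hHdiff hs
  have hB : ∀ s ∈ Icc (0 : ℝ) 1, HasDerivWithinAt (dot A) (dot (dot A) s) (Icc 0 1) s :=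
    fun s hs => hasDerivWithinAt_dot_dot_block S hHdiff hHdiff2 hs
  have hA₂ : ∀ s ∈ Icc (0 : ℝ) 1, HasDerivWithinAt A₂ (dot A₂ s) (Icc 0 1) s := fun s hs =>
    hasDerivWithinAt_dot_block Sᗮ hHdiff hs
  have hP : ∀ s ∈ Icc (0 : ℝ) 1, HasDerivWithinAt P
      (-(P s * dot A s * R s + R s * dot A s * P s)) (Icc 0 1) s := fun s hs =>
    GroundData.hasDerivWithinAt_P hs h (hA s hs)
  have hP₂ : ∀ s ∈ Icc (0 : ℝ) 1, HasDerivWithinAt P₂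
      (-(P₂ s * dot A₂ s * R₂ s + R₂ s * dot A₂ s * P₂ s)) (Icc 0 1) s := fun s hs =>
    GroundData.hasDerivWithinAt_P hs h₂ (hA₂ s hs)
  have hD : ∀ s ∈ Icc (0 : ℝ) 1, HasDerivWithinAt D (dot D s) (Icc 0 1) s := by
    intro s hs
    have hM := ((hP s hs).const_sub 1).sub (hP₂ s hs)
    exact ((hM.mul (hΔdiff s hs).hasDerivWithinAt).mul hM).differentiableWithinAt.hasDerivWithinAt
  have hQ : ∀ s ∈ Icc (0 : ℝ) 1,
      dot P s = -(P s * dot A s * R s + R s * dot A s * P s) := fun s hs =>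
    HasDerivWithinAt.dot_eq hs (hP s hs)
  have hBsymm : ∀ s ∈ Icc (0 : ℝ) 1, ((dot A s : E →L[ℂ] E) : E →ₗ[ℂ] E).IsSymmetric := fun s hs =>
    isSymmetric_of_hasDerivWithinAt (uniqueDiffWithinAt_unit hs) hs
      (fun t ht => (h t ht).symmA) (hA s hs)
  have hQsymm : ∀ s ∈ Icc (0 : ℝ) 1, ((dot P s : E →L[ℂ] E) : E →ₗ[ℂ] E).IsSymmetric := fun s hs =>
    isSymmetric_of_hasDerivWithinAt (uniqueDiffWithinAt_unit hs) hs
      (fun t ht => (h t ht).symmP) (hP s hs).differentiableWithinAt.hasDerivWithinAt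
  have hQP : ∀ s ∈ Icc (0 : ℝ) 1, dot P s * P s = -(R s * dot A s * P s) := fun s hs => by
    rw [hQ s hs, (h s hs).deriv_P_mul_P]
  have hPQ : ∀ s ∈ Icc (0 : ℝ) 1, P s * dot P s = -(P s * dot A s * R s) := fun s hs => by
    rw [hQ s hs, (h s hs).P_mul_deriv_P]
  have hQQ : ∀ s ∈ Icc (0 : ℝ) 1, dot P s = dot P s * P s + P s * dot P s := fun s hs => by
    rw [hQP s hs, hPQ s hs, hQ s hs]; abel
  have hHA : ∀ s ∈ Icc (0 : ℝ) 1, H s = A s + A₂ s := fun s hs =>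
    (block_add_block (hHdiag s hs)).symm
  have hAP : ∀ s ∈ Icc (0 : ℝ) 1, A s * P s = (μ s : ℂ) • P s := fun s hs => by
    have := (h s hs).sA_P
    rw [shifted, sub_mul, smul_mul_assoc, one_mul] at this
    exact sub_eq_zero.1 this
  have hPA : ∀ s ∈ Icc (0 : ℝ) 1, P s * A s = (μ s : ℂ) • P s := fun s hs => by
    have := (h s hs).P_sA
    rw [shifted, mul_sub, mul_smul_comm, mul_one] at this
    exact sub_eq_zero.1 this
  have hA₂P : ∀ s ∈ Icc (0 : ℝ) 1, A₂ s * P s = 0 := fun s hs =>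
    mul_eq_zero_of_factor (h₂ s hs).A_N (h s hs).N_P (starProjection_orthogonal_mul S)
  have hPA₂ : ∀ s ∈ Icc (0 : ℝ) 1, P s * A₂ s = 0 := fun s hs =>
    mul_eq_zero_of_factor (h s hs).P_N (h₂ s hs).N_A (starProjection_mul_orthogonal S)
  have hHP : ∀ s ∈ Icc (0 : ℝ) 1, H s * P s = (μ s : ℂ) • P s := fun s hs => by
    rw [hHA s hs, add_mul, hA₂P s hs, add_zero, hAP s hs]
  have hPH : ∀ s ∈ Icc (0 : ℝ) 1, P s * H s = (μ s : ℂ) • P s := fun s hs => by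
    rw [hHA s hs, mul_add, hPA₂ s hs, add_zero, hPA s hs]
  have hPQP : ∀ s ∈ Icc (0 : ℝ) 1, P s * dot P s * P s = 0 := fun s hs =>
    mul_deriv_mul_eq_zero (h s hs).P_P (hQQ s hs)
  have hDM : ∀ s, (1 - P s - P₂ s) * D s = D s := fun s => by
    change awayProj S (H s) * (awayProj S (H s) * Δ s * awayProj S (H s)) = _
    rw [← mul_assoc, ← mul_assoc, awayProj_mul_self]
    rfl
  set C : ℝ → E →L[ℂ] E := fun s => coupled S (A s) (A₂ s) (D s) (μ s) (μ₂ s) with hCdef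
  have hCeq : ∀ s ∈ Icc (0 : ℝ) 1, aligned S (H s) + perpPart S (H s) (Δ s) = C s := by
    intro s hs
    rw [hCdef]; simp only
    rw [coupled, ← hHA s hs]
    rfl
  have hCsymm : ∀ s ∈ Icc (0 : ℝ) 1, (C s : E →ₗ[ℂ] E).IsSymmetric := fun s hs => by
    rw [← hCeq s hs]
    exact isSymmetric_add (isSymmetric_aligned (hHsymm s hs)) (isSymmetric_perpPart (hΔsymm s hs))
  have hCP : ∀ s ∈ Icc (0 : ℝ) 1, C s * P s = (μ s : ℂ) • P s := fun s hs => by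
    have h1 : Sᗮ.starProjection * P s = 0 := by
      rw [← (h s hs).N_P, ← mul_assoc, starProjection_orthogonal_mul, zero_mul]
    have h2 : D s * P s = 0 := perpPart_mul_groundProj S (H s) (Δ s)
    rw [hCdef]; simp only
    rw [coupled, ← hHA s hs, add_mul, add_mul, smul_mul_assoc, h1, h2, smul_zero, add_zero,
      add_zero, hHP s hs]
  have hWC : IsEvolution (fun s => (T : ℂ) • C s) W :=
    ⟨hW.1, fun s hs => by
      have := hW.2 s hs
      rw [perpGenerator, hCeq s hs] at this
      exact this⟩
  have hηD : ∀ s ∈ Icc (0 : ℝ) 1, 0 < 1 - ‖D s‖ / min (γ s) (γ₂ s) := hη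
  have hRDlt : ∀ s ∈ Icc (0 : ℝ) 1, ‖(R s + R₂ s) * D s‖ < 1 := fun s hs =>
    lt_of_le_of_lt (norm_R_mul_le (h s hs) (h₂ s hs)) (by linarith [hηD s hs])
  choose! Z' hZ' hZ'n using fun s (hs : s ∈ Icc (0 : ℝ) 1) =>
    exists_hasDerivWithinAt_couplingSolution hs h h₂ (hA s hs) (hB s hs) (hA₂ s hs) (hD s hs)
      (hηD s hs)
  obtain ⟨hVn, hVP⟩ := proj_apply_adiabatic_evolution hHsymm
    (fun s hs => (hP s hs).differentiableWithinAt.hasDerivWithinAt) (fun s hs => (h s hs).symmP)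
    hQsymm (fun s hs => (h s hs).P_P) hQQ hHP hPH hV x
  -- Half of T M₂ for each value of Z: the end points 0 and 1 both contribute.
  have hbd : ∀ s ∈ Icc (0 : ℝ) 1,
      ‖couplingSolution (R s) (R₂ s) (D s) (dot A s) (P s)‖ ≤ T * M₂ / 2 := by
    intro s hs
    have h1 := norm_couplingSolution_le (B := dot A s) (h s hs) (h₂ s hs) (hηD s hs)
    have h2 := hM₂ s hs
    have hη' := hη s hs
    rw [adiabaticBoundary, div_mul_eq_mul_div, div_le_iff₀ (by positivity)] at h2
    refine h1.trans ?_
    change 1 / eta S (H s) (Δ s) * (‖dot A s‖ / γ s ^ 2) ≤ T * M₂ / 2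
    rw [div_mul_eq_mul_div, div_le_iff₀ hη']
    change 1 * (2 * (‖dot A s‖ / γ s ^ 2)) ≤ M₂ * (eta S (H s) (Δ s) * T) at h2
    linarith
  have hblk : ∀ s ∈ Icc (0 : ℝ) 1, ‖Z' s * P s‖ ≤ T * M₃ := by
    intro s hs
    have h2 := hM₃ s hs
    have hη' := hη s hs
    have hγ := hgap s hs
    have hγ₂ := hgap' s hs
    have hm : 0 < min (γ s) (γ₂ s) := lt_min hγ hγ₂
    rw [div_mul_eq_mul_div, div_le_iff₀ (by positivity)] at h2
    refine (hZ'n s hs).trans ?_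
    rw [div_mul_eq_mul_div, div_le_iff₀ (hηD s hs)]
    refine le_trans ?_ (h2.trans (le_of_eq (show _ = T * M₃ * eta S (H s) (Δ s) by ring)))
    rw [one_mul, one_mul]
    have hsq := norm_sq_le_norm_sq_of_isSymmetric (hBsymm s hs)
    change _ ≤ ‖dot (dot A) s‖ / γ s ^ 2 + 10 * (‖dot A s ^ 2‖ / γ s ^ 3)
      + 1 / (1 - ‖D s‖ / min (γ s) (γ₂ s)) * (‖dot A s‖ / γ s ^ 2) *
      (‖dot D s‖ / min (γ s) (γ₂ s) + 4 * ‖D s‖ * max (‖dot A s‖ / γ s ^ 2)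
        ((2 * ‖dot A₂ s‖ + ‖dot A s‖) / γ₂ s ^ 2))
    have hη'' := hηD s hs
    -- R₂ is the reduced resolvent of the second block at its own ground energy, so the derivative
    -- of the shift μ - μbar does not enter. The estimate obtained here is therefore smaller than
    -- the required one.
    have : ‖dot A₂ s‖ ≤ 2 * ‖dot A₂ s‖ + ‖dot A s‖ := by
      linarith [norm_nonneg (dot A₂ s), norm_nonneg (dot A s)]
    gcongr
  have key := norm_sub_adiabatic_evolution_le hT hCsymm hWC hV hVn (hVP hx) hPQP
    (Z := fun t => couplingSolution (R t) (R₂ t) (D t) (dot A t) (P t)) (Z' := Z') (μ := μ)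
    (fun s hs => by
      rw [adiabaticGenerator, add_mul, smul_mul_assoc, smul_mul_assoc, hHP s hs, smul_smul, sub_mul,
        mul_assoc (dot P s), (h s hs).P_P, hPQP s hs, sub_zero]
      push_cast; rfl)
    hCP hZ' (fun s hs => couplingSolution_mul_P (h s hs))
    (fun s hs => by
      rw [hQP s hs, neg_neg]
      exact coupled_mul_couplingSolution (h s hs) (h₂ s hs) (hDM s) (hRDlt s hs))
    (hbd 0 (by simp)) (hbd 1 (by simp)) hblk
  refine key.trans (le_of_eq ?_)
  field_simp
  ring

/-! ### Low-energy spectral projections -/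

/-- The range of `lowProj A b`. -/
def lowSpace (A : E →L[ℂ] E) (b : ℝ) : Submodule ℂ E :=
  ⨆ x : Set.Iic b, eigenSubspace A (x : ℝ)

theorem mem_eigenSubspace {A : E →L[ℂ] E} {e : ℝ} {x : E} :
    x ∈ eigenSubspace A e ↔ A x = (e : ℂ) • x := by
  rw [eigenSubspace, Module.End.mem_eigenspace_iff]; rfl

theorem eigenSubspace_le_lowSpace {A : E →L[ℂ] E} {b e : ℝ} (h : e ≤ b) :
    eigenSubspace A e ≤ lowSpace A b :=
  le_iSup (fun x : Set.Iic b => eigenSubspace A (x : ℝ)) ⟨e, h⟩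

theorem lowSpace_invariant (A : E →L[ℂ] E) (b : ℝ) : ∀ x ∈ lowSpace A b, A x ∈ lowSpace A b := by
  have h : lowSpace A b ≤ (lowSpace A b).comap (A : E →ₗ[ℂ] E) := by
    refine iSup_le fun e x hx => ?_
    have : A x ∈ eigenSubspace A (e : ℝ) := by
      rw [mem_eigenSubspace.1 hx]; exact Submodule.smul_mem _ _ hx
    exact eigenSubspace_le_lowSpace e.2 this
  exact h

theorem orthogonal_invariant {A : E →L[ℂ] E} (hA : (A : E →ₗ[ℂ] E).IsSymmetric)
    {L : Submodule ℂ E} (hL : ∀ x ∈ L, A x ∈ L) : ∀ x ∈ Lᗮ, A x ∈ Lᗮ := by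
  intro x hx v hv
  have : inner ℂ (A v) x = inner ℂ v (A x) := hA v x
  rw [← this]
  exact hx _ (hL v hv)

theorem mem_lowSpace_orthogonal_of_lt {A : E →L[ℂ] E} (hA : (A : E →ₗ[ℂ] E).IsSymmetric)
    {b e : ℝ} (h : b < e) {v : E} (hv : A v = (e : ℂ) • v) : v ∈ (lowSpace A b)ᗮ := by
  rw [lowSpace, ← Submodule.iInf_orthogonal, Submodule.mem_iInf]
  intro x w hw
  rw [mem_eigenSubspace] at hw
  have h1 : inner ℂ (A w) v = inner ℂ w (A v) := hA w v
  rw [hw, hv, inner_smul_left, inner_smul_right, Complex.conj_ofReal] at h1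
  have h2 : ((x : ℝ) : ℂ) - (e : ℂ) ≠ 0 := by
    rw [← Complex.ofReal_sub]
    exact_mod_cast (sub_neg.2 (lt_of_le_of_lt x.2 h)).ne
  have h3 : (((x : ℝ) : ℂ) - (e : ℂ)) * inner ℂ w v = 0 := by rw [sub_mul, h1, sub_self]
  exact (mul_eq_zero.1 h3).resolve_left h2

/-- The Rayleigh bound for -A: an eigenvector in the low space with energy above b would be
orthogonal to that space, hence to itself. -/
theorem re_inner_le_of_mem_lowSpace {A : E →L[ℂ] E} (hA : (A : E →ₗ[ℂ] E).IsSymmetric) {b : ℝ}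
    {x : E} (hx : x ∈ lowSpace A b) : (inner ℂ x (A x)).re ≤ b * ‖x‖ ^ 2 := by
  have hA' : ((-A : E →L[ℂ] E) : E →ₗ[ℂ] E).IsSymmetric := by
    intro x y
    have h : inner ℂ (A x) y = inner ℂ x (A y) := hA x y
    change inner ℂ (-A x) y = inner ℂ x (-A y)
    rw [inner_neg_left, inner_neg_right, h]
  have h := mul_norm_sq_le_of_le_spectrumOn (K := lowSpace A b) (g := -b) hA'
    (fun y hy => Submodule.neg_mem _ (lowSpace_invariant A b y hy)) ?_ hx
  · rw [neg_apply, inner_neg_right, Complex.neg_re] at h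
    linarith
  · rintro e ⟨v, hv, hv0, he⟩
    by_contra! hlt
    refine hv0 (inner_self_eq_zero.1 (mem_lowSpace_orthogonal_of_lt hA (b := b) (e := -e)
      (by linarith) ?_ v hv) : v = 0)
    rw [neg_apply] at he
    rw [Complex.ofReal_neg, neg_smul, ← he, neg_neg]

theorem mul_norm_sq_le_of_mem_lowSpace_orthogonal {A : E →L[ℂ] E}
    (hA : (A : E →ₗ[ℂ] E).IsSymmetric) {b g : ℝ}
    (hg : ∀ e ∈ spectrumOn ⊤ A, b < e → g ≤ e) {x : E} (hx : x ∈ (lowSpace A b)ᗮ) :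
    g * ‖x‖ ^ 2 ≤ (inner ℂ x (A x)).re := by
  refine mul_norm_sq_le_of_le_spectrumOn hA
    (orthogonal_invariant hA (lowSpace_invariant A b)) ?_ hx
  rintro e ⟨v, hv, hv0, he⟩
  refine hg e ⟨v, trivial, hv0, he⟩ ?_
  by_contra! hle
  exact hv0 (inner_self_eq_zero.1
    (hv v (eigenSubspace_le_lowSpace hle (mem_eigenSubspace.2 he))))

theorem finite_spectrumOn (K : Submodule ℂ E) (A : E →L[ℂ] E) : (spectrumOn K A).Finite := by
  have h := (Module.End.finite_hasEigenvalue (A : E →ₗ[ℂ] E)).preimage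
    (Complex.ofReal_injective.injOn (s := univ) |>.mono (subset_univ _))
  refine h.subset ?_
  rintro e ⟨v, -, hv0, he⟩
  exact Module.End.hasEigenvalue_of_hasEigenvector
    (Module.End.hasEigenvector_iff.2 ⟨Module.End.mem_eigenspace_iff.2 he, hv0⟩)

/-- The spectrum is finite, so the levels above b stay a positive distance away from b. The
dimension counts rely on this strict inequality. -/
theorem lt_re_inner_of_mem_lowSpace_orthogonal {A : E →L[ℂ] E}
    (hA : (A : E →ₗ[ℂ] E).IsSymmetric) {b : ℝ} {x : E} (hx : x ∈ (lowSpace A b)ᗮ) (hx0 : x ≠ 0) :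
    b * ‖x‖ ^ 2 < (inner ℂ x (A x)).re := by
  have hp : 0 < ‖x‖ ^ 2 := by positivity
  obtain ⟨g, hbg, hg⟩ : ∃ g, b < g ∧ ∀ e ∈ spectrumOn ⊤ A, b < e → g ≤ e := by
    have hfin := (finite_spectrumOn ⊤ A).inter_of_left (Ioi b)
    rcases (spectrumOn ⊤ A ∩ Ioi b).eq_empty_or_nonempty with h0 | h0
    · refine ⟨b + 1, by linarith, fun e he hb => ?_⟩
      have : e ∈ spectrumOn ⊤ A ∩ Ioi b := ⟨he, hb⟩
      rw [h0] at this
      exact this.elim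
    · obtain ⟨g, hg, hmin⟩ := exists_min_image _ id hfin h0
      exact ⟨g, hg.2, fun e he hb => hmin e ⟨he, hb⟩⟩
  have := mul_norm_sq_le_of_mem_lowSpace_orthogonal hA hg hx
  nlinarith

/-- The linear map `(α, β) ↦ α u + β v`. -/
def combination (u v : E) : ℂ × ℂ →ₗ[ℂ] E :=
  (LinearMap.toSpanSingleton ℂ E u).coprod (LinearMap.toSpanSingleton ℂ E v)

theorem combination_apply (u v : E) (p : ℂ × ℂ) : combination u v p = p.1 • u + p.2 • v := rfl

/-- The linear map `x ↦ (⟪u, x⟫, ⟪v, x⟫)`. -/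
def coefficients (u v : E) : E →ₗ[ℂ] ℂ × ℂ :=
  LinearMap.prod (innerSL ℂ u : E →L[ℂ] ℂ).toLinearMap (innerSL ℂ v : E →L[ℂ] ℂ).toLinearMap

theorem coefficients_eq_zero {u v x : E} :
    coefficients u v x = 0 ↔ inner ℂ u x = 0 ∧ inner ℂ v x = 0 := Prod.ext_iff

section TwoLevels

variable {A : E →L[ℂ] E} {φ₁ φ₂ ψ₁ ψ₂ : E} {b g : ℝ}

/-- Three dimensions would contain a nonzero vector orthogonal to φ₁ and φ₂, whose energy is at
least g > b. -/
theorem finrank_lowSpace_le_two (hA : (A : E →ₗ[ℂ] E).IsSymmetric)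
    (hg : ∀ x, inner ℂ φ₁ x = 0 → inner ℂ φ₂ x = 0 → g * ‖x‖ ^ 2 ≤ (inner ℂ x (A x)).re)
    (hbg : b < g) : Module.finrank ℂ (lowSpace A b) ≤ 2 := by
  by_contra! hlt
  have hker : LinearMap.ker ((coefficients φ₁ φ₂).domRestrict (lowSpace A b)) ≠ ⊥ :=
    LinearMap.ker_ne_bot_of_finrank_lt (by simpa using hlt)
  obtain ⟨x, hx, hx0⟩ := (Submodule.ne_bot_iff _).1 hker
  have hx' : coefficients φ₁ φ₂ (x : E) = 0 := LinearMap.mem_ker.1 hx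
  obtain ⟨h1, h2⟩ := coefficients_eq_zero.1 hx'
  have h3 := hg _ h1 h2
  have h4 := re_inner_le_of_mem_lowSpace hA x.2
  have hp : 0 < ‖(x : E)‖ ^ 2 := by
    have : (x : E) ≠ 0 := fun h => hx0 (Subtype.ext h)
    positivity
  nlinarith

/-- Otherwise projecting the plane of ψ₁, ψ₂ onto the low space has a kernel, and a kernel vector
has energy strictly above b. -/
theorem two_le_finrank_lowSpace (hA : (A : E →ₗ[ℂ] E).IsSymmetric)
    (hψ : ∀ p, combination ψ₁ ψ₂ p = 0 → p = 0)
    (hb : ∀ p, (inner ℂ (combination ψ₁ ψ₂ p) (A (combination ψ₁ ψ₂ p))).re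
      ≤ b * ‖combination ψ₁ ψ₂ p‖ ^ 2) : 2 ≤ Module.finrank ℂ (lowSpace A b) := by
  by_contra! hlt
  set f : ℂ × ℂ →ₗ[ℂ] lowSpace A b :=
    ((lowSpace A b).orthogonalProjectionOnto : E →ₗ[ℂ] lowSpace A b) ∘ₗ combination ψ₁ ψ₂
  have hker : LinearMap.ker f ≠ ⊥ := LinearMap.ker_ne_bot_of_finrank_lt (by simpa using hlt)
  obtain ⟨p, hp, hp0⟩ := (Submodule.ne_bot_iff _).1 hker
  have h1 : combination ψ₁ ψ₂ p ∈ (lowSpace A b)ᗮ :=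
    Submodule.orthogonalProjectionOnto_eq_zero_iff.1 (LinearMap.mem_ker.1 hp)
  exact absurd (hb p) (not_le.2
    (lt_re_inner_of_mem_lowSpace_orthogonal hA h1 fun h => hp0 (hψ p h)))

theorem mul_norm_sq_le_of_two_levels (hA : (A : E →ₗ[ℂ] E).IsSymmetric)
    (hg : ∀ x, inner ℂ φ₁ x = 0 → inner ℂ φ₂ x = 0 → g * ‖x‖ ^ 2 ≤ (inner ℂ x (A x)).re)
    (hbg : b < g) (hL : 2 ≤ Module.finrank ℂ (lowSpace A b)) {x : E}
    (hx : x ∈ (lowSpace A b)ᗮ) : g * ‖x‖ ^ 2 ≤ (inner ℂ x (A x)).re := by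
  refine mul_norm_sq_le_of_mem_lowSpace_orthogonal hA ?_ hx
  rintro e ⟨v, -, hv0, he⟩ hbe
  by_contra! hlt
  have hv := mem_lowSpace_orthogonal_of_lt hA hbe he
  -- Together with an eigenvector v of energy between b and g, the low space spans at least three
  -- dimensions. Some combination is orthogonal to φ₁ and φ₂, although every nonzero combination has
  -- energy below g.
  set f : lowSpace A b × ℂ →ₗ[ℂ] ℂ × ℂ :=
    coefficients φ₁ φ₂ ∘ₗ (lowSpace A b).subtype.coprod (LinearMap.toSpanSingleton ℂ E v)
  have hker : LinearMap.ker f ≠ ⊥ := LinearMap.ker_ne_bot_of_finrank_lt (by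
    rw [Module.finrank_prod, Module.finrank_prod, Module.finrank_self]; omega)
  obtain ⟨⟨y, α⟩, hp, hp0⟩ := (Submodule.ne_bot_iff _).1 hker
  have hp' : coefficients φ₁ φ₂ ((y : E) + α • v) = 0 := LinearMap.mem_ker.1 hp
  obtain ⟨h1, h2⟩ := coefficients_eq_zero.1 hp'
  have h3 := hg _ h1 h2
  have hyv : inner ℂ (y : E) v = 0 := hv _ y.2
  have hvy : inner ℂ v (y : E) = 0 := by rw [← inner_conj_symm, hyv, map_zero]
  have hvAy : inner ℂ v (A y) = 0 := by
    rw [← inner_conj_symm, hv _ (lowSpace_invariant A b _ y.2), map_zero]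
  have e1 : ‖(y : E) + α • v‖ ^ 2 = ‖(y : E)‖ ^ 2 + ‖α‖ ^ 2 * ‖v‖ ^ 2 := by
    rw [sq, norm_add_sq_eq_norm_sq_add_norm_sq_of_inner_eq_zero (𝕜 := ℂ), norm_smul]
    · ring
    · rw [inner_smul_right, hyv, mul_zero]
  have e2 : (inner ℂ ((y : E) + α • v) (A ((y : E) + α • v))).re
      = (inner ℂ (y : E) (A y)).re + e * (‖α‖ ^ 2 * ‖v‖ ^ 2) := by
    rw [map_add, map_smul, he, inner_add_left, inner_add_right, inner_add_right, inner_smul_left,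
      inner_smul_left, hvAy, smul_comm α, inner_smul_right, inner_smul_right, hyv, inner_smul_right,
      inner_smul_right, ← mul_pow, ← norm_smul, ← re_inner_self, inner_smul_left, inner_smul_right]
    simp only [mul_zero, add_zero, zero_add, Complex.add_re]
    rw [mul_left_comm, Complex.re_ofReal_mul]
  have h4 := re_inner_le_of_mem_lowSpace hA y.2
  rw [e1, e2] at h3
  have hy2 : 0 ≤ ‖(y : E)‖ ^ 2 := sq_nonneg _
  have hv2 : 0 < ‖v‖ ^ 2 := by positivity
  have hα2 : 0 ≤ ‖α‖ ^ 2 * ‖v‖ ^ 2 := by positivity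
  have hy0 : ‖(y : E)‖ ^ 2 = 0 := by nlinarith
  have hα0 : ‖α‖ ^ 2 * ‖v‖ ^ 2 = 0 := by nlinarith
  have k1 : y = 0 := Subtype.ext (norm_eq_zero.1 (pow_eq_zero_iff two_ne_zero |>.1 hy0))
  have k2 : α = 0 := by
    rcases mul_eq_zero.1 hα0 with h | h
    · exact norm_eq_zero.1 (pow_eq_zero_iff two_ne_zero |>.1 h)
    · exact absurd h hv2.ne'
  exact hp0 (by rw [k1, k2]; rfl)

theorem norm_sq_eq_low_add (L : Submodule ℂ E) (x : E) :
    ‖x‖ ^ 2 = ‖L.starProjection x‖ ^ 2 + ‖(1 - L.starProjection) x‖ ^ 2 := by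
  rw [norm_sq_eq_add_blocks L x, Submodule.starProjection_orthogonal']

/-- Vectors of low energy are close to the low-energy space. -/
theorem norm_sub_lowProj_sq_le (hA : (A : E →ₗ[ℂ] E).IsSymmetric) {e₀ : ℝ}
    (h0 : ∀ x, e₀ * ‖x‖ ^ 2 ≤ (inner ℂ x (A x)).re)
    (hg : ∀ x ∈ (lowSpace A b)ᗮ, g * ‖x‖ ^ 2 ≤ (inner ℂ x (A x)).re) {y : E}
    (hy : (inner ℂ y (A y)).re ≤ b * ‖y‖ ^ 2) :
    (g - e₀) * ‖(1 - lowProj A b) y‖ ^ 2 ≤ (b - e₀) * ‖y‖ ^ 2 := by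
  set L := lowSpace A b
  change (g - e₀) * ‖(1 - L.starProjection) y‖ ^ 2 ≤ _
  set u := L.starProjection y with hu
  set v := (1 - L.starProjection) y with hv
  have hyuv : y = u + v := by rw [hu, hv, sub_apply, one_apply_eq_self]; abel
  have hvL : v ∈ Lᗮ := L.sub_starProjection_mem_orthogonal y
  have huL : u ∈ L := L.starProjection_apply_mem y
  have h1 := hg v hvL
  have h2 := h0 u
  -- The form splits without cross terms because the low space and its complement are invariant.
  -- Bounding the low part only by e₀ leaves the excess b - e₀ to pay for the high part.
  have h3 : (inner ℂ y (A y)).re = (inner ℂ u (A u)).re + (inner ℂ v (A v)).re := by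
    have k1 : inner ℂ u (A v) = 0 :=
      orthogonal_invariant hA (lowSpace_invariant A b) v hvL u huL
    have k2 : inner ℂ v (A u) = 0 := by
      rw [← inner_conj_symm, hvL _ (lowSpace_invariant A b u huL), map_zero]
    rw [hyuv, map_add, inner_add_left, inner_add_right, inner_add_right, k1, k2, add_zero, zero_add,
      Complex.add_re]
  have h4 := norm_sq_eq_low_add L y
  rw [← hu, ← hv] at h4
  have h5 : e₀ * ‖u‖ ^ 2 = e₀ * ‖y‖ ^ 2 - e₀ * ‖v‖ ^ 2 := by rw [h4]; ring
  linarith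

/-- If two unit vectors span a plane that is close to a plane `L`, then `L` is close to their
plane. -/
theorem norm_sub_coefficients_le {L : Submodule ℂ E} (hL : Module.finrank ℂ L = 2)
    (hφ₁ : ‖φ₁‖ = 1) (hφ₂ : ‖φ₂‖ = 1) (hφ : inner ℂ φ₁ φ₂ = 0) {q : ℝ} (hq1 : q < 1)
    (hq : ∀ p, ‖(1 - L.starProjection) (combination φ₁ φ₂ p)‖ ^ 2
      ≤ q * ‖combination φ₁ φ₂ p‖ ^ 2) {x : E} (hx : x ∈ L) :
    ‖x - (inner ℂ φ₁ x • φ₁ + inner ℂ φ₂ x • φ₂)‖ ^ 2 ≤ q * ‖x‖ ^ 2 := by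
  have hφ' : inner ℂ φ₂ φ₁ = 0 := by rw [← inner_conj_symm, hφ, map_zero]
  -- Projection onto L is injective on the plane of φ₁, φ₂ since q < 1. Both dimensions are 2, so
  -- every x in L is the projection of some y in the plane.
  set f : ℂ × ℂ →ₗ[ℂ] L := (L.orthogonalProjectionOnto : E →ₗ[ℂ] L) ∘ₗ combination φ₁ φ₂ with hf
  have hlow : ∀ p, (1 - q) * ‖combination φ₁ φ₂ p‖ ^ 2
      ≤ ‖L.starProjection (combination φ₁ φ₂ p)‖ ^ 2 := by
    intro p
    have h1 := norm_sq_eq_low_add L (combination φ₁ φ₂ p)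
    linarith [hq p]
  have hnorm : ∀ p, ‖combination φ₁ φ₂ p‖ ^ 2 = ‖p.1‖ ^ 2 + ‖p.2‖ ^ 2 := by
    intro p
    rw [combination_apply, sq, norm_add_sq_eq_norm_sq_add_norm_sq_of_inner_eq_zero (𝕜 := ℂ),
      norm_smul, norm_smul, hφ₁, hφ₂]
    · ring
    · rw [inner_smul_left, inner_smul_right, hφ]; simp
  have hinj : Function.Injective f := by
    refine (injective_iff_map_eq_zero f).2 fun p hp => ?_
    have h1 : L.starProjection (combination φ₁ φ₂ p) = 0 := congrArg Subtype.val hp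
    have h2 := hlow p
    rw [h1, norm_zero, hnorm] at h2
    have h3 : ‖p.1‖ ^ 2 = 0 := by nlinarith [sq_nonneg ‖p.1‖, sq_nonneg ‖p.2‖]
    have h4 : ‖p.2‖ ^ 2 = 0 := by nlinarith [sq_nonneg ‖p.1‖, sq_nonneg ‖p.2‖]
    exact Prod.ext (norm_eq_zero.1 (pow_eq_zero_iff two_ne_zero |>.1 h3))
      (norm_eq_zero.1 (pow_eq_zero_iff two_ne_zero |>.1 h4))
  have hsurj : Function.Surjective f :=
    (LinearMap.injective_iff_surjective_of_finrank_eq_finrank (by simp [hL])).1 hinj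
  obtain ⟨p, hp⟩ := hsurj ⟨x, hx⟩
  set y := combination φ₁ φ₂ p with hy
  have hxy : L.starProjection y = x := congrArg Subtype.val hp
  set z := inner ℂ φ₁ x • φ₁ + inner ℂ φ₂ x • φ₂ with hz
  have hyz : inner ℂ y x = inner ℂ y z := by
    rw [hy, hz, combination_apply]
    simp only [inner_add_left, inner_add_right, inner_smul_left, inner_smul_right, hφ, hφ',
      inner_self_eq_norm_sq_to_K, hφ₁, hφ₂]
    simp [mul_comm]
  have hyx : (inner ℂ y x).re = ‖x‖ ^ 2 := by
    have h1 : inner ℂ (L.starProjection y) x = inner ℂ y x := by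
      have : inner ℂ (L.starProjection y) x = inner ℂ y (L.starProjection x) :=
        L.starProjection_isSymmetric y x
      rw [this, Submodule.starProjection_eq_self_iff.2 hx]
    rw [← h1, hxy, re_inner_self]
  have hort : inner ℂ z (x - z) = 0 := by
    have a₁ : inner ℂ φ₁ (x - z) = 0 := by
      rw [hz, inner_sub_right, inner_add_right, inner_smul_right, inner_smul_right, hφ,
        inner_self_eq_norm_sq_to_K, hφ₁]
      simp
    have a₂ : inner ℂ φ₂ (x - z) = 0 := by
      rw [hz, inner_sub_right, inner_add_right, inner_smul_right, inner_smul_right, hφ',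
        inner_self_eq_norm_sq_to_K, hφ₂]
      simp
    have e : inner ℂ z (x - z)
        = inner ℂ (inner ℂ φ₁ x • φ₁ + inner ℂ φ₂ x • φ₂) (x - z) := rfl
    rw [e, inner_add_left, inner_smul_left, inner_smul_left, a₁, a₂, mul_zero, mul_zero, add_zero]
  have hpyth : ‖x‖ ^ 2 = ‖z‖ ^ 2 + ‖x - z‖ ^ 2 := by
    have := norm_add_sq_eq_norm_sq_add_norm_sq_of_inner_eq_zero (𝕜 := ℂ) z (x - z) hort
    rw [add_sub_cancel] at this
    linarith
  -- Here x is the projection of y onto L, and z is the projection of x onto the plane containing y,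
  -- so ‖x‖² = ⟨y, x⟩ = ⟨y, z⟩. With (1 - q)‖y‖² ≤ ‖x‖² this gives (1 - q)‖x‖² ≤ ‖z‖².
  have h1 : ‖x‖ ^ 2 ≤ ‖y‖ * ‖z‖ := by
    rw [← hyx, hyz]
    exact (Complex.re_le_norm _).trans (norm_inner_le_norm _ _)
  have h2 := hlow p
  rw [← hy, hxy] at h2
  rcases (sq_nonneg ‖x‖).eq_or_lt with h0 | h0
  · rw [hpyth] at h0
    rw [hpyth]
    have k1 : ‖x - z‖ ^ 2 = 0 := by nlinarith [sq_nonneg ‖z‖, sq_nonneg ‖x - z‖]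
    have k2 : ‖z‖ ^ 2 = 0 := by nlinarith [sq_nonneg ‖z‖, sq_nonneg ‖x - z‖]
    rw [k1, k2]; simp
  · have h3 : ‖x‖ ^ 2 * ‖x‖ ^ 2 ≤ ‖y‖ ^ 2 * ‖z‖ ^ 2 := by
      have := mul_self_le_mul_self h0.le h1
      nlinarith
    have h4 : (1 - q) * ‖x‖ ^ 2 ≤ ‖z‖ ^ 2 := by
      have h5 : (1 - q) * ‖x‖ ^ 2 * ‖x‖ ^ 2 ≤ ‖z‖ ^ 2 * ‖x‖ ^ 2 := by
        calc (1 - q) * ‖x‖ ^ 2 * ‖x‖ ^ 2 = (1 - q) * (‖x‖ ^ 2 * ‖x‖ ^ 2) := by ring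
          _ ≤ (1 - q) * (‖y‖ ^ 2 * ‖z‖ ^ 2) := by
              apply mul_le_mul_of_nonneg_left h3; linarith
          _ = (1 - q) * ‖y‖ ^ 2 * ‖z‖ ^ 2 := by ring
          _ ≤ ‖x‖ ^ 2 * ‖z‖ ^ 2 := by gcongr
          _ = ‖z‖ ^ 2 * ‖x‖ ^ 2 := by ring
      exact le_of_mul_le_mul_right h5 h0
    linarith

end TwoLevels

/-! ### A block-diagonal operator with an antidiagonal perturbation -/

/-- The hypotheses on `H`, `Δ` and the ground vector `ψ` of `H + Δ` at one parameter value. -/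
structure BlockPair (S : Submodule ℂ E) (H Δ : E →L[ℂ] E) (ψ : E) : Prop where
  symmH : (H : E →ₗ[ℂ] E).IsSymmetric
  symmΔ : (Δ : E →ₗ[ℂ] E).IsSymmetric
  diag : H * S.starProjection = S.starProjection * H
  anti : Δ * S.starProjection = Sᗮ.starProjection * Δ
  simple : Module.finrank ℂ (groundSpace ⊤ (H + Δ)) = 1
  simpleS : Module.finrank ℂ (groundSpace S H) = 1
  simpleS' : Module.finrank ℂ (groundSpace Sᗮ H) = 1
  ground : ψ ∈ groundSpace ⊤ (H + Δ)
  projS : S.starProjection ψ ≠ 0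
  projS' : Sᗮ.starProjection ψ ≠ 0
  separated : max (groundEnergy S H) (groundEnergy Sᗮ H) <
    min (excitedEnergy S H) (excitedEnergy Sᗮ H)
  small : relSize S H Δ ≤ 1 - cheegerRatio S Δ ψ / minGap S H

namespace BlockPair

variable {S : Submodule ℂ E} {H Δ : E →L[ℂ] E} {ψ : E}

theorem gap_pos (X : BlockPair S H Δ ψ) : 0 < gap S H := by
  rw [gap, sub_pos]
  exact (le_max_left _ _).trans_lt (X.separated.trans_le (min_le_left _ _))

theorem gap_pos' (X : BlockPair S H Δ ψ) : 0 < gap Sᗮ H := by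
  rw [gap, sub_pos]
  exact (le_max_right _ _).trans_lt (X.separated.trans_le (min_le_right _ _))

theorem minGap_pos (X : BlockPair S H Δ ψ) : 0 < minGap S H := lt_min X.gap_pos X.gap_pos'

theorem symm_add (X : BlockPair S H Δ ψ) : ((H + Δ : E →L[ℂ] E) : E →ₗ[ℂ] E).IsSymmetric :=
  isSymmetric_add X.symmH X.symmΔ

theorem apply_mem_orthogonal (X : BlockPair S H Δ ψ) {x : E} (hx : x ∈ S) : Δ x ∈ Sᗮ := by
  have h : Δ (S.starProjection x) = Sᗮ.starProjection (Δ x) := DFunLike.congr_fun X.anti x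
  rw [Submodule.starProjection_eq_self_iff.2 hx] at h
  exact Submodule.starProjection_eq_self_iff.1 h.symm

theorem apply_mem (X : BlockPair S H Δ ψ) {x : E} (hx : x ∈ Sᗮ) : Δ x ∈ S := by
  have h : Δ (S.starProjection x) = Sᗮ.starProjection (Δ x) := DFunLike.congr_fun X.anti x
  rw [(Submodule.starProjection_apply_eq_zero_iff _).2 hx, map_zero, eq_comm,
    Submodule.starProjection_apply_eq_zero_iff, Submodule.orthogonal_orthogonal] at h
  exact h

theorem inner_apply_self (X : BlockPair S H Δ ψ) {x y : E} (hx : x ∈ S) (hy : y ∈ S) :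
    inner ℂ x (Δ y) = 0 := X.apply_mem_orthogonal hy x hx

theorem inner_apply_self' (X : BlockPair S H Δ ψ) {x y : E} (hx : x ∈ Sᗮ) (hy : y ∈ Sᗮ) :
    inner ℂ x (Δ y) = 0 := by
  rw [← inner_conj_symm, hx _ (X.apply_mem hy), map_zero]

theorem energy_mul_le (X : BlockPair S H Δ ψ) (x : E) :
    groundEnergy ⊤ (H + Δ) * ‖x‖ ^ 2 ≤ (inner ℂ x ((H + Δ) x)).re :=
  groundEnergy_mul_le (K := ⊤) X.symm_add (fun _ _ => trivial) trivial

theorem re_inner_add_of_mem (X : BlockPair S H Δ ψ) {x : E} (hx : x ∈ S) :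
    inner ℂ x ((H + Δ) x) = inner ℂ x (H x) := by
  rw [add_apply, inner_add_right, X.inner_apply_self hx hx, add_zero]

theorem re_inner_add_of_mem' (X : BlockPair S H Δ ψ) {x : E} (hx : x ∈ Sᗮ) :
    inner ℂ x ((H + Δ) x) = inner ℂ x (H x) := by
  rw [add_apply, inner_add_right, X.inner_apply_self' hx hx, add_zero]

theorem H_mem (X : BlockPair S H Δ ψ) : ∀ x ∈ S, H x ∈ S := mem_of_commute X.diag

theorem H_mem' (X : BlockPair S H Δ ψ) : ∀ x ∈ Sᗮ, H x ∈ Sᗮ :=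
  mem_of_commute (commute_orthogonal X.diag)

theorem decomposition (S : Submodule ℂ E) (x : E) :
    S.starProjection x + Sᗮ.starProjection x = x :=
  S.starProjection_add_starProjection_orthogonal x

theorem ground_eq (X : BlockPair S H Δ ψ) :
    H (S.starProjection ψ) + Δ (Sᗮ.starProjection ψ)
      = (groundEnergy ⊤ (H + Δ) : ℂ) • S.starProjection ψ ∧
    H (Sᗮ.starProjection ψ) + Δ (S.starProjection ψ)
      = (groundEnergy ⊤ (H + Δ) : ℂ) • Sᗮ.starProjection ψ := by
  set p := S.starProjection ψ with hp
  set r := Sᗮ.starProjection ψ with hr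
  have hpS : p ∈ S := S.starProjection_apply_mem ψ
  have hrS : r ∈ Sᗮ := Sᗮ.starProjection_apply_mem ψ
  have hψ : p + r = ψ := decomposition S ψ
  have h := (mem_groundSpace.1 X.ground).2
  set l := (groundEnergy ⊤ (H + Δ) : ℂ)
  have h1 : H p + Δ r - l • p = -(H r + Δ p - l • r) := by
    have h2 : H ψ + Δ ψ = l • ψ := h
    rw [← hψ, map_add, map_add, smul_add] at h2
    rw [eq_neg_iff_add_eq_zero]
    calc _ = (H p + H r + (Δ p + Δ r)) - (l • p + l • r) := by abel
      _ = 0 := by rw [h2, sub_self]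
  have hm : H p + Δ r - l • p ∈ S := S.sub_mem
    (S.add_mem (X.H_mem p hpS) (X.apply_mem hrS)) (S.smul_mem _ hpS)
  have hm' : H r + Δ p - l • r ∈ Sᗮ := Sᗮ.sub_mem
    (Sᗮ.add_mem (X.H_mem' r hrS) (X.apply_mem_orthogonal hpS)) (Sᗮ.smul_mem _ hrS)
  have h0 : H p + Δ r - l • p = 0 := by
    refine (inner_self_eq_zero (𝕜 := ℂ)).1 ((congrArg (inner ℂ _) h1).trans ?_)
    rw [inner_neg_right, hm' _ hm, neg_zero]
  have h0' : H r + Δ p - l • r = 0 := by rw [h0, eq_comm, neg_eq_zero] at h1; exact h1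
  exact ⟨sub_eq_zero.1 h0, sub_eq_zero.1 h0'⟩

/-- `Q = -⟪ψ, Δ P_S ψ⟫`. -/
def tunneling (S : Submodule ℂ E) (Δ : E →L[ℂ] E) (ψ : E) : ℝ :=
  -(inner ℂ ψ (Δ (S.starProjection ψ))).re

/-- The block components of the eigenvalue equation give Δp = λr - Hr. The matrix element is thus an
expectation value of a Hermitian operator, hence real. -/
theorem inner_cross (X : BlockPair S H Δ ψ) :
    inner ℂ (Sᗮ.starProjection ψ) (Δ (S.starProjection ψ)) = ((-tunneling S Δ ψ : ℝ) : ℂ) := by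
  set p := S.starProjection ψ with hp
  set r := Sᗮ.starProjection ψ with hr
  have hpS : p ∈ S := S.starProjection_apply_mem ψ
  have hψ : p + r = ψ := decomposition S ψ
  have h1 : inner ℂ ψ (Δ p) = inner ℂ r (Δ p) := by
    conv_lhs => rw [← hψ]
    rw [inner_add_left, X.inner_apply_self hpS hpS, zero_add]
  have h2 : (inner ℂ r (Δ p)).im = 0 := by
    have h3 : Δ p = (groundEnergy ⊤ (H + Δ) : ℂ) • r - H r := by
      rw [← X.ground_eq.2, add_sub_cancel_left]
    have h4 : inner ℂ (H r) r = inner ℂ r (H r) := X.symmH r r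
    have h5 : (inner ℂ r (H r)).im = 0 := by
      rw [← Complex.conj_eq_iff_im, inner_conj_symm, h4]
    have h6 : (inner ℂ r r).im = 0 := inner_self_im (𝕜 := ℂ) r
    rw [h3, inner_sub_right, inner_smul_right, Complex.sub_im, h5, Complex.im_ofReal_mul, h6,
      mul_zero, sub_zero]
  rw [tunneling, ← hp, h1, neg_neg]
  exact Complex.ext (by simp) (by simp [h2])

/-- By the eigenvalue equation, (H + Δ - λ)(αp + βr) = (α - β)(Δp - Δr). The energy excess thus
depends only on α - β; the bounds of energies by h start from this. -/
theorem form_combination (X : BlockPair S H Δ ψ) (α β : ℂ) :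
    (inner ℂ (α • S.starProjection ψ + β • Sᗮ.starProjection ψ)
      ((H + Δ) (α • S.starProjection ψ + β • Sᗮ.starProjection ψ))).re
      = groundEnergy ⊤ (H + Δ) * ‖α • S.starProjection ψ + β • Sᗮ.starProjection ψ‖ ^ 2
        + ‖α - β‖ ^ 2 * tunneling S Δ ψ := by
  have hcross := X.inner_cross
  obtain ⟨hg1, hg2⟩ := X.ground_eq
  set p := S.starProjection ψ with hp
  set r := Sᗮ.starProjection ψ with hr
  have hpS : p ∈ S := S.starProjection_apply_mem ψ
  have hrS : r ∈ Sᗮ := Sᗮ.starProjection_apply_mem ψ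
  set l := groundEnergy ⊤ (H + Δ)
  set Q := tunneling S Δ ψ
  have hpr : inner ℂ p (Δ r) = ((-Q : ℝ) : ℂ) := by
    have : inner ℂ (Δ p) r = inner ℂ p (Δ r) := X.symmΔ p r
    rw [← this, ← inner_conj_symm, hcross, Complex.conj_ofReal]
  have e1 : (H + Δ) (α • p + β • r)
      = (l : ℂ) • (α • p + β • r) + (α - β) • (Δ p - Δ r) := by
    have k1 : H p = (l : ℂ) • p - Δ r := by rw [← hg1, add_sub_cancel_right]
    have k2 : H r = (l : ℂ) • r - Δ p := by rw [← hg2, add_sub_cancel_right]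
    rw [add_apply, map_add, map_add, map_smul, map_smul, map_smul, map_smul, k1, k2]
    module
  have e2 : inner ℂ (α • p + β • r) ((α - β) • (Δ p - Δ r)) = ((‖α - β‖ ^ 2 * Q : ℝ) : ℂ) := by
    rw [inner_smul_right, inner_sub_right, inner_add_left, inner_add_left, inner_smul_left,
      inner_smul_left, inner_smul_left, inner_smul_left, X.inner_apply_self hpS hpS,
      X.inner_apply_self' hrS hrS, hcross, hpr]
    push_cast
    rw [← Complex.mul_conj', map_sub]
    ring
  rw [e1, inner_add_right, e2, inner_smul_right, Complex.add_re, Complex.ofReal_re,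
    Complex.re_ofReal_mul, re_inner_self]

theorem form_S (X : BlockPair S H Δ ψ) :
    (inner ℂ (S.starProjection ψ) ((H + Δ) (S.starProjection ψ))).re
      = groundEnergy ⊤ (H + Δ) * ‖S.starProjection ψ‖ ^ 2 + tunneling S Δ ψ := by
  have := X.form_combination 1 0
  simpa using this

theorem form_S' (X : BlockPair S H Δ ψ) :
    (inner ℂ (Sᗮ.starProjection ψ) ((H + Δ) (Sᗮ.starProjection ψ))).re
      = groundEnergy ⊤ (H + Δ) * ‖Sᗮ.starProjection ψ‖ ^ 2 + tunneling S Δ ψ := by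
  have := X.form_combination 0 1
  simpa using this

theorem tunneling_nonneg (X : BlockPair S H Δ ψ) : 0 ≤ tunneling S Δ ψ := by
  have h1 := X.form_S
  have h2 := X.energy_mul_le (S.starProjection ψ)
  linarith

theorem min_pos (X : BlockPair S H Δ ψ) :
    0 < min (‖S.starProjection ψ‖ ^ 2) (‖Sᗮ.starProjection ψ‖ ^ 2) := by
  have h1 := norm_pos_iff.2 X.projS
  have h2 := norm_pos_iff.2 X.projS'
  exact lt_min (by positivity) (by positivity)

theorem cheegerRatio_mul (X : BlockPair S H Δ ψ) :
    cheegerRatio S Δ ψ * min (‖S.starProjection ψ‖ ^ 2) (‖Sᗮ.starProjection ψ‖ ^ 2)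
      = tunneling S Δ ψ := by
  have h1 : ∀ K : Submodule ℂ E, (inner ℂ ψ (K.starProjection ψ)).re = ‖K.starProjection ψ‖ ^ 2 := by
    intro K
    have h2 : inner ℂ (K.starProjection ψ) (K.starProjection ψ)
        = inner ℂ ψ (K.starProjection (K.starProjection ψ)) := K.starProjection_isSymmetric _ _
    rw [Submodule.starProjection_eq_self_iff.2 (K.starProjection_apply_mem ψ)] at h2
    rw [← h2, re_inner_self]
  have hpos := X.min_pos
  rw [cheegerRatio, h1, h1, if_pos hpos.ne', div_mul_cancel₀ _ hpos.ne', tunneling]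

theorem shifted_nonneg (X : BlockPair S H Δ ψ) (x : E) :
    0 ≤ (inner ℂ x (shifted (H + Δ) (groundEnergy ⊤ (H + Δ)) x)).re := by
  have := X.energy_mul_le x
  rw [shifted_apply, inner_sub_right, inner_smul_right, Complex.sub_re, Complex.re_ofReal_mul,
    re_inner_self]
  linarith

theorem isSymmetric_shifted {A : E →L[ℂ] E} (hA : (A : E →ₗ[ℂ] E).IsSymmetric) (μ : ℝ) :
    (shifted A μ : E →ₗ[ℂ] E).IsSymmetric := by
  intro x y
  have : inner ℂ (A x) y = inner ℂ x (A y) := hA x y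
  change inner ℂ (A x - (μ : ℂ) • x) y = inner ℂ x (A y - (μ : ℂ) • y)
  rw [inner_sub_left, inner_sub_right, this, inner_smul_left, inner_smul_right, Complex.conj_ofReal]

/-- The Cheeger ratio is positive, since the ground energy of `H + Δ` is simple. -/
theorem cheegerRatio_pos (X : BlockPair S H Δ ψ) : 0 < cheegerRatio S Δ ψ := by
  have hQ : 0 < tunneling S Δ ψ := by
    -- If Q = 0, both p and r have energy λ, so both are ground vectors. They are nonzero and
    -- orthogonal, against simplicity.
    refine lt_of_le_of_ne X.tunneling_nonneg fun h0 => ?_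
    have key : ∀ x : E, (inner ℂ x ((H + Δ) x)).re = groundEnergy ⊤ (H + Δ) * ‖x‖ ^ 2 →
        x ∈ groundSpace ⊤ (H + Δ) := by
      intro x hx
      have h1 := norm_apply_sq_le_of_nonneg (isSymmetric_shifted X.symm_add _) X.shifted_nonneg x
      have h2 : (inner ℂ x (shifted (H + Δ) (groundEnergy ⊤ (H + Δ)) x)).re = 0 := by
        rw [shifted_apply, inner_sub_right, inner_smul_right, Complex.sub_re, Complex.re_ofReal_mul,
          re_inner_self, hx, sub_self]
      rw [h2, mul_zero] at h1
      have h3 : shifted (H + Δ) (groundEnergy ⊤ (H + Δ)) x = 0 :=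
        norm_eq_zero.1 (pow_eq_zero_iff two_ne_zero |>.1 (le_antisymm h1 (sq_nonneg _)))
      exact mem_groundSpace.2 ⟨trivial, sub_eq_zero.1 h3⟩
    obtain ⟨φ, -, h1, hφ⟩ := exists_unit_groundSpace X.simple
    have hp : S.starProjection ψ = inner ℂ φ (S.starProjection ψ) • φ := by
      rw [← hφ]
      exact (Submodule.starProjection_eq_self_iff.2
        (key _ (by rw [X.form_S, ← h0, add_zero]))).symm
    have hr : Sᗮ.starProjection ψ = inner ℂ φ (Sᗮ.starProjection ψ) • φ := by
      rw [← hφ]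
      exact (Submodule.starProjection_eq_self_iff.2
        (key _ (by rw [X.form_S', ← h0, add_zero]))).symm
    have hort : inner ℂ (S.starProjection ψ) (Sᗮ.starProjection ψ) = 0 :=
      Sᗮ.starProjection_apply_mem ψ _ (S.starProjection_apply_mem ψ)
    rw [hp, hr, inner_smul_left, inner_smul_right, inner_self_eq_norm_sq_to_K, h1] at hort
    simp only [mul_eq_zero, map_eq_zero] at hort
    rcases hort with h | h | h
    · exact X.projS (by rw [hp, h, zero_smul])
    · exact X.projS' (by rw [hr, h, zero_smul])
    · simp at h
  have := X.cheegerRatio_mul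
  by_contra! hle
  nlinarith [X.min_pos]

/-- From |α - β|² ≤ 2(|α|² + |β|²), and Q = h min(‖p‖², ‖r‖²): the minimum in the Cheeger ratio
serves both components at once. -/
theorem form_combination_le (X : BlockPair S H Δ ψ) (α β : ℂ) :
    (inner ℂ (α • S.starProjection ψ + β • Sᗮ.starProjection ψ)
      ((H + Δ) (α • S.starProjection ψ + β • Sᗮ.starProjection ψ))).re
      ≤ (groundEnergy ⊤ (H + Δ) + 2 * cheegerRatio S Δ ψ)
        * ‖α • S.starProjection ψ + β • Sᗮ.starProjection ψ‖ ^ 2 := by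
  rw [X.form_combination, ← X.cheegerRatio_mul]
  have hort : inner ℂ (S.starProjection ψ) (Sᗮ.starProjection ψ) = 0 :=
    Sᗮ.starProjection_apply_mem ψ _ (S.starProjection_apply_mem ψ)
  have e1 : ‖α • S.starProjection ψ + β • Sᗮ.starProjection ψ‖ ^ 2
      = ‖α‖ ^ 2 * ‖S.starProjection ψ‖ ^ 2 + ‖β‖ ^ 2 * ‖Sᗮ.starProjection ψ‖ ^ 2 := by
    rw [sq, norm_add_sq_eq_norm_sq_add_norm_sq_of_inner_eq_zero (𝕜 := ℂ), norm_smul, norm_smul]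
    · ring
    · rw [inner_smul_left, inner_smul_right, hort, mul_zero, mul_zero]
  have h1 : ‖α - β‖ ^ 2 ≤ 2 * (‖α‖ ^ 2 + ‖β‖ ^ 2) := by
    have := norm_sub_le α β
    nlinarith [sq_nonneg (‖α‖ - ‖β‖), norm_nonneg (α - β), norm_nonneg α, norm_nonneg β]
  rw [e1, add_mul]
  have hm := X.min_pos
  have hh := X.cheegerRatio_pos
  set a := ‖S.starProjection ψ‖ ^ 2
  set b := ‖Sᗮ.starProjection ψ‖ ^ 2
  have h2 : ‖α - β‖ ^ 2 * min a b ≤ 2 * (‖α‖ ^ 2 * a + ‖β‖ ^ 2 * b) := by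
    calc ‖α - β‖ ^ 2 * min a b ≤ 2 * (‖α‖ ^ 2 + ‖β‖ ^ 2) * min a b := by gcongr
      _ = 2 * (‖α‖ ^ 2 * min a b + ‖β‖ ^ 2 * min a b) := by ring
      _ ≤ 2 * (‖α‖ ^ 2 * a + ‖β‖ ^ 2 * b) := by
          gcongr
          · exact min_le_left _ _
          · exact min_le_right _ _
  nlinarith [mul_le_mul_of_nonneg_left h2 hh.le]

theorem energy_le_groundEnergy (X : BlockPair S H Δ ψ) :
    groundEnergy ⊤ (H + Δ) ≤ groundEnergy S H := by
  obtain ⟨φ, hφ, h1, -⟩ := exists_unit_groundSpace X.simpleS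
  obtain ⟨hφS, hφH⟩ := mem_groundSpace.1 hφ
  have h := X.energy_mul_le φ
  rw [X.re_inner_add_of_mem hφS, hφH, inner_smul_right, Complex.re_ofReal_mul, re_inner_self, h1]
    at h
  linarith

theorem energy_le_groundEnergy' (X : BlockPair S H Δ ψ) :
    groundEnergy ⊤ (H + Δ) ≤ groundEnergy Sᗮ H := by
  obtain ⟨φ, hφ, h1, -⟩ := exists_unit_groundSpace X.simpleS'
  obtain ⟨hφS, hφH⟩ := mem_groundSpace.1 hφ
  have h := X.energy_mul_le φ
  rw [X.re_inner_add_of_mem' hφS, hφH, inner_smul_right, Complex.re_ofReal_mul, re_inner_self, h1]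
    at h
  linarith

/-- The trial vector P_S ψ has Rayleigh quotient λ + Q/‖P_S ψ‖², at most λ + h. -/
theorem groundEnergy_le (X : BlockPair S H Δ ψ) :
    groundEnergy S H ≤ groundEnergy ⊤ (H + Δ) + cheegerRatio S Δ ψ := by
  have hpS := S.starProjection_apply_mem ψ
  have h1 := groundEnergy_mul_le X.symmH X.H_mem hpS
  rw [← X.re_inner_add_of_mem hpS, X.form_S, ← X.cheegerRatio_mul] at h1
  have h2 := norm_pos_iff.2 X.projS
  have h3 : cheegerRatio S Δ ψ * min (‖S.starProjection ψ‖ ^ 2) (‖Sᗮ.starProjection ψ‖ ^ 2)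
      ≤ cheegerRatio S Δ ψ * ‖S.starProjection ψ‖ ^ 2 :=
    mul_le_mul_of_nonneg_left (min_le_left _ _) X.cheegerRatio_pos.le
  refine le_of_mul_le_mul_right (a := ‖S.starProjection ψ‖ ^ 2) ?_ (by positivity)
  linarith

theorem groundEnergy_le' (X : BlockPair S H Δ ψ) :
    groundEnergy Sᗮ H ≤ groundEnergy ⊤ (H + Δ) + cheegerRatio S Δ ψ := by
  have hpS := Sᗮ.starProjection_apply_mem ψ
  have h1 := groundEnergy_mul_le X.symmH X.H_mem' hpS
  rw [← X.re_inner_add_of_mem' hpS, X.form_S', ← X.cheegerRatio_mul] at h1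
  have h2 := norm_pos_iff.2 X.projS'
  have h3 : cheegerRatio S Δ ψ * min (‖S.starProjection ψ‖ ^ 2) (‖Sᗮ.starProjection ψ‖ ^ 2)
      ≤ cheegerRatio S Δ ψ * ‖Sᗮ.starProjection ψ‖ ^ 2 :=
    mul_le_mul_of_nonneg_left (min_le_right _ _) X.cheegerRatio_pos.le
  refine le_of_mul_le_mul_right (a := ‖Sᗮ.starProjection ψ‖ ^ 2) ?_ (by positivity)
  linarith

/-- `(1 - c) min(Γ_S, Γ_Sbar) = min(Γ_S, Γ_Sbar) - ‖Δ‖`. -/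
theorem one_sub_relSize_mul (X : BlockPair S H Δ ψ) :
    (1 - relSize S H Δ) * minGap S H = minGap S H - ‖Δ‖ := by
  rw [relSize, sub_mul, one_mul, div_mul_cancel₀ _ X.minGap_pos.ne']

/-- Assumption (2), multiplied by m. It keeps m - ‖Δ‖ positive, which all later divisions need. -/
theorem cheegerRatio_le (X : BlockPair S H Δ ψ) : cheegerRatio S Δ ψ ≤ minGap S H - ‖Δ‖ := by
  have h := mul_le_mul_of_nonneg_right X.small X.minGap_pos.le
  have h2 := X.one_sub_relSize_mul
  rw [sub_mul, one_mul] at h2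
  rw [sub_mul, one_mul, div_mul_cancel₀ _ X.minGap_pos.ne'] at h
  linarith

/-- Away from the local ground vectors the energy of `H + Δ` is large. -/
theorem form_away (X : BlockPair S H Δ ψ) {x : E} (hx : groundProj S H x = 0)
    (hx' : groundProj Sᗮ H x = 0) :
    (groundEnergy ⊤ (H + Δ) + (minGap S H - ‖Δ‖)) * ‖x‖ ^ 2 ≤ (inner ℂ x ((H + Δ) x)).re := by
  set p := S.starProjection x with hp
  set r := Sᗮ.starProjection x with hr
  have hpS : p ∈ S := S.starProjection_apply_mem x
  have hrS : r ∈ Sᗮ := Sᗮ.starProjection_apply_mem x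
  have hxpr : p + r = x := decomposition S x
  have hpg : p ∈ (groundSpace S H)ᗮ := by
    intro v hv
    have h1 := (Submodule.starProjection_apply_eq_zero_iff _).1 hx v hv
    rw [← hxpr, inner_add_right, hrS v (mem_groundSpace.1 hv).1, add_zero] at h1
    exact h1
  have hrg : r ∈ (groundSpace Sᗮ H)ᗮ := by
    intro v hv
    have h1 := (Submodule.starProjection_apply_eq_zero_iff _).1 hx' v hv
    have h2 : inner ℂ v p = 0 := by
      rw [← inner_conj_symm, (mem_groundSpace.1 hv).1 p hpS, map_zero]
    rw [← hxpr, inner_add_right, h2, zero_add] at h1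
    exact h1
  have h1 := excitedEnergy_mul_le X.symmH X.H_mem hpS hpg
  have h2 := excitedEnergy_mul_le X.symmH X.H_mem' hrS hrg
  have h3 : inner ℂ x (H x) = inner ℂ p (H p) + inner ℂ r (H r) := by
    have k1 : inner ℂ p (H r) = 0 := X.H_mem' r hrS p hpS
    have k2 : inner ℂ r (H p) = 0 := by
      rw [← inner_conj_symm, hrS _ (X.H_mem p hpS), map_zero]
    rw [← hxpr, map_add, inner_add_left, inner_add_right, inner_add_right, k1, k2, add_zero,
      zero_add]
  have h4 : -(‖Δ‖ * ‖x‖ ^ 2) ≤ (inner ℂ x (Δ x)).re := by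
    have k : |(inner ℂ x (Δ x)).re| ≤ ‖Δ‖ * ‖x‖ ^ 2 := by
      refine (Complex.abs_re_le_norm _).trans ((norm_inner_le_norm _ _).trans ?_)
      nlinarith [Δ.le_opNorm x, norm_nonneg x]
    exact (abs_le.1 k).1
  have h5 := norm_sq_eq_add_blocks S x
  rw [← hp, ← hr] at h5
  -- The excited energy is the local ground energy plus the local gap, and the former is at least λ.
  have e1 : groundEnergy ⊤ (H + Δ) + minGap S H ≤ excitedEnergy S H := by
    have := X.energy_le_groundEnergy
    have k : minGap S H ≤ gap S H := min_le_left _ _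
    rw [gap] at k
    linarith
  have e2 : groundEnergy ⊤ (H + Δ) + minGap S H ≤ excitedEnergy Sᗮ H := by
    have := X.energy_le_groundEnergy'
    have k : minGap S H ≤ gap Sᗮ H := min_le_right _ _
    rw [gap] at k
    linarith
  have e3 := mul_le_mul_of_nonneg_right e1 (sq_nonneg ‖p‖)
  have e4 := mul_le_mul_of_nonneg_right e2 (sq_nonneg ‖r‖)
  rw [add_apply, inner_add_right, h3, Complex.add_re, Complex.add_re]
  have e5 : (groundEnergy ⊤ (H + Δ) + (minGap S H - ‖Δ‖)) * ‖x‖ ^ 2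
      = (groundEnergy ⊤ (H + Δ) + minGap S H) * ‖p‖ ^ 2
        + (groundEnergy ⊤ (H + Δ) + minGap S H) * ‖r‖ ^ 2 - ‖Δ‖ * ‖x‖ ^ 2 := by
    rw [h5]; ring
  linarith

/-- On the sum of the local ground spaces the energy of `H + Δ` is at most `λ + 2h`. -/
theorem form_ground_le (X : BlockPair S H Δ ψ) {u v : E} (hu : u ∈ groundSpace S H)
    (hv : v ∈ groundSpace Sᗮ H) : (inner ℂ (u + v) ((H + Δ) (u + v))).re
      ≤ (groundEnergy ⊤ (H + Δ) + 2 * cheegerRatio S Δ ψ) * ‖u + v‖ ^ 2 := by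
  obtain ⟨huS, huH⟩ := mem_groundSpace.1 hu
  obtain ⟨hvS, hvH⟩ := mem_groundSpace.1 hv
  have huv : inner ℂ u v = 0 := hvS u huS
  have n1 : ‖u + v‖ ^ 2 = ‖u‖ ^ 2 + ‖v‖ ^ 2 := by
    rw [sq, norm_add_sq_eq_norm_sq_add_norm_sq_of_inner_eq_zero (𝕜 := ℂ) _ _ huv]; ring
  have n2 : ‖u - v‖ ^ 2 = ‖u‖ ^ 2 + ‖v‖ ^ 2 := by
    rw [sub_eq_add_neg, sq, norm_add_sq_eq_norm_sq_add_norm_sq_of_inner_eq_zero (𝕜 := ℂ), norm_neg]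
    · ring
    · rw [inner_neg_right, huv, neg_zero]
  have h1 := X.energy_mul_le (u - v)
  have fu : (inner ℂ u ((H + Δ) u)).re = groundEnergy S H * ‖u‖ ^ 2 := by
    rw [X.re_inner_add_of_mem huS, huH, inner_smul_right, Complex.re_ofReal_mul, re_inner_self]
  have fv : (inner ℂ v ((H + Δ) v)).re = groundEnergy Sᗮ H * ‖v‖ ^ 2 := by
    rw [X.re_inner_add_of_mem' hvS, hvH, inner_smul_right, Complex.re_ofReal_mul, re_inner_self]
  -- The parallelogram law avoids estimating the cross term: u and v have energies at most λ + h,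
  -- and u - v has energy at least λ.
  have par : (inner ℂ (u + v) ((H + Δ) (u + v))).re + (inner ℂ (u - v) ((H + Δ) (u - v))).re
      = 2 * (inner ℂ u ((H + Δ) u)).re + 2 * (inner ℂ v ((H + Δ) v)).re := by
    rw [map_add (H + Δ), map_sub (H + Δ)]
    simp only [inner_add_left, inner_add_right, inner_sub_left, inner_sub_right, Complex.add_re,
      Complex.sub_re]
    ring
  have g1 := mul_le_mul_of_nonneg_right X.groundEnergy_le (sq_nonneg ‖u‖)
  have g2 := mul_le_mul_of_nonneg_right X.groundEnergy_le' (sq_nonneg ‖v‖)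
  rw [n2] at h1
  rw [n1]
  linarith

end BlockPair

/-! ### Low-energy plane versus local ground spaces, and the couplings between them -/

theorem groundProj_mem (S : Submodule ℂ E) (H : E →L[ℂ] E) (x : E) :
    groundProj S H x ∈ groundSpace S H :=
  Submodule.starProjection_apply_mem _ x

theorem norm_groundProj_apply_le (S : Submodule ℂ E) (H : E →L[ℂ] E) (x : E) :
    ‖groundProj S H x‖ ≤ ‖x‖ :=
  (groundSpace S H).norm_starProjection_apply_le x

theorem awayProj_apply (S : Submodule ℂ E) (H : E →L[ℂ] E) (x : E) :
    awayProj S H x = x - groundProj S H x - groundProj Sᗮ H x := rfl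

theorem norm_sq_eq_three (S : Submodule ℂ E) (H : E →L[ℂ] E) (x : E) :
    ‖x‖ ^ 2 = ‖groundProj S H x‖ ^ 2 + ‖groundProj Sᗮ H x‖ ^ 2 + ‖awayProj S H x‖ ^ 2 := by
  have h1 := norm_sq_eq_low_add (groundSpace S H) x
  have h2 := norm_sq_eq_low_add (groundSpace Sᗮ H) ((1 - groundProj S H) x)
  have h3 : groundProj Sᗮ H ((1 - groundProj S H) x) = groundProj Sᗮ H x := by
    have : groundProj Sᗮ H * (1 - groundProj S H) = groundProj Sᗮ H := by
      rw [mul_sub, mul_one, groundProj_orthogonal_mul_groundProj, sub_zero]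
    exact DFunLike.congr_fun this x
  have h4 : (1 - groundProj Sᗮ H) ((1 - groundProj S H) x) = awayProj S H x := by
    have : (1 - groundProj Sᗮ H) ((1 - groundProj S H) x)
      = (1 - groundProj S H) x - groundProj Sᗮ H ((1 - groundProj S H) x) := rfl
    rw [this, h3]; rfl
  change ‖x‖ ^ 2 = ‖groundProj S H x‖ ^ 2 + ‖(1 - groundProj S H) x‖ ^ 2 at h1
  change _ = ‖groundProj Sᗮ H ((1 - groundProj S H) x)‖ ^ 2
    + ‖(1 - groundProj Sᗮ H) ((1 - groundProj S H) x)‖ ^ 2 at h2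
  rw [h3, h4] at h2
  linarith

theorem norm_awayProj_apply_le (S : Submodule ℂ E) (H : E →L[ℂ] E) (x : E) :
    ‖awayProj S H x‖ ≤ ‖x‖ := by
  refine (sq_le_sq₀ (norm_nonneg _) (norm_nonneg _)).1 ?_
  have := norm_sq_eq_three S H x
  nlinarith [sq_nonneg ‖groundProj S H x‖, sq_nonneg ‖groundProj Sᗮ H x‖]

theorem norm_perpPart_le (S : Submodule ℂ E) (H Δ : E →L[ℂ] E) : ‖perpPart S H Δ‖ ≤ ‖Δ‖ := by
  have h : ‖awayProj S H‖ ≤ 1 := ContinuousLinearMap.opNorm_le_bound _ zero_le_one fun x => by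
    rw [one_mul]; exact norm_awayProj_apply_le S H x
  have := norm_mul_le_of_le (norm_mul_le_of_le h (le_refl ‖Δ‖)) h
  rwa [one_mul, mul_one] at this

theorem norm_one_sub_lowProj_apply_le (A : E →L[ℂ] E) (b : ℝ) (x : E) :
    ‖(1 - lowProj A b) x‖ ≤ ‖x‖ := by
  have : 1 - lowProj A b = (lowSpace A b)ᗮ.starProjection :=
    (Submodule.starProjection_orthogonal' _).symm
  rw [this]
  exact Submodule.norm_starProjection_apply_le _ x

namespace BlockPair

variable {S : Submodule ℂ E} {H Δ : E →L[ℂ] E} {ψ : E}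

theorem eta_pos (X : BlockPair S H Δ ψ) : 0 < eta S H Δ := by
  rw [eta, sub_pos, div_lt_one X.minGap_pos]
  linarith [norm_perpPart_le S H Δ, X.cheegerRatio_le, X.cheegerRatio_pos]

theorem mismatch_sq (X : BlockPair S H Δ ψ) :
    mismatch S H Δ ψ ^ 2 = 2 * cheegerRatio S Δ ψ / (minGap S H - ‖Δ‖) := by
  have h1 := X.cheegerRatio_pos
  have h2 := X.cheegerRatio_le
  rw [mismatch, X.one_sub_relSize_mul, Real.sq_sqrt]
  have : 0 < minGap S H - ‖Δ‖ := by linarith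
  positivity

/-- The spectral estimates in the case of well separated low levels. -/
theorem low_levels (X : BlockPair S H Δ ψ) (hlt : 2 * cheegerRatio S Δ ψ < minGap S H - ‖Δ‖) :
    Module.finrank ℂ (lowSpace (H + Δ) (groundEnergy ⊤ (H + Δ) + 2 * cheegerRatio S Δ ψ)) = 2 ∧
    ∀ x ∈ (lowSpace (H + Δ) (groundEnergy ⊤ (H + Δ) + 2 * cheegerRatio S Δ ψ))ᗮ,
      (groundEnergy ⊤ (H + Δ) + (minGap S H - ‖Δ‖)) * ‖x‖ ^ 2
        ≤ (inner ℂ x ((H + Δ) x)).re := by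
  obtain ⟨φ₁, -, -, hφ₁⟩ := exists_unit_groundSpace X.simpleS
  obtain ⟨φ₂, -, -, hφ₂⟩ := exists_unit_groundSpace X.simpleS'
  have hg : ∀ x, inner ℂ φ₁ x = 0 → inner ℂ φ₂ x = 0 →
      (groundEnergy ⊤ (H + Δ) + (minGap S H - ‖Δ‖)) * ‖x‖ ^ 2
        ≤ (inner ℂ x ((H + Δ) x)).re := fun x h1 h2 =>
    X.form_away (by rw [hφ₁, h1, zero_smul]) (by rw [hφ₂, h2, zero_smul])
  have hbg : groundEnergy ⊤ (H + Δ) + 2 * cheegerRatio S Δ ψ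
      < groundEnergy ⊤ (H + Δ) + (minGap S H - ‖Δ‖) := by linarith
  have hort : inner ℂ (S.starProjection ψ) (Sᗮ.starProjection ψ) = 0 :=
    Sᗮ.starProjection_apply_mem ψ _ (S.starProjection_apply_mem ψ)
  -- Two planes play different roles: the components of ψ show that there are at least two low
  -- levels, while the local ground vectors show that there are at most two.
  have h2 := two_le_finrank_lowSpace (ψ₁ := S.starProjection ψ) (ψ₂ := Sᗮ.starProjection ψ)
    X.symm_add (fun p hp => by
      rw [combination_apply] at hp
      have k1 := congrArg (S.starProjection) hp
      have k2 := congrArg (Sᗮ.starProjection) hp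
      have z1 : S.starProjection (Sᗮ.starProjection ψ) = 0 :=
        DFunLike.congr_fun (starProjection_mul_orthogonal S) ψ
      have z2 : Sᗮ.starProjection (S.starProjection ψ) = 0 :=
        DFunLike.congr_fun (starProjection_orthogonal_mul S) ψ
      have i1 := Submodule.starProjection_eq_self_iff.2 (S.starProjection_apply_mem ψ)
      have i2 := Submodule.starProjection_eq_self_iff.2 (Sᗮ.starProjection_apply_mem ψ)
      rw [map_add, map_smul, map_smul, z1, i1, smul_zero, add_zero, map_zero] at k1
      rw [map_add, map_smul, map_smul, z2, i2, smul_zero, zero_add, map_zero] at k2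
      exact Prod.ext ((smul_eq_zero.1 k1).resolve_right X.projS)
        ((smul_eq_zero.1 k2).resolve_right X.projS'))
    (fun p => X.form_combination_le p.1 p.2)
  exact ⟨le_antisymm (finrank_lowSpace_le_two X.symm_add hg hbg) h2,
    fun x hx => mul_norm_sq_le_of_two_levels X.symm_add hg hbg h2 hx⟩

theorem norm_sub_lowProj_ground_sq_le (X : BlockPair S H Δ ψ)
    (hlt : 2 * cheegerRatio S Δ ψ < minGap S H - ‖Δ‖) {u v : E} (hu : u ∈ groundSpace S H)
    (hv : v ∈ groundSpace Sᗮ H) :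
    ‖(1 - lowProj (H + Δ) (groundEnergy ⊤ (H + Δ) + 2 * cheegerRatio S Δ ψ)) (u + v)‖ ^ 2
      ≤ mismatch S H Δ ψ ^ 2 * ‖u + v‖ ^ 2 := by
  have h := norm_sub_lowProj_sq_le X.symm_add X.energy_mul_le (X.low_levels hlt).2
    (X.form_ground_le hu hv)
  rw [add_sub_cancel_left, add_sub_cancel_left] at h
  have hpos : 0 < minGap S H - ‖Δ‖ := by linarith [X.cheegerRatio_pos]
  rw [X.mismatch_sq, div_mul_eq_mul_div, le_div_iff₀ hpos]
  linarith

/-- When the low levels need not be separated, the closeness estimates reduce to the fact that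
projections do not increase norms. -/
theorem one_le_mismatch (X : BlockPair S H Δ ψ)
    (hle : minGap S H - ‖Δ‖ ≤ 2 * cheegerRatio S Δ ψ) : 1 ≤ mismatch S H Δ ψ := by
  have hpos : 0 < minGap S H - ‖Δ‖ := by linarith [X.cheegerRatio_pos, X.cheegerRatio_le]
  have h : 1 ≤ mismatch S H Δ ψ ^ 2 := by rw [X.mismatch_sq, one_le_div hpos]; exact hle
  have h0 : 0 ≤ mismatch S H Δ ψ := Real.sqrt_nonneg _
  nlinarith

/-- The local ground vector is close to the low-energy space. -/
theorem norm_sub_lowProj_le (X : BlockPair S H Δ ψ) {u : E} (hu : u ∈ groundSpace S H) :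
    ‖(1 - lowProj (H + Δ) (groundEnergy ⊤ (H + Δ) + 2 * cheegerRatio S Δ ψ)) u‖
      ≤ mismatch S H Δ ψ * ‖u‖ := by
  have h0 : 0 ≤ mismatch S H Δ ψ := Real.sqrt_nonneg _
  rcases lt_or_ge (2 * cheegerRatio S Δ ψ) (minGap S H - ‖Δ‖) with hlt | hle
  · have h := X.norm_sub_lowProj_ground_sq_le hlt hu (Submodule.zero_mem _)
    rw [add_zero, ← mul_pow] at h
    exact (sq_le_sq₀ (norm_nonneg _) (by positivity)).1 h
  · exact (norm_one_sub_lowProj_apply_le _ _ u).trans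
      (le_mul_of_one_le_left (norm_nonneg _) (X.one_le_mismatch hle))

/-- The low-energy space is close to the sum of the local ground spaces. -/
theorem norm_awayProj_lowProj_le (X : BlockPair S H Δ ψ) (y : E) :
    ‖awayProj S H (lowProj (H + Δ) (groundEnergy ⊤ (H + Δ) + 2 * cheegerRatio S Δ ψ) y)‖
      ≤ mismatch S H Δ ψ * ‖y‖ := by
  have h0 : 0 ≤ mismatch S H Δ ψ := Real.sqrt_nonneg _
  have hn : ‖lowProj (H + Δ) (groundEnergy ⊤ (H + Δ) + 2 * cheegerRatio S Δ ψ) y‖ ≤ ‖y‖ :=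
    Submodule.norm_starProjection_apply_le _ y
  rcases lt_or_ge (2 * cheegerRatio S Δ ψ) (minGap S H - ‖Δ‖) with hlt | hle
  · obtain ⟨φ₁, m₁, n₁, hφ₁⟩ := exists_unit_groundSpace X.simpleS
    obtain ⟨φ₂, m₂, n₂, hφ₂⟩ := exists_unit_groundSpace X.simpleS'
    have hφ : inner ℂ φ₁ φ₂ = 0 := (mem_groundSpace.1 m₂).1 φ₁ (mem_groundSpace.1 m₁).1
    have hpos : 0 < minGap S H - ‖Δ‖ := by linarith [X.cheegerRatio_pos]
    have hq1 : mismatch S H Δ ψ ^ 2 < 1 := by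
      rw [X.mismatch_sq, div_lt_one hpos]; exact hlt
    have h := norm_sub_coefficients_le (X.low_levels hlt).1 n₁ n₂ hφ hq1
      (fun p => X.norm_sub_lowProj_ground_sq_le hlt (Submodule.smul_mem _ p.1 m₁)
        (Submodule.smul_mem _ p.2 m₂))
      (Submodule.starProjection_apply_mem _ y)
    rw [← hφ₁, ← hφ₂, ← sub_sub, ← mul_pow] at h
    exact ((sq_le_sq₀ (norm_nonneg _) (by positivity)).1 h).trans (by gcongr; exact hn)
  · exact ((norm_awayProj_apply_le S H _).trans hn).trans
      (le_mul_of_one_le_left (norm_nonneg _) (X.one_le_mismatch hle))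

theorem shifted_apply_ground {u : E} (hu : u ∈ groundSpace S H) :
    shifted (H + Δ) (groundEnergy ⊤ (H + Δ)) u
      = ((groundEnergy S H - groundEnergy ⊤ (H + Δ) : ℝ) : ℂ) • u + Δ u := by
  rw [shifted_apply, add_apply, (mem_groundSpace.1 hu).2]
  push_cast; module

theorem shifted_apply_ground' {u : E} (hu : u ∈ groundSpace Sᗮ H) :
    shifted (H + Δ) (groundEnergy ⊤ (H + Δ)) u
      = ((groundEnergy Sᗮ H - groundEnergy ⊤ (H + Δ) : ℝ) : ℂ) • u + Δ u := by
  rw [shifted_apply, add_apply, (mem_groundSpace.1 hu).2]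
  push_cast; module

theorem form_ground (X : BlockPair S H Δ ψ) {u : E} (hu : u ∈ groundSpace S H) :
    (inner ℂ u (shifted (H + Δ) (groundEnergy ⊤ (H + Δ)) u)).re
      ≤ cheegerRatio S Δ ψ * ‖u‖ ^ 2 := by
  have huS := (mem_groundSpace.1 hu).1
  rw [shifted_apply_ground hu, inner_add_right, X.inner_apply_self huS huS, add_zero,
    inner_smul_right, Complex.re_ofReal_mul, re_inner_self]
  have := X.groundEnergy_le
  gcongr
  linarith

theorem form_ground' (X : BlockPair S H Δ ψ) {u : E} (hu : u ∈ groundSpace Sᗮ H) :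
    (inner ℂ u (shifted (H + Δ) (groundEnergy ⊤ (H + Δ)) u)).re
      ≤ cheegerRatio S Δ ψ * ‖u‖ ^ 2 := by
  have huS := (mem_groundSpace.1 hu).1
  rw [shifted_apply_ground' hu, inner_add_right, X.inner_apply_self' huS huS, add_zero,
    inner_smul_right, Complex.re_ofReal_mul, re_inner_self]
  have := X.groundEnergy_le'
  gcongr
  linarith

/-- The matrix element of `Δ` between the two local ground spaces. -/
theorem norm_inner_ground_le (X : BlockPair S H Δ ψ) {u v : E} (hu : u ∈ groundSpace S H)
    (hv : v ∈ groundSpace Sᗮ H) : ‖inner ℂ u (Δ v)‖ ≤ cheegerRatio S Δ ψ * (‖u‖ * ‖v‖) := by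
  -- In the positive form H + Δ - λ, both local ground vectors have energy at most h, and their
  -- mixed term is just the matrix element of Δ because they are orthogonal.
  have h := norm_inner_sq_le_of_nonneg (isSymmetric_shifted X.symm_add _) X.shifted_nonneg u v
  have huv : inner ℂ u v = 0 := (mem_groundSpace.1 hv).1 u (mem_groundSpace.1 hu).1
  have e : inner ℂ u (shifted (H + Δ) (groundEnergy ⊤ (H + Δ)) v) = inner ℂ u (Δ v) := by
    rw [shifted_apply_ground' hv, inner_add_right, inner_smul_right, huv, mul_zero, zero_add]
  rw [e] at h
  have hh := X.cheegerRatio_pos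
  refine (sq_le_sq₀ (norm_nonneg _) (by positivity)).1 (h.trans ?_)
  calc _ ≤ (cheegerRatio S Δ ψ * ‖u‖ ^ 2) * (cheegerRatio S Δ ψ * ‖v‖ ^ 2) :=
        mul_le_mul (X.form_ground hu) (X.form_ground' hv) (X.shifted_nonneg v) (by positivity)
    _ = _ := by ring

/-- The coupling of the local ground spaces to their complement. -/
theorem norm_away_ground_le (X : BlockPair S H Δ ψ) {u v : E} (hu : u ∈ groundSpace S H)
    (hv : v ∈ groundSpace Sᗮ H) :
    ‖awayProj S H (Δ (u + v))‖ ≤ √(kappa H Δ * cheegerRatio S Δ ψ) * ‖u + v‖ := by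
  have hh := X.cheegerRatio_pos
  have hκ : 0 ≤ kappa H Δ := norm_nonneg _
  have key : ∀ w : E, (inner ℂ w (shifted (H + Δ) (groundEnergy ⊤ (H + Δ)) w)).re
      ≤ cheegerRatio S Δ ψ * ‖w‖ ^ 2 → awayProj S H (Δ w)
        = awayProj S H (shifted (H + Δ) (groundEnergy ⊤ (H + Δ)) w) →
      ‖awayProj S H (Δ w)‖ ^ 2 ≤ kappa H Δ * cheegerRatio S Δ ψ * ‖w‖ ^ 2 := by
    intro w h1 h2
    have h3 := norm_apply_sq_le_of_nonneg (isSymmetric_shifted X.symm_add _) X.shifted_nonneg w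
    have h4 := norm_awayProj_apply_le S H (shifted (H + Δ) (groundEnergy ⊤ (H + Δ)) w)
    rw [h2]
    calc _ ≤ ‖shifted (H + Δ) (groundEnergy ⊤ (H + Δ)) w‖ ^ 2 := by gcongr
      _ ≤ kappa H Δ * (inner ℂ w (shifted (H + Δ) (groundEnergy ⊤ (H + Δ)) w)).re := h3
      _ ≤ kappa H Δ * (cheegerRatio S Δ ψ * ‖w‖ ^ 2) := by gcongr
      _ = _ := by ring
  have au : awayProj S H u = 0 := by
    have h := DFunLike.congr_fun (awayProj_mul_groundProj S H) u
    rwa [mul_apply_eq_comp, show groundProj S H u = u from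
      Submodule.starProjection_eq_self_iff.2 hu] at h
  have av : awayProj S H v = 0 := by
    have h := DFunLike.congr_fun (awayProj_mul_groundProj_orthogonal S H) v
    rwa [mul_apply_eq_comp, show groundProj Sᗮ H v = v from
      Submodule.starProjection_eq_self_iff.2 hv] at h
  have ku := key u (X.form_ground hu) (by
    rw [shifted_apply_ground hu, map_add, map_smul, au, smul_zero, zero_add])
  have kv := key v (X.form_ground' hv) (by
    rw [shifted_apply_ground' hv, map_add, map_smul, av, smul_zero, zero_add])
  have huS := (mem_groundSpace.1 hu).1
  have hvS := (mem_groundSpace.1 hv).1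
  have mu : awayProj S H (Δ u) ∈ Sᗮ := by
    have hΔ := X.apply_mem_orthogonal huS
    have h1 : groundProj S H (Δ u) = 0 := (Submodule.starProjection_apply_eq_zero_iff _).2
      fun w hw => hΔ w (mem_groundSpace.1 hw).1
    rw [awayProj_apply, h1, sub_zero]
    exact Sᗮ.sub_mem hΔ (mem_groundSpace.1 (groundProj_mem _ _ _)).1
  have mv : awayProj S H (Δ v) ∈ S := by
    have hΔ := X.apply_mem hvS
    have h1 : groundProj Sᗮ H (Δ v) = 0 := (Submodule.starProjection_apply_eq_zero_iff _).2
      fun w hw => by rw [← inner_conj_symm, (mem_groundSpace.1 hw).1 _ hΔ, map_zero]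
    rw [awayProj_apply, h1, sub_zero]
    exact S.sub_mem hΔ (mem_groundSpace.1 (groundProj_mem _ _ _)).1
  -- The images of u and v lie in opposite blocks, so the squares add and no factor is lost.
  have n1 : ‖awayProj S H (Δ (u + v))‖ ^ 2
      = ‖awayProj S H (Δ u)‖ ^ 2 + ‖awayProj S H (Δ v)‖ ^ 2 := by
    rw [map_add, map_add, add_comm, sq,
      norm_add_sq_eq_norm_sq_add_norm_sq_of_inner_eq_zero (𝕜 := ℂ) _ _ (mu _ mv)]
    ring
  have n2 : ‖u + v‖ ^ 2 = ‖u‖ ^ 2 + ‖v‖ ^ 2 := by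
    rw [sq, norm_add_sq_eq_norm_sq_add_norm_sq_of_inner_eq_zero (𝕜 := ℂ) _ _ (hvS u huS)]; ring
  refine (sq_le_sq₀ (norm_nonneg _) (by positivity)).1 ?_
  rw [mul_pow, Real.sq_sqrt (by positivity), n1, n2]
  linarith

/-- The matrix elements of the difference of the true and the auxiliary Hamiltonian. -/
theorem norm_inner_difference_le (X : BlockPair S H Δ ψ) (u w : E) :
    ‖inner ℂ u ((H + Δ - (aligned S H + perpPart S H Δ)) w)‖
      ≤ 2 * cheegerRatio S Δ ψ * (‖u‖ * ‖w‖) + √(kappa H Δ * cheegerRatio S Δ ψ)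
        * (‖awayProj S H u‖ * ‖w‖ + ‖u‖ * ‖awayProj S H w‖) := by
  set h := cheegerRatio S Δ ψ
  set k := √(kappa H Δ * h)
  have hh : 0 < h := X.cheegerRatio_pos
  have hk : 0 ≤ k := Real.sqrt_nonneg _
  set u₁ := groundProj S H u with hu₁
  set u₂ := groundProj Sᗮ H u with hu₂
  set u₃ := awayProj S H u with hu₃
  set w₁ := groundProj S H w with hw₁
  set w₂ := groundProj Sᗮ H w with hw₂
  set w₃ := awayProj S H w with hw₃
  have eu : u = u₁ + u₂ + u₃ := by rw [hu₃, awayProj_apply]; abel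
  have ew : w = w₁ + w₂ + w₃ := by rw [hw₃, awayProj_apply]; abel
  have nu := norm_sq_eq_three S H u
  have nw := norm_sq_eq_three S H w
  rw [← hu₁, ← hu₂, ← hu₃] at nu
  rw [← hw₁, ← hw₂, ← hw₃] at nw
  have m₁ : u₁ ∈ groundSpace S H := groundProj_mem _ _ _
  have m₂ : u₂ ∈ groundSpace Sᗮ H := groundProj_mem _ _ _
  have l₁ : w₁ ∈ groundSpace S H := groundProj_mem _ _ _
  have l₂ : w₂ ∈ groundSpace Sᗮ H := groundProj_mem _ _ _
  have symΔ : ∀ x y, inner ℂ (Δ x) y = inner ℂ x (Δ y) := fun x y => X.symmΔ x y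
  have symM : ∀ x y, inner ℂ (awayProj S H x) y = inner ℂ x (awayProj S H y) := fun x y =>
    isSymmetric_awayProj S H x y
  have hMM : ∀ x, awayProj S H (awayProj S H x) = awayProj S H x := fun x =>
    DFunLike.congr_fun (awayProj_mul_self S H) x
  -- the four contributions
  set d : ℂ := ((groundEnergy S H - groundEnergy Sᗮ H : ℝ) : ℂ) with hd
  have e1 : (H + Δ - (aligned S H + perpPart S H Δ)) w
      = Δ w - awayProj S H (Δ w₃) - d • Sᗮ.starProjection w := by
    have : (H + Δ - (aligned S H + perpPart S H Δ)) w = H w + Δ w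
      - (H w + d • Sᗮ.starProjection w + awayProj S H (Δ (awayProj S H w))) := rfl
    rw [this, ← hw₃]; abel
  -- Δ^⊥ removes the coupling of u₃ to w₃, and antidiagonality removes those of u₁ to w₁ and u₂ to
  -- w₂. Every remaining term involves a local ground space.
  have e2 : inner ℂ u (Δ w) - inner ℂ u (awayProj S H (Δ w₃))
      = inner ℂ u₁ (Δ w₂) + inner ℂ u₂ (Δ w₁) + inner ℂ u₃ (awayProj S H (Δ (w₁ + w₂)))
        + inner ℂ (awayProj S H (Δ (u₁ + u₂))) w₃ := by
    have c1 : inner ℂ u (awayProj S H (Δ w₃)) = inner ℂ u₃ (Δ w₃) := by rw [hu₃, symM]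
    have c2 : inner ℂ u₃ (awayProj S H (Δ (w₁ + w₂))) = inner ℂ u₃ (Δ (w₁ + w₂)) := by
      rw [← symM, hu₃, hMM]
    have c3 : inner ℂ (awayProj S H (Δ (u₁ + u₂))) w₃ = inner ℂ (u₁ + u₂) (Δ w₃) := by
      rw [symM, hw₃, hMM, symΔ]
    have c4 : inner ℂ u (Δ w) = inner ℂ (u₁ + u₂ + u₃) (Δ w₁ + Δ w₂ + Δ w₃) := by
      rw [← map_add, ← map_add, ← eu, ← ew]
    have z1 := X.inner_apply_self (mem_groundSpace.1 m₁).1 (mem_groundSpace.1 l₁).1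
    have z2 := X.inner_apply_self' (mem_groundSpace.1 m₂).1 (mem_groundSpace.1 l₂).1
    rw [c1, c2, c3, c4, map_add]
    simp only [inner_add_left, inner_add_right, z1, z2]
    ring
  have b1 : ‖inner ℂ u₁ (Δ w₂)‖ ≤ h * (‖u₁‖ * ‖w₂‖) := X.norm_inner_ground_le m₁ l₂
  have b2 : ‖inner ℂ u₂ (Δ w₁)‖ ≤ h * (‖u₂‖ * ‖w₁‖) := by
    have := X.norm_inner_ground_le l₁ m₂
    rw [← symΔ, ← inner_conj_symm, RCLike.norm_conj, mul_comm ‖u₂‖]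
    exact this
  have b12 : h * (‖u₁‖ * ‖w₂‖) + h * (‖u₂‖ * ‖w₁‖) ≤ h * (‖u‖ * ‖w‖) := by
    rw [← mul_add]
    refine mul_le_mul_of_nonneg_left ?_ hh.le
    refine (sq_le_sq₀ (by positivity) (by positivity)).1 ?_
    rw [mul_pow, nu, nw]
    nlinarith [sq_nonneg (‖u₁‖ * ‖w₁‖ - ‖u₂‖ * ‖w₂‖),
      mul_nonneg (sq_nonneg ‖u₃‖) (sq_nonneg ‖w₃‖), mul_nonneg (sq_nonneg ‖u₃‖) (sq_nonneg ‖w₁‖),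
      mul_nonneg (sq_nonneg ‖u₃‖) (sq_nonneg ‖w₂‖), mul_nonneg (sq_nonneg ‖u₁‖) (sq_nonneg ‖w₃‖),
      mul_nonneg (sq_nonneg ‖u₂‖) (sq_nonneg ‖w₃‖)]
  have hsum : ∀ x, ‖groundProj S H x + groundProj Sᗮ H x‖ ≤ ‖x‖ := by
    intro x
    refine (sq_le_sq₀ (norm_nonneg _) (norm_nonneg _)).1 ?_
    have ho : inner ℂ (groundProj S H x) (groundProj Sᗮ H x) = 0 :=
      (mem_groundSpace.1 (groundProj_mem Sᗮ H x)).1 _ (mem_groundSpace.1 (groundProj_mem S H x)).1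
    rw [norm_sq_eq_three S H x, sq,
      norm_add_sq_eq_norm_sq_add_norm_sq_of_inner_eq_zero (𝕜 := ℂ) _ _ ho]
    nlinarith [sq_nonneg ‖awayProj S H x‖]
  have b3 : ‖inner ℂ u₃ (awayProj S H (Δ (w₁ + w₂)))‖ ≤ k * (‖u₃‖ * ‖w‖) := by
    refine (norm_inner_le_norm _ _).trans ?_
    calc _ ≤ ‖u₃‖ * (k * ‖w‖) := by
          gcongr
          exact (X.norm_away_ground_le l₁ l₂).trans (by gcongr; exact hsum w)
      _ = _ := by ring
  have b4 : ‖inner ℂ (awayProj S H (Δ (u₁ + u₂))) w₃‖ ≤ k * (‖u‖ * ‖w₃‖) := by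
    refine (norm_inner_le_norm _ _).trans ?_
    calc _ ≤ k * ‖u‖ * ‖w₃‖ := by
          gcongr
          exact (X.norm_away_ground_le m₁ m₂).trans (by gcongr; exact hsum u)
      _ = _ := by ring
  -- Both local ground energies lie in [λ, λ + h], so the alignment shift is at most h. With `b12`
  -- this makes the 2h in the bound.
  have b5 : ‖inner ℂ u (d • Sᗮ.starProjection w)‖ ≤ h * (‖u‖ * ‖w‖) := by
    have hd' : ‖d‖ ≤ h := by
      rw [hd, Complex.norm_real, Real.norm_eq_abs, abs_le]
      have := X.groundEnergy_le
      have := X.groundEnergy_le'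
      have := X.energy_le_groundEnergy
      have := X.energy_le_groundEnergy'
      constructor <;> linarith
    rw [inner_smul_right, norm_mul]
    exact mul_le_mul hd' ((norm_inner_le_norm _ _).trans (mul_le_mul_of_nonneg_left
      (Submodule.norm_starProjection_apply_le _ w) (norm_nonneg _))) (norm_nonneg _) hh.le
  rw [e1, inner_sub_right, inner_sub_right, e2]
  have t1 := norm_sub_le (inner ℂ u₁ (Δ w₂) + inner ℂ u₂ (Δ w₁)
    + inner ℂ u₃ (awayProj S H (Δ (w₁ + w₂))) + inner ℂ (awayProj S H (Δ (u₁ + u₂))) w₃)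
    (inner ℂ u (d • Sᗮ.starProjection w))
  have t2 := norm_add_le (inner ℂ u₁ (Δ w₂) + inner ℂ u₂ (Δ w₁)
    + inner ℂ u₃ (awayProj S H (Δ (w₁ + w₂)))) (inner ℂ (awayProj S H (Δ (u₁ + u₂))) w₃)
  have t3 := norm_add₃_le (a := inner ℂ u₁ (Δ w₂)) (b := inner ℂ u₂ (Δ w₁))
    (c := inner ℂ u₃ (awayProj S H (Δ (w₁ + w₂))))
  linarith

end BlockPair

/-! ### The tunneling estimate -/

theorem isSymmetric_real_smul {A : E →L[ℂ] E} (hA : (A : E →ₗ[ℂ] E).IsSymmetric) (T : ℝ) :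
    (((T : ℂ) • A : E →L[ℂ] E) : E →ₗ[ℂ] E).IsSymmetric := by
  intro y z
  change inner ℂ ((T : ℂ) • A y) z = inner ℂ y ((T : ℂ) • A z)
  have : inner ℂ (A y) z = inner ℂ y (A z) := hA y z
  rw [inner_smul_left, inner_smul_right, this, Complex.conj_ofReal]

/-- Two unitary evolutions separate at a rate given by the matrix elements of the difference of
their generators. -/
theorem norm_sub_sq_le_of_evolutions {T : ℝ} (hT : 0 < T) {A C U W : ℝ → E →L[ℂ] E}
    (hA : ∀ s ∈ Icc (0 : ℝ) 1, (A s : E →ₗ[ℂ] E).IsSymmetric)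
    (hC : ∀ s ∈ Icc (0 : ℝ) 1, (C s : E →ₗ[ℂ] E).IsSymmetric)
    (hU : IsEvolution (fun s => (T : ℂ) • A s) U) (hW : IsEvolution (fun s => (T : ℂ) • C s) W)
    {x : E} {b : ℝ} (hb : ∀ s ∈ Icc (0 : ℝ) 1,
      2 * (T * ‖inner ℂ (U s x) ((A s - C s) (W s x))‖) ≤ b) :
    ‖U 1 x - W 1 x‖ ^ 2 ≤ b := by
  have hb0 : 0 ≤ b := le_trans (by positivity) (hb 0 (by simp))
  have hd : ∀ t ∈ Icc (0 : ℝ) 1, HasDerivWithinAt (fun t => ‖U t x - W t x‖ ^ 2)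
      (2 * (inner ℂ (U t x - W t x) (-Complex.I • ((T : ℂ) • A t) (U t x)
        - -Complex.I • ((T : ℂ) • C t) (W t x))).re) (Icc (0 : ℝ) 1) t := fun t ht =>
    hasDerivWithinAt_norm_sq ((hU.hasDerivWithinAt_apply x ht).sub (hW.hasDerivWithinAt_apply x ht))
  have hle : ∀ t ∈ Icc (0 : ℝ) 1, 2 * (inner ℂ (U t x - W t x)
      (-Complex.I • ((T : ℂ) • A t) (U t x) - -Complex.I • ((T : ℂ) • C t) (W t x))).re ≤ b := by
    intro t ht
    set u := U t x
    set w := W t x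
    have h1 := re_inner_I_smul_eq_zero (isSymmetric_real_smul (hA t ht) T) (u - w)
    have h2 := re_inner_I_smul_eq_zero (isSymmetric_real_smul (hA t ht) T) w
    have h3 := re_inner_I_smul_eq_zero (isSymmetric_real_smul (hC t ht) T) w
    have e1 : -Complex.I • ((T : ℂ) • A t) u - -Complex.I • ((T : ℂ) • C t) w
        = -Complex.I • ((T : ℂ) • A t) (u - w) + (-Complex.I * T) • (A t - C t) w := by
      simp only [smul_apply, sub_apply, map_sub]
      module
    -- The expectation of the Hermitian difference in w is real, so it contributes no growth, and u
    -- - w may be replaced by u in the first slot.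
    have e2 : (inner ℂ w ((-Complex.I * T) • (A t - C t) w)).re = 0 := by
      have : (-Complex.I * (T : ℂ)) • (A t - C t) w
          = -Complex.I • ((T : ℂ) • A t) w - -Complex.I • ((T : ℂ) • C t) w := by
        simp only [smul_apply, sub_apply]
        module
      rw [this, inner_sub_right, Complex.sub_re, h2, h3, sub_zero]
    have e3 : (inner ℂ u ((-Complex.I * T) • (A t - C t) w)).re
        ≤ T * ‖inner ℂ u ((A t - C t) w)‖ := by
      refine (Complex.re_le_norm _).trans (le_of_eq ?_)
      rw [inner_smul_right, norm_mul, norm_mul, norm_neg, Complex.norm_I, one_mul,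
        Complex.norm_real, Real.norm_eq_abs, abs_of_pos hT]
    rw [e1, inner_add_right, Complex.add_re, h1, zero_add, inner_sub_left, Complex.sub_re, e2,
      sub_zero]
    have := hb t ht
    linarith
  have h := le_add_of_hasDerivWithinAt_le hb0 hd hle (show (1 : ℝ) ∈ Icc (0 : ℝ) 1 by simp)
  rw [hU.1, hW.1, sub_self, norm_zero] at h
  simpa using h

/-- The true evolution follows the auxiliary one. -/
theorem norm_true_sub_auxiliary_le {S : Submodule ℂ E} {T : ℝ} (hT : 0 < T)
    {H Δ : ℝ → E →L[ℂ] E} {ψ : ℝ → E}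
    (X : ∀ s ∈ Icc (0 : ℝ) 1, BlockPair S (H s) (Δ s) (ψ s))
    {U W : ℝ → E →L[ℂ] E} (hU : IsEvolution (trueGenerator T H Δ) U)
    (hW : IsEvolution (perpGenerator T S H Δ) W) {M : ℝ}
    (hM : ∀ s ∈ Icc (0 : ℝ) 1,
      2 * √(cheegerRatio S (Δ s) (ψ s) * T * tunnelFactor S H Δ ψ U W s) ≤ M)
    {x : E} (hx : x ∈ groundSpace S (H 0)) : ‖U 1 x - W 1 x‖ ≤ M * ‖x‖ := by
  have m0 : (0 : ℝ) ∈ Icc (0 : ℝ) 1 := by simp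
  have hM0 : 0 ≤ M := le_trans (by positivity) (hM 0 m0)
  have hA : ∀ s ∈ Icc (0 : ℝ) 1, ((H s + Δ s : E →L[ℂ] E) : E →ₗ[ℂ] E).IsSymmetric :=
    fun s hs => (X s hs).symm_add
  have hC : ∀ s ∈ Icc (0 : ℝ) 1, ((aligned S (H s) + perpPart S (H s) (Δ s) : E →L[ℂ] E)
      : E →ₗ[ℂ] E).IsSymmetric := fun s hs =>
    isSymmetric_add (isSymmetric_aligned (X s hs).symmH) (isSymmetric_perpPart (X s hs).symmΔ)
  refine (sq_le_sq₀ (norm_nonneg _) (by positivity)).1 ?_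
  refine norm_sub_sq_le_of_evolutions hT hA hC hU hW fun s hs => ?_
  have Y := X s hs
  have hun : ‖U s x‖ ≤ ‖x‖ := hU.norm_apply_le (fun t ht => isSymmetric_real_smul (hA t ht) T) x hs
  have hwn : ‖W s x‖ ≤ ‖x‖ := hW.norm_apply_le (fun t ht => isSymmetric_real_smul (hC t ht) T) x hs
  have hPx : groundProj S (H 0) x = x := Submodule.starProjection_eq_self_iff.2 hx
  set h := cheegerRatio S (Δ s) (ψ s) with hh
  have hpos : 0 < h := Y.cheegerRatio_pos
  set k := kappa (H s) (Δ s) with hk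
  have hk0 : 0 ≤ k := norm_nonneg _
  set ε := leakage S H Δ ψ U W s with hε
  have hε0 : 0 ≤ ε := le_max_of_le_left (norm_nonneg _)
  set q₀ := mismatch S (H 0) (Δ 0) (ψ 0) with hq₀
  set q := mismatch S (H s) (Δ s) (ψ s) with hq
  have hq₀0 : 0 ≤ q₀ := Real.sqrt_nonneg _
  have hq0 : 0 ≤ q := Real.sqrt_nonneg _
  have hw : ‖awayProj S (H s) (W s x)‖ ≤ ε * ‖x‖ := by
    have e : awayProj S (H s) (W s x) = (awayProj S (H s) * W s * groundProj S (H 0)) x := by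
      rw [mul_apply_eq_comp, mul_apply_eq_comp, hPx]
    rw [e]
    exact (ContinuousLinearMap.le_opNorm _ x).trans (by gcongr; exact le_max_right _ _)
  -- The leakage is measured on the initial low-energy space, while x is in the local ground space;
  -- q₀ pays for the difference at time 0, and q for the converse passage at time s.
  have hu1 : ‖(1 - globalLowProj S H Δ ψ s) (U s x)‖ ≤ (ε + q₀) * ‖x‖ := by
    have e : (1 - globalLowProj S H Δ ψ s) (U s x)
        = ((1 - globalLowProj S H Δ ψ s) * U s * globalLowProj S H Δ ψ 0) x
          + (1 - globalLowProj S H Δ ψ s) (U s ((1 - globalLowProj S H Δ ψ 0) x)) := by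
      rw [mul_apply_eq_comp, mul_apply_eq_comp, ← map_add, ← map_add]
      congr 2
      rw [sub_apply, one_apply_eq_self]; abel
    rw [e, add_mul]
    refine (norm_add_le _ _).trans (add_le_add ?_ ?_)
    · exact (ContinuousLinearMap.le_opNorm _ x).trans (by gcongr; exact le_max_left _ _)
    · refine (norm_one_sub_lowProj_apply_le _ _ _).trans ?_
      refine (hU.norm_apply_le (fun t ht => isSymmetric_real_smul (hA t ht) T) _ hs).trans ?_
      exact (X 0 m0).norm_sub_lowProj_le hx
  have hu : ‖awayProj S (H s) (U s x)‖ ≤ (ε + q₀ + q) * ‖x‖ := by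
    have e : awayProj S (H s) (U s x)
        = awayProj S (H s) ((1 - globalLowProj S H Δ ψ s) (U s x))
          + awayProj S (H s) (globalLowProj S H Δ ψ s (U s x)) := by
      rw [← map_add]
      congr 1
      rw [sub_apply, one_apply_eq_self]; abel
    rw [e, add_mul]
    refine (norm_add_le _ _).trans (add_le_add ((norm_awayProj_apply_le _ _ _).trans hu1) ?_)
    exact (Y.norm_awayProj_lowProj_le (U s x)).trans (by gcongr)
  have hJ := Y.norm_inner_difference_le (U s x) (W s x)
  rw [← hh, ← hk] at hJ
  have hsq : √(k * h) = h * √(k / h) := by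
    rw [Real.sqrt_div hk0, Real.sqrt_mul hk0, mul_div_assoc', eq_div_iff (Real.sqrt_pos.2 hpos).ne',
      mul_assoc, Real.mul_self_sqrt hpos.le, mul_comm]
  set z := √(k / h) with hz
  have hz0 : 0 ≤ z := Real.sqrt_nonneg _
  have hB : tunnelFactor S H Δ ψ U W s
      = 1 + (q₀ + q) / 2 + (q₀ + q) / 2 * z + ε * (1 + z) := rfl
  have hJ' : ‖inner ℂ (U s x) ((H s + Δ s - (aligned S (H s) + perpPart S (H s) (Δ s))) (W s x))‖
      ≤ 2 * h * tunnelFactor S H Δ ψ U W s * ‖x‖ ^ 2 := by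
    -- The leakages of U x and W x sum to 2ε + q₀ + q. Extracting 2h turns this into ε plus the mean
    -- mismatch, which is why the mean occurs in B.
    calc _ ≤ 2 * h * (‖x‖ * ‖x‖) + h * z * ((ε + q₀ + q) * ‖x‖ * ‖x‖ + ‖x‖ * (ε * ‖x‖)) := by
          rw [hsq] at hJ
          refine hJ.trans ?_
          gcongr
      _ = 2 * h * (1 + (q₀ + q) / 2 * z + ε * z) * ‖x‖ ^ 2 := by ring
      _ ≤ 2 * h * tunnelFactor S H Δ ψ U W s * ‖x‖ ^ 2 := by
          have hle : 1 + (q₀ + q) / 2 * z + ε * z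
              ≤ 1 + (q₀ + q) / 2 + (q₀ + q) / 2 * z + ε * (1 + z) := by
            rw [mul_add, mul_one]; linarith
          rw [hB]
          exact mul_le_mul_of_nonneg_right (mul_le_mul_of_nonneg_left hle (by positivity))
            (sq_nonneg _)
  have hB0 : 0 ≤ tunnelFactor S H Δ ψ U W s := by rw [hB]; positivity
  have hM2 : 4 * (h * T * tunnelFactor S H Δ ψ U W s) ≤ M ^ 2 := by
    have h1 := pow_le_pow_left₀ (by positivity) (hM s hs) 2
    rw [mul_pow, Real.sq_sqrt (by positivity)] at h1
    linarith
  calc _ ≤ 2 * (T * (2 * h * tunnelFactor S H Δ ψ U W s * ‖x‖ ^ 2)) := by gcongr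
    _ = 4 * (h * T * tunnelFactor S H Δ ψ U W s) * ‖x‖ ^ 2 := by ring
    _ ≤ M ^ 2 * ‖x‖ ^ 2 := by gcongr
    _ = (M * ‖x‖) ^ 2 := by ring

end LocalAdiabatic

end

/-! ### Combining the tunneling and adiabatic errors -/

theorem mainTheorem1 {E : Type*} [NormedAddCommGroup E] [InnerProductSpace ℂ E]
    [FiniteDimensional ℂ E] (S : Submodule ℂ E)
    (hS : 2 ≤ Module.finrank ℂ S) (hS' : 2 ≤ Module.finrank ℂ Sᗮ)
    (T : ℝ) (hT : 0 < T)
    (H Δ : ℝ → E →L[ℂ] E)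
    -- `H(s)` and `Δ(s)` are Hermitian, block diagonal and block antidiagonal respectively
    (hHsymm : ∀ s ∈ Set.Icc (0 : ℝ) 1, (H s : E →ₗ[ℂ] E).IsSymmetric)
    (hΔsymm : ∀ s ∈ Set.Icc (0 : ℝ) 1, (Δ s : E →ₗ[ℂ] E).IsSymmetric)
    (hHdiag : ∀ s ∈ Set.Icc (0 : ℝ) 1, H s * S.starProjection = S.starProjection * H s)
    (hΔanti : ∀ s ∈ Set.Icc (0 : ℝ) 1, Δ s * S.starProjection = Sᗮ.starProjection * Δ s)
    -- regularity
    (hHdiff : DifferentiableOn ℝ H (Set.Icc 0 1))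
    (hHdiff2 : DifferentiableOn ℝ (LocalAdiabatic.dot H) (Set.Icc 0 1))
    (hΔdiff : DifferentiableOn ℝ Δ (Set.Icc 0 1))
    -- the smallest eigenvalues of `H + Δ` and of the two blocks of `H` are simple
    (hground : ∀ s ∈ Set.Icc (0 : ℝ) 1,
      Module.finrank ℂ (LocalAdiabatic.groundSpace ⊤ (H s + Δ s)) = 1)
    (hgroundS : ∀ s ∈ Set.Icc (0 : ℝ) 1,
      Module.finrank ℂ (LocalAdiabatic.groundSpace S (H s)) = 1)
    (hgroundS' : ∀ s ∈ Set.Icc (0 : ℝ) 1,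
      Module.finrank ℂ (LocalAdiabatic.groundSpace Sᗮ (H s)) = 1)
    -- `ψ(s)` is a normalized ground vector of `H + Δ`, with a component in each block
    (ψ : ℝ → E)
    (hψ : ∀ s ∈ Set.Icc (0 : ℝ) 1,
      ψ s ∈ LocalAdiabatic.groundSpace ⊤ (H s + Δ s) ∧ ‖ψ s‖ = 1)
    (hψS : ∀ s ∈ Set.Icc (0 : ℝ) 1, S.starProjection (ψ s) ≠ 0)
    (hψS' : ∀ s ∈ Set.Icc (0 : ℝ) 1, Sᗮ.starProjection (ψ s) ≠ 0)
    -- the two spectral assumptions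
    (hA1 : ∀ s ∈ Set.Icc (0 : ℝ) 1,
      max (LocalAdiabatic.groundEnergy S (H s)) (LocalAdiabatic.groundEnergy Sᗮ (H s)) <
        min (LocalAdiabatic.excitedEnergy S (H s)) (LocalAdiabatic.excitedEnergy Sᗮ (H s)))
    (hA2 : ∀ s ∈ Set.Icc (0 : ℝ) 1,
      LocalAdiabatic.relSize S (H s) (Δ s) ≤
        1 - LocalAdiabatic.cheegerRatio S (Δ s) (ψ s) / LocalAdiabatic.minGap S (H s))
    -- the true, the auxiliary and the adiabatic evolution
    (U W V : ℝ → E →L[ℂ] E)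
    (hU : LocalAdiabatic.IsEvolution (LocalAdiabatic.trueGenerator T H Δ) U)
    (hW : LocalAdiabatic.IsEvolution (LocalAdiabatic.perpGenerator T S H Δ) W)
    (hV : LocalAdiabatic.IsEvolution (LocalAdiabatic.adiabaticGenerator T S H) V) :
    -- the bound by the sum of three suprema over `[0,1]`, each expressed by its upper bounds
    ∀ M₁ M₂ M₃ : ℝ,
      (∀ s ∈ Set.Icc (0 : ℝ) 1,
        2 * √(LocalAdiabatic.cheegerRatio S (Δ s) (ψ s) * T *
          LocalAdiabatic.tunnelFactor S H Δ ψ U W s) ≤ M₁) →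
      (∀ s ∈ Set.Icc (0 : ℝ) 1,
        1 / (LocalAdiabatic.eta S (H s) (Δ s) * T) *
          LocalAdiabatic.adiabaticBoundary S H s ≤ M₂) →
      (∀ s ∈ Set.Icc (0 : ℝ) 1,
        1 / (LocalAdiabatic.eta S (H s) (Δ s) * T) *
          LocalAdiabatic.adiabaticBulk S H Δ s ≤ M₃) →
      ‖(U 1 - V 1) * LocalAdiabatic.groundProj S (H 0)‖ ≤ M₁ + M₂ + M₃ := by
  intro M₁ M₂ M₃ hM₁ hM₂ hM₃
  have X : ∀ s ∈ Set.Icc (0 : ℝ) 1, LocalAdiabatic.BlockPair S (H s) (Δ s) (ψ s) := fun s hs =>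
    { symmH := hHsymm s hs
      symmΔ := hΔsymm s hs
      diag := hHdiag s hs
      anti := hΔanti s hs
      simple := hground s hs
      simpleS := hgroundS s hs
      simpleS' := hgroundS' s hs
      ground := (hψ s hs).1
      projS := hψS s hs
      projS' := hψS' s hs
      separated := hA1 s hs
      small := hA2 s hs }
  have key : ∀ x ∈ LocalAdiabatic.groundSpace S (H 0),
      ‖U 1 x - V 1 x‖ ≤ (M₁ + M₂ + M₃) * ‖x‖ := by
    intro x hx
    have h1 := LocalAdiabatic.norm_true_sub_auxiliary_le hT X hU hW hM₁ hx
    have h2 := LocalAdiabatic.norm_auxiliary_sub_adiabatic_le hT hHsymm hΔsymm hHdiag hHdiff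
      hHdiff2 hΔdiff hgroundS hgroundS' (fun s hs => (X s hs).gap_pos)
      (fun s hs => (X s hs).gap_pos') (fun s hs => (X s hs).eta_pos) hW hV hM₂ hM₃
      (Submodule.starProjection_eq_self_iff.2 hx)
    have h3 := norm_sub_le_norm_sub_add_norm_sub (U 1 x) (W 1 x) (V 1 x)
    linarith
  -- The operator-norm bound needs a nonnegative constant; evaluating `key` at a unit ground vector
  -- provides it.
  have hpos : 0 ≤ M₁ + M₂ + M₃ := by
    obtain ⟨φ, hφ, h1, -⟩ := LocalAdiabatic.exists_unit_groundSpace (hgroundS 0 (by simp))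
    have h2 := key φ hφ
    rw [h1, mul_one] at h2
    exact (norm_nonneg _).trans h2
  refine ContinuousLinearMap.opNorm_le_bound _ hpos fun y => ?_
  refine (key _ (LocalAdiabatic.groundProj_mem S (H 0) y)).trans ?_
  exact mul_le_mul_of_nonneg_left (LocalAdiabatic.norm_groundProj_apply_le S (H 0) y) hpos
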